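/- Let $M>0$ and let the Schwarzschild exterior $\mathbb{R}_t\times(2M,\infty)_r\times S^2$ carry the metric $$g=(1-2M/r)\,dt^2-(1-2M/r)^{-1}dr^2-r^2(d\theta^2+\sin^2\theta\,d\phi^2).$$ Let $F_{ab}$ be a smooth real $2$-form on the exterior with $\nabla^aF_{ab}=0$ and $\nabla_{[a}F_{bc]}=0$. Put $\xi=\partial_t$, $U_a=-r^{-1}\nabla_a r$, $Y_{ab}=-2r^3\sin\theta\,d\theta_{[a}d\phi_{b]}$, and $$Z_{ab}=-\tfrac43\,{*F}_{[a}{}^{c}Y_{b]c},\qquad \beta_a=-\tfrac12U^bZ_{ab}-\tfrac i2U^b\,{*Z}_{ab}-\tfrac12\nabla_bZ_a{}^b-\tfrac i2\nabla_b{*Z}_a{}^b,\qquad \mathbf H_{ab}=\beta_{(a}\bar\beta_{b)}-\tfrac12g_{ab}\beta^c\bar\beta_c .$$ With $$A^a=\frac{(r-3M)(r-2M)}{2r^2}(\partial_r)^a,\qquad q=\frac{9M^2(r-2M)(2r-3M)}{4r^5},$$ let $$\mathbf P_a=\mathbf H_{ab}A^b+\tfrac14q\beta^bZ_{ab}+\tfrac14q\bar\beta^bZ_{ab}-\tfrac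 i4q\beta^b\,{*Z}_{ab}+\tfrac i4q\bar\beta^b\,{*Z}_{ab}+\tfrac1{16}Z_{bc}Z^{bc}\nabla_aq-\tfrac14Z_a{}^cZ_{bc}\nabla^bq .$$ For a smooth spacelike hypersurface $\Sigma$ with future-directed unit normal $N^a$ ($N^aN_a=1$) and induced volume element $d\mu_\Sigma$, let $$E_\xi(\Sigma)=\int_\Sigma\mathbf H_{ab}\xi^bN^a\,d\mu_\Sigma,\qquad E_{\xi+A,q}(\Sigma)=\int_\Sigma(\mathbf H_{ab}\xi^b+\mathbf P_a)N^a\,d\mu_\Sigma .$$ Let $\Sigma$ be a spherically symmetric spacelike slice of the exterior, that is, an $SO(3)$-invariant spacelike hypersurface which is the graph $t=h(x)$ of a smooth function over an open subset of $(2M,\infty)\times S^2$. Then the integral defining $E_\xi(\Sigma)$ converges absolutely if and only if the integral defining $E_{\xi+A,q}(\Sigma)$ does, and in that case $$\tfrac1{10}E_\xi(\Sigma)\le E_{\xi+A,q}(\Sigma)\le\tfrac{19}{10}E_\xi(\Sigma).$$ -/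

import Mathlib

open MeasureTheory
open scoped ContDiff

noncomputable section

namespace Schwarzschild

/-! The exterior of the Schwarzschild black hole of mass `M` is the manifold
`ℝ × (2M, ∞) × S²`. Writing `x = r ω ∈ ℝ³` (with `ω ∈ S²`) identifies it with the open set
`{(t, x) : 2M < |x|}` of `ℝ × ℝ³`, so that `(t, x¹, x², x³)` is a global smooth chart (regular
also on the axis of the spherical coordinates). All tensors are given by their components in
this chart; the index `0` is `t`, and the indices `1, 2, 3` are `x¹, x², x³`.
The signature is `(+, -, -, -)`. -/

/-- Coordinates `(t, x¹, x², x³)` of a spacetime point. -/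
abbrev Point : Type := Fin 4 → ℝ

/-- Euclidean three-space, the range of `x = r ω`. -/
abbrev Space : Type := EuclideanSpace ℝ (Fin 3)

/-- The spacetime point with time coordinate `t` and space coordinates `x`. -/
def point (t : ℝ) (x : Space) : Point := ![t, x 0, x 1, x 2]

/-- The area radius `r`. -/
def radius (p : Point) : ℝ := Real.sqrt (p 1 ^ 2 + p 2 ^ 2 + p 3 ^ 2)

/-- The exterior region `r > 2M`. -/
def exterior (M : ℝ) : Set Point := {p | 2 * M < radius p}

/-- The coordinate derivative `∂_a f`. -/
def pd (a : Fin 4) (f : Point → ℝ) (p : Point) : ℝ := fderiv ℝ f p (Pi.single a 1)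

/-- The components of the one-form `dt`. -/
def dt (a : Fin 4) : ℝ := if a = 0 then 1 else 0

/-- The components of the one-form `dr`; as `r dr = x · dx`, they are `(0, x / r)`. -/
def dr (p : Point) (a : Fin 4) : ℝ := if a = 0 then 0 else p a / radius p

/-- The components of `r² (dθ² + sin² θ dφ²) = |dx|² - dr²`. -/
def sphereMetric (p : Point) (a b : Fin 4) : ℝ :=
  (if a = b ∧ a ≠ 0 then 1 else 0) - dr p a * dr p b

/-- The Schwarzschild metric
`g = (1 - 2M/r) dt² - (1 - 2M/r)⁻¹ dr² - r² (dθ² + sin² θ dφ²)`. -/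
def metric (M : ℝ) (p : Point) : Matrix (Fin 4) (Fin 4) ℝ := fun a b =>
  (1 - 2 * M / radius p) * dt a * dt b
    - (1 - 2 * M / radius p)⁻¹ * dr p a * dr p b - sphereMetric p a b

/-- The inverse metric `g^{ab}`. -/
def invMetric (M : ℝ) (p : Point) : Matrix (Fin 4) (Fin 4) ℝ := (metric M p)⁻¹

/-- The Christoffel symbol `Γ^a_{bc}` of the Levi-Civita connection. -/
def christoffel (M : ℝ) (p : Point) (a b c : Fin 4) : ℝ :=
  1 / 2 * ∑ d, invMetric M p a d *
    (pd b (fun y => metric M y d c) p + pd c (fun y => metric M y d b) p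
      - pd d (fun y => metric M y b c) p)

/-- A field of covariant tensors of rank two. -/
abbrev TensorField : Type := Point → Fin 4 → Fin 4 → ℝ

/-- The covariant derivative `∇_c T_{ab}`. -/
def covDeriv (M : ℝ) (T : TensorField) (p : Point) (c a b : Fin 4) : ℝ :=
  pd c (fun y => T y a b) p
    - ∑ d, christoffel M p d c a * T p d b - ∑ d, christoffel M p d c b * T p a d

/-- The divergence `∇_b T_a{}^b = g^{bc} ∇_c T_{ab}` over the second index. -/
def divSnd (M : ℝ) (T : TensorField) (p : Point) (a : Fin 4) : ℝ :=
  ∑ b, ∑ c, invMetric M p b c * covDeriv M T p c a b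

/-- The totally antisymmetric symbol with value `1` at `(0, 1, 2, 3)`. -/
def leviCivita (a b c d : Fin 4) : ℝ :=
  Matrix.det (Matrix.of fun i j : Fin 4 => if ![a, b, c, d] i = j then (1 : ℝ) else 0)

/-- The volume form `e_{abcd}`. -/
def volForm (M : ℝ) (p : Point) (a b c d : Fin 4) : ℝ :=
  Real.sqrt |(metric M p).det| * leviCivita a b c d

/-- The Hodge dual `*T_{ab} = ½ e_{abcd} T^{cd}` of a two-form. -/
def hodge (M : ℝ) (T : TensorField) : TensorField := fun p a b =>
  1 / 2 * ∑ c, ∑ d, ∑ e, ∑ f,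
    volForm M p a b c d * invMetric M p c e * invMetric M p d f * T p e f

/-- `F` is a (test) Maxwell field on the exterior: a smooth real two-form with
`∇^a F_{ab} = 0` and `∇_{[a} F_{bc]} = 0`. -/
structure IsMaxwellField (M : ℝ) (F : TensorField) : Prop where
  smooth : ∀ a b, ContDiffOn ℝ ∞ (fun p => F p a b) (exterior M)
  antisymm : ∀ p ∈ exterior M, ∀ a b, F p a b = -F p b a
  divergence_free : ∀ p ∈ exterior M, ∀ b,
    ∑ a, ∑ c, invMetric M p a c * covDeriv M F p c a b = 0
  closed : ∀ p ∈ exterior M, ∀ a b c,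
    covDeriv M F p a b c + covDeriv M F p b c a + covDeriv M F p c a b = 0

/-- The Killing-Yano tensor
`Y_{ab} = -2 r³ sin θ dθ_{[a} dφ_{b]} = - r³ sin θ (dθ_a dφ_b - dφ_a dθ_b)`. The form
`r² sin θ dθ ∧ dφ` is the area form of the spheres, with components `ε_{ijk} x^k / r`. -/
def killingYano (p : Point) (a b : Fin 4) : ℝ := -∑ c, leviCivita 0 a b c * p c

/-- The mixed contraction `*F_a{}^c Y_{bc}`. -/
def starFY (M : ℝ) (F : TensorField) (p : Point) (a b : Fin 4) : ℝ :=
  ∑ c, ∑ d, hodge M F p a d * invMetric M p d c * killingYano p b c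

/-- The two-form `Z_{ab} = -(4/3) *F_{[a}{}^c Y_{b]c}`. -/
def Z (M : ℝ) (F : TensorField) : TensorField := fun p a b =>
  -(4 / 3) * (1 / 2 * (starFY M F p a b - starFY M F p b a))

/-- The one-form `U_a = - r⁻¹ ∇_a r`. -/
def U (p : Point) (a : Fin 4) : ℝ := -(radius p)⁻¹ * pd a radius p

/-- The vector `U^a`. -/
def Uup (M : ℝ) (p : Point) (a : Fin 4) : ℝ := ∑ b, invMetric M p a b * U p b

/-- The complex one-form
`β_a = -½ U^b Z_{ab} - ½ i U^b *Z_{ab} - ½ ∇_b Z_a{}^b - ½ i ∇_b *Z_a{}^b`. -/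
def beta (M : ℝ) (F : TensorField) (p : Point) (a : Fin 4) : ℂ :=
  -(1 / 2) * ((∑ b, Uup M p b * Z M F p a b : ℝ) : ℂ)
    - 1 / 2 * Complex.I * ((∑ b, Uup M p b * hodge M (Z M F) p a b : ℝ) : ℂ)
    - 1 / 2 * ((divSnd M (Z M F) p a : ℝ) : ℂ)
    - 1 / 2 * Complex.I * ((divSnd M (hodge M (Z M F)) p a : ℝ) : ℂ)

/-- The complex vector `β^a`. -/
def betaUp (M : ℝ) (F : TensorField) (p : Point) (a : Fin 4) : ℂ :=
  ∑ b, (invMetric M p a b : ℂ) * beta M F p b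

/-- The superenergy tensor `H_{ab} = β_{(a} β̄_{b)} - ½ g_{ab} β^c β̄_c`; note that
`β_{(a} β̄_{b)} = Re (β_a β̄_b)`, and that `β^c β̄_c` is real. -/
def H (M : ℝ) (F : TensorField) (p : Point) (a b : Fin 4) : ℝ :=
  (beta M F p a * star (beta M F p b)).re
    - 1 / 2 * metric M p a b * (∑ c, betaUp M F p c * star (beta M F p c)).re

/-- The static Killing field `ξ = ∂_t`. -/
def xi (_p : Point) (a : Fin 4) : ℝ := if a = 0 then 1 else 0

/-- The radial vector field `A = (r - 3M) (r - 2M) / (2 r²) ∂_r`; the components of `∂_r`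
are `(0, x / r)`. -/
def A (M : ℝ) (p : Point) (a : Fin 4) : ℝ :=
  (radius p - 3 * M) * (radius p - 2 * M) / (2 * radius p ^ 2)
    * (if a = 0 then 0 else p a / radius p)

/-- The scalar field `q = 9 M² (r - 2M) (2r - 3M) / (4 r⁵)`. -/
def q (M : ℝ) (p : Point) : ℝ :=
  9 * M ^ 2 * (radius p - 2 * M) * (2 * radius p - 3 * M) / (4 * radius p ^ 5)

/-- The terms of the Morawetz current that are linear in `β` (their sum is real):
`¼ q β^b Z_{ab} + ¼ q β̄^b Z_{ab} - ¼ i q β^b *Z_{ab} + ¼ i q β̄^b *Z_{ab}`. -/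
def crossTerm (M : ℝ) (F : TensorField) (p : Point) (a : Fin 4) : ℂ :=
  ∑ b, (1 / 4 * (q M p : ℂ) * betaUp M F p b * (Z M F p a b : ℂ)
    + 1 / 4 * (q M p : ℂ) * star (betaUp M F p b) * (Z M F p a b : ℂ)
    - 1 / 4 * Complex.I * (q M p : ℂ) * betaUp M F p b * (hodge M (Z M F) p a b : ℂ)
    + 1 / 4 * Complex.I * (q M p : ℂ) * star (betaUp M F p b) * (hodge M (Z M F) p a b : ℂ))

/-- The contraction `Z_a{}^c Z_{bc}`. -/
def ZZ (M : ℝ) (F : TensorField) (p : Point) (a b : Fin 4) : ℝ :=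
  ∑ c, ∑ d, Z M F p a d * invMetric M p d c * Z M F p b c

/-- The Morawetz current
`P_a = H_{ab} A^b + ¼ q β^b Z_{ab} + ¼ q β̄^b Z_{ab} - ¼ i q β^b *Z_{ab} + ¼ i q β̄^b *Z_{ab}
  + (1/16) Z_{bc} Z^{bc} ∇_a q - ¼ Z_a{}^c Z_{bc} ∇^b q`. -/
def P (M : ℝ) (F : TensorField) (p : Point) (a : Fin 4) : ℝ :=
  (∑ b, H M F p a b * A M p b) + (crossTerm M F p a).re
    + 1 / 16 * (∑ b, ∑ c, invMetric M p b c * ZZ M F p b c) * pd a (q M) p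
    - 1 / 4 * ∑ b, ∑ c, ZZ M F p a b * invMetric M p b c * pd c (q M) p

/-- The derivative `∂_i h` of a function on space. -/
def spd (i : Fin 3) (h : Space → ℝ) (x : Space) : ℝ :=
  fderiv ℝ h x (EuclideanSpace.single i 1)

/-- The tangent vector `∂_i (h(x), x)` of the graph `t = h(x)`. -/
def graphTangent (h : Space → ℝ) (x : Space) (i : Fin 3) : Fin 4 → ℝ :=
  point (spd i h x) (EuclideanSpace.single i 1)

/-- The metric induced on the graph `t = h(x)`, in the coordinates `x`. -/
def inducedMetric (M : ℝ) (h : Space → ℝ) (x : Space) : Matrix (Fin 3) (Fin 3) ℝ := fun i j =>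
  ∑ a, ∑ b, metric M (point (h x) x) a b * graphTangent h x i a * graphTangent h x j b

/-- A smooth spacelike slice of the exterior: a spacelike hypersurface that meets each integral
curve of the static Killing field `∂_t` at most once, that is, the graph `t = h(x)` of a smooth
function over an open set. With the signature `(+, -, -, -)`, spacelike means that the induced
metric is negative definite. -/
structure SpacelikeSlice (M : ℝ) where
  /-- the projection of the slice to space -/
  dom : Set Space
  /-- the time function `h` whose graph the slice is -/
  height : Space → ℝ
  isOpen_dom : IsOpen dom
  dom_subset : ∀ x ∈ dom, 2 * M < ‖x‖
  smooth : ContDiffOn ℝ ∞ height dom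
  spacelike : ∀ x ∈ dom, (-inducedMetric M height x).PosDef

namespace SpacelikeSlice

variable {M : ℝ}

/-- The hypersurface itself. -/
def carrier (S : SpacelikeSlice M) : Set Point :=
  {p | ∃ x ∈ S.dom, p = point (S.height x) x}

/-- The slice is invariant under the action of `SO(3)` on spacetime. -/
def IsSphericallySymmetric (S : SpacelikeSlice M) : Prop :=
  ∀ R : Space ≃ₗᵢ[ℝ] Space, LinearMap.det (R.toLinearEquiv : Space →ₗ[ℝ] Space) = 1 →
    ∀ t x, point t x ∈ S.carrier → point t (R x) ∈ S.carrier

/-- The conormal `d(t - h)`. -/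
def conormal (S : SpacelikeSlice M) (x : Space) : Fin 4 → ℝ :=
  ![1, -spd 0 S.height x, -spd 1 S.height x, -spd 2 S.height x]

/-- The future-directed unit normal `N^a`, `N^a N_a = 1`. -/
def normal (S : SpacelikeSlice M) (x : Space) (a : Fin 4) : ℝ :=
  (∑ b, invMetric M (point (S.height x) x) a b * S.conormal x b) /
    Real.sqrt (∑ b, ∑ c, invMetric M (point (S.height x) x) b c
      * S.conormal x b * S.conormal x c)

/-- The density of the induced volume element `dμ_Σ` with respect to `d³x`. -/
def volDensity (S : SpacelikeSlice M) (x : Space) : ℝ :=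
  Real.sqrt (-inducedMetric M S.height x).det

/-- The density `J_a N^a dμ_Σ / d³x` of the flux of a current through the slice. -/
def fluxDensity (S : SpacelikeSlice M) (J : Point → Fin 4 → ℝ) (x : Space) : ℝ :=
  (∑ a, J (point (S.height x) x) a * S.normal x a) * S.volDensity x

/-- The integral of `J_a N^a` over the slice converges absolutely. -/
def FluxIntegrable (S : SpacelikeSlice M) (J : Point → Fin 4 → ℝ) : Prop :=
  IntegrableOn (S.fluxDensity J) S.dom volume

/-- The flux `∫_Σ J_a N^a dμ_Σ`. -/
def flux (S : SpacelikeSlice M) (J : Point → Fin 4 → ℝ) : ℝ :=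
  ∫ x in S.dom, S.fluxDensity J x

end SpacelikeSlice

/-- The superenergy current `H_{ab} ξ^b`. -/
def currentXi (M : ℝ) (F : TensorField) (p : Point) (a : Fin 4) : ℝ :=
  ∑ b, H M F p a b * xi p b

/-- The modified current `H_{ab} ξ^b + P_a`. -/
def currentXiAq (M : ℝ) (F : TensorField) (p : Point) (a : Fin 4) : ℝ :=
  currentXi M F p a + P M F p a

/-- The superenergy `E_ξ(Σ) = ∫_Σ H_{ab} ξ^b N^a dμ_Σ`. -/
def energyXi {M : ℝ} (F : TensorField) (S : SpacelikeSlice M) : ℝ :=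
  S.flux (currentXi M F)

/-- The modified energy `E_{ξ+A,q}(Σ) = ∫_Σ (H_{ab} ξ^b + P_a) N^a dμ_Σ`. -/
def energyXiAq {M : ℝ} (F : TensorField) (S : SpacelikeSlice M) : ℝ :=
  S.flux (currentXiAq M F)

end Schwarzschild

end

open MeasureTheory
open scoped ContDiff

noncomputable section

namespace Schwarzschild

/-! ### The metric, its inverse and its determinant in the chart `(t, x)` -/

section

/-! Write f = 1 - 2M/r, n = dr and ℓ_s = ∂_t + s f ∂_r for s = ±1 (null vectors). On an
SO(3)-invariant slice the gradient of the time function is radial, and in the chart x = rω the norm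
of the conormal cancels the volume density. The flux density of a current J is therefore (2f)⁻¹((1 +
v) J(ℓ₊) + (1 - v) J(ℓ₋)), with |v| < 1 invariant under rotations (`fluxDensity_eq`). It suffices to
compare the two currents on each ℓ_s, after integration against nonnegative rotation-invariant
weights.

The form Z has neither a t-r component nor a component along the spheres (`isExtreme_Z`), so it is
encoded by the fields w_s = Z(ℓ_s, ·), tangential to the spheres. The Hodge dual rotates w_s by a
quarter turn, up to the sign s, so β(ℓ_s) = ½(div w_s + i s curl w_s) (`betaNull_eq`). The current
of ξ on ℓ_s is ½(|β(ℓ_s)|² + f|β_tan|²). In the modified current (`nullComp_currentXiAq`) the two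
squares acquire the factors 1 ± sα with α = (r - 3M)/(2r), and there appear a cross term of β_tan
with w_s and its dual, with coefficient q, and a term -(s/8) q'|w_s|².

The terms in w_s are not controlled pointwise by the ξ-current. They are absorbed by the sharp
Poincaré inequality on spheres, ∫(|div w|² + |curl w|²) ≥ (2/r²)∫|w|². Replace |β(ℓ_s)|² by
|w_s|²/(2r²) plus a quarter of the Poincaré defect. After a tenth of the ξ-current has been taken
away, what remains besides the defect is a quadratic form in (β_tan, w_s), positive for all r > 2M
(`two_mul_abs_le`). The upper bound is the same statement with s replaced by -s (`nullComp_bounds`).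
The defect enters with a nonnegative rotation-invariant factor, so its contribution to the integral
is nonnegative.

The Poincaré inequality (`poincare_inequality`) is proved in space rather than on each sphere: the
rotation generators L_i = (x × ∇)_i integrate to zero against invariant weights, their commutators
supply the curvature term of a Bochner identity, and the remaining integrand is a sum of squares.
Integration takes place over an exhaustion by compact rotation-invariant sets, and
`integral_comparison` carries integrability and both inequalities to the whole slice. -/

/-- The Kronecker symbol of the spatial indices. -/
def spatialDelta (a b : Fin 4) : ℝ := if a = b ∧ a ≠ 0 then 1 else 0

/-- The lapse function `1 - 2M/r`. -/
def lapse (M : ℝ) (p : Point) : ℝ := 1 - 2 * M / radius p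

theorem radius_sq (p : Point) : radius p ^ 2 = p 1 ^ 2 + p 2 ^ 2 + p 3 ^ 2 :=
  Real.sq_sqrt (by positivity)

theorem radius_pos {M : ℝ} (hM : 0 < M) {p : Point} (hp : p ∈ exterior M) : 0 < radius p := by
  have h : 2 * M < radius p := hp
  linarith

theorem lapse_pos {M : ℝ} (hM : 0 < M) {p : Point} (hp : p ∈ exterior M) : 0 < lapse M p := by
  have h : 2 * M < radius p := hp
  have h' := radius_pos hM hp
  rw [lapse, sub_pos, div_lt_one h']
  exact h

@[simp] theorem dr_zero (p : Point) : dr p 0 = 0 := by simp [dr]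

theorem dr_spatial (p : Point) (i : Fin 3) : dr p i.succ = p i.succ / radius p := by
  simp [dr, Fin.succ_ne_zero]

theorem sum_dr_sq {p : Point} (hr : 0 < radius p) : dr p 1 ^ 2 + dr p 2 ^ 2 + dr p 3 ^ 2 = 1 := by
  have := radius_sq p
  have e (i : Fin 3) : dr p i.succ ^ 2 * radius p ^ 2 = p i.succ ^ 2 := by
    rw [dr_spatial]; field_simp
  have e0 := e 0
  have e1 := e 1
  have e2 := e 2
  simp only [Fin.succ_zero_eq_one, Fin.succ_one_eq_two, show (2 : Fin 3).succ = 3 from rfl] at e0 e1 e2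
  have hr' : radius p ^ 2 ≠ 0 := by positivity
  apply mul_right_cancel₀ hr'
  linarith

theorem metric_eq (M : ℝ) (p : Point) (a b : Fin 4) :
    metric M p a b = lapse M p * dt a * dt b - spatialDelta a b
      + (1 - (lapse M p)⁻¹) * dr p a * dr p b := by
  simp only [metric, sphereMetric, lapse, spatialDelta]
  ring

/-- The matrix of the inverse metric. -/
def invMetricMatrix (M : ℝ) (p : Point) : Matrix (Fin 4) (Fin 4) ℝ := fun a b =>
  (lapse M p)⁻¹ * dt a * dt b - spatialDelta a b + (1 - lapse M p) * dr p a * dr p b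

theorem metric_mul_invMetricMatrix {M : ℝ} {p : Point} (hr : 0 < radius p)
    (hf : lapse M p ≠ 0) : metric M p * invMetricMatrix M p = 1 := by
  have h := sum_dr_sq hr
  ext a b
  rw [Matrix.mul_apply, Fin.sum_univ_four]
  simp only [metric_eq, invMetricMatrix, Matrix.one_apply]
  have hg : lapse M p * (lapse M p)⁻¹ = 1 := mul_inv_cancel₀ hf
  have h0 := dr_zero p
  generalize dr p = n at *
  generalize (lapse M p)⁻¹ = g at *
  generalize lapse M p = f at *
  fin_cases a <;> fin_cases b <;> simp [dt, spatialDelta, h0] <;> grind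

theorem invMetric_eq {M : ℝ} (hM : 0 < M) {p : Point} (hp : p ∈ exterior M) (a b : Fin 4) :
    invMetric M p a b = (lapse M p)⁻¹ * dt a * dt b - spatialDelta a b
      + (1 - lapse M p) * dr p a * dr p b := by
  rw [invMetric, Matrix.inv_eq_right_inv
    (metric_mul_invMetricMatrix (radius_pos hM hp) (lapse_pos hM hp).ne')]
  rfl

/-- The factors f and f⁻¹ in the t and r directions cancel, and the sphere part is Euclidean in this
chart. Hence `volForm` is the bare symbol `leviCivita`. -/
theorem det_metric {M : ℝ} {p : Point} (hr : 0 < radius p) (hf : lapse M p ≠ 0) :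
    (metric M p).det = -1 := by
  have h := sum_dr_sq hr
  rw [Matrix.det_succ_row_zero]
  simp [Matrix.det_fin_three, Matrix.submatrix_apply, metric_eq, dt,
    spatialDelta, Fin.succAbove]
  have hg : lapse M p * (lapse M p)⁻¹ = 1 := mul_inv_cancel₀ hf
  linear_combination (lapse M p - 1) * h
    + (dr p 1 ^ 2 + dr p 2 ^ 2 + dr p 3 ^ 2) * (-1) * hg

end

/-! ### Coordinate derivatives and the Levi-Civita connection -/

section

theorem sum_dt_mul (v : Fin 4 → ℝ) : ∑ b, dt b * v b = v 0 := by
  simp [dt]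

theorem sum_spatialDelta_mul (a : Fin 4) (v : Fin 4 → ℝ) :
    ∑ b, spatialDelta a b * v b = v a - dt a * v 0 := by
  rw [Fin.sum_univ_four]
  fin_cases a <;> simp [spatialDelta, dt]

theorem sum_invMetric_mul {M : ℝ} (hM : 0 < M) {p : Point} (hp : p ∈ exterior M) (a : Fin 4)
    (v : Fin 4 → ℝ) :
    ∑ b, invMetric M p a b * v b = ((lapse M p)⁻¹ + 1) * dt a * v 0 - v a
      + (1 - lapse M p) * dr p a * ∑ b, dr p b * v b := by
  have e : ∀ b, invMetric M p a b * v b = (lapse M p)⁻¹ * dt a * (dt b * v b)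
      - spatialDelta a b * v b + (1 - lapse M p) * dr p a * (dr p b * v b) := by
    intro b
    rw [invMetric_eq hM hp]
    ring
  simp only [e, Finset.sum_add_distrib, Finset.sum_sub_distrib, ← Finset.mul_sum, sum_dt_mul,
    sum_spatialDelta_mul]
  ring

theorem invMetric_comm {M : ℝ} (hM : 0 < M) {p : Point} (hp : p ∈ exterior M) (a b : Fin 4) :
    invMetric M p a b = invMetric M p b a := by
  rw [invMetric_eq hM hp, invMetric_eq hM hp]
  simp only [spatialDelta]
  by_cases h : a = b
  · subst h; ring
  · simp [h, Ne.symm h]; ring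

theorem sum_dr_mul_dr {p : Point} (hr : 0 < radius p) : ∑ b, dr p b * dr p b = 1 := by
  have := sum_dr_sq hr
  simp [Fin.sum_univ_four]
  linarith

section Derivatives

variable {f g : Point → ℝ} {p : Point}

theorem pd_const (a : Fin 4) (c : ℝ) : pd a (fun _ => c) p = 0 := by
  simp [pd]

theorem pd_add (a : Fin 4) (hf : DifferentiableAt ℝ f p) (hg : DifferentiableAt ℝ g p) :
    pd a (fun y => f y + g y) p = pd a f p + pd a g p := by
  simp only [pd]
  rw [fderiv_fun_add hf hg]
  rfl

theorem pd_sub (a : Fin 4) (hf : DifferentiableAt ℝ f p) (hg : DifferentiableAt ℝ g p) :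
    pd a (fun y => f y - g y) p = pd a f p - pd a g p := by
  simp only [pd]
  rw [fderiv_fun_sub hf hg]
  rfl

theorem pd_mul (a : Fin 4) (hf : DifferentiableAt ℝ f p) (hg : DifferentiableAt ℝ g p) :
    pd a (fun y => f y * g y) p = pd a f p * g p + f p * pd a g p := by
  simp only [pd]
  rw [fderiv_fun_mul hf hg]
  simp
  ring

theorem pd_sum {ι : Type*} (s : Finset ι) (a : Fin 4) {F : ι → Point → ℝ}
    (hF : ∀ i ∈ s, DifferentiableAt ℝ (F i) p) :
    pd a (fun y => ∑ i ∈ s, F i y) p = ∑ i ∈ s, pd a (F i) p := by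
  simp only [pd]
  rw [fderiv_fun_sum hF]
  simp

theorem pd_inv (a : Fin 4) (hf : DifferentiableAt ℝ f p) (h0 : f p ≠ 0) :
    pd a (fun y => (f y)⁻¹) p = -pd a f p / f p ^ 2 := by
  have h := (hasDerivAt_inv h0).comp_hasFDerivAt p hf.hasFDerivAt
  rw [pd, pd, show (fun y => (f y)⁻¹) = Inv.inv ∘ f from rfl, h.fderiv]
  simp
  field_simp

theorem pd_coord (a b : Fin 4) : pd a (fun y => y b) p = if a = b then 1 else 0 := by
  have : HasFDerivAt (fun y : Point => y b) (ContinuousLinearMap.proj (R := ℝ) b) p :=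
    (ContinuousLinearMap.proj (R := ℝ) (φ := fun _ : Fin 4 => ℝ) b).hasFDerivAt
  rw [pd, this.fderiv]
  simp [Pi.single_apply, eq_comm]

end Derivatives

theorem contDiffAt_radius {p : Point} (hr : 0 < radius p) {n : WithTop ℕ∞} :
    ContDiffAt ℝ n radius p := by
  have h : p 1 ^ 2 + p 2 ^ 2 + p 3 ^ 2 ≠ 0 := by
    rw [← radius_sq]; positivity
  exact ContDiffAt.sqrt (f := fun p : Point => p 1 ^ 2 + p 2 ^ 2 + p 3 ^ 2) (by fun_prop) h

theorem pd_radius {p : Point} (hr : 0 < radius p) (a : Fin 4) : pd a radius p = dr p a := by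
  have hd : DifferentiableAt ℝ radius p := (contDiffAt_radius hr (n := 1)).differentiableAt (by simp)
  have e : (fun y => radius y * radius y) = fun y : Point => y 1 * y 1 + y 2 * y 2 + y 3 * y 3 := by
    ext y
    linarith [radius_sq y]
  have h := congrArg (fun F => pd a F p) e
  rw [pd_mul a hd hd, pd_add, pd_add, pd_mul, pd_mul, pd_mul] at h <;> try fun_prop
  simp only [pd_coord] at h
  apply mul_left_cancel₀ hr.ne'
  have e' : radius p * dr p a = if a = 0 then 0 else p a := by
    simp only [dr]
    split_ifs <;> field_simp
    simp
  rw [e']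
  fin_cases a <;> simp [-mul_eq_zero] at h ⊢ <;> linarith

theorem contDiffAt_dr {p : Point} (hr : 0 < radius p) {n : WithTop ℕ∞} (a : Fin 4) :
    ContDiffAt ℝ n (fun y => dr y a) p := by
  unfold dr
  split_ifs
  · fun_prop
  · exact ContDiffAt.div (by fun_prop) (contDiffAt_radius hr) hr.ne'

theorem contDiffAt_lapse {p : Point} (hr : 0 < radius p) {n : WithTop ℕ∞} (M : ℝ) :
    ContDiffAt ℝ n (lapse M) p := by
  unfold lapse
  exact ContDiffAt.sub (by fun_prop) (ContDiffAt.div (by fun_prop) (contDiffAt_radius hr) hr.ne')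

theorem pd_dr {p : Point} (hr : 0 < radius p) (c a : Fin 4) :
    pd c (fun y => dr y a) p = (spatialDelta c a - dr p c * dr p a) / radius p := by
  have hd : DifferentiableAt ℝ radius p := (contDiffAt_radius hr (n := 1)).differentiableAt (by simp)
  by_cases ha : a = 0
  · subst ha
    simp only [dr_zero, pd_const]
    simp [spatialDelta]
  · have e : (fun y => dr y a) = fun y => y a * (radius y)⁻¹ := by
      ext y
      simp [dr, ha, div_eq_mul_inv]
    rw [e]
    rw [pd_mul c (by fun_prop) (hd.fun_inv hr.ne'), pd_inv c hd hr.ne', pd_radius hr, pd_coord]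
    simp only [spatialDelta]
    by_cases hc : c = a
    · subst hc
      simp [ha, dr]
      field_simp
      ring
    · simp [hc, dr]
      split_ifs <;> simp [field]

theorem pd_lapse {p : Point} (hr : 0 < radius p) (M : ℝ) (c : Fin 4) :
    pd c (lapse M) p = 2 * M / radius p ^ 2 * dr p c := by
  have hd : DifferentiableAt ℝ radius p := (contDiffAt_radius hr (n := 1)).differentiableAt (by simp)
  unfold lapse
  have e : (fun p => 1 - 2 * M / radius p) = fun p => 1 - 2 * M * (radius p)⁻¹ := by
    simp only [div_eq_mul_inv]
  rw [e, pd_sub c (by fun_prop) ((hd.fun_inv hr.ne').const_mul (2 * M)), pd_mul c (by fun_prop) (hd.fun_inv hr.ne'), pd_inv c hd hr.ne',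
    pd_radius hr, pd_const, pd_const]
  field_simp
  ring

theorem pd_metric {M : ℝ} {p : Point} (hr : 0 < radius p) (hf : lapse M p ≠ 0) (c a b : Fin 4) :
    pd c (fun y => metric M y a b) p =
      2 * M / radius p ^ 2 * dr p c * (dt a * dt b + ((lapse M p)⁻¹) ^ 2 * dr p a * dr p b)
      + (1 - (lapse M p)⁻¹) / radius p
        * ((spatialDelta c a - dr p c * dr p a) * dr p b
          + dr p a * (spatialDelta c b - dr p c * dr p b)) := by
  have hl : DifferentiableAt ℝ (lapse M) p :=
    (contDiffAt_lapse hr M (n := 1)).differentiableAt (by simp)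
  have hd (a : Fin 4) : DifferentiableAt ℝ (fun y => dr y a) p :=
    (contDiffAt_dr hr a (n := 1)).differentiableAt (by simp)
  have hli := hl.fun_inv hf
  have hda := hd a
  have hdb := hd b
  simp only [metric_eq]
  rw [pd_add, pd_sub, pd_mul, pd_mul, pd_mul, pd_mul, pd_sub, pd_inv, pd_lapse hr, pd_dr hr, pd_dr hr]
  · simp only [pd_const]
    field_simp
    ring
  all_goals first | exact hf | fun_prop

/-- The coefficient of `∂_t` in the connection. -/
def connT (M : ℝ) (p : Point) (b c : Fin 4) : ℝ :=
  (lapse M p)⁻¹ * (M / radius p ^ 2) * (dr p b * dt c + dr p c * dt b)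

/-- The coefficient of `∂_r` in the connection. -/
def connR (M : ℝ) (p : Point) (b c : Fin 4) : ℝ :=
  lapse M p * (M / radius p ^ 2) * (dt b * dt c - ((lapse M p)⁻¹) ^ 2 * dr p b * dr p c)
    + (1 - lapse M p) / radius p * (spatialDelta b c - dr p b * dr p c)

theorem spatialDelta_comm (a b : Fin 4) : spatialDelta a b = spatialDelta b a := by
  simp only [spatialDelta]
  by_cases h : a = b
  · subst h; rfl
  · simp [h, Ne.symm h]

/-- In the Koszul combination the terms with a Kronecker symbol in the lowered index d cancel, so
only multiples of dt and n survive. Contracting a connection term with a two-form thus involves only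
its time and radial contractions. -/
theorem christoffel_eq {M : ℝ} (hM : 0 < M) {p : Point} (hp : p ∈ exterior M) (a b c : Fin 4) :
    christoffel M p a b c = dt a * connT M p b c + dr p a * connR M p b c := by
  have hr := radius_pos hM hp
  have hf := (lapse_pos hM hp).ne'
  rw [christoffel, sum_invMetric_mul hM hp]
  have e (d : Fin 4) : pd b (fun y => metric M y d c) p + pd c (fun y => metric M y d b) p
      - pd d (fun y => metric M y b c) p
      = dt d * (2 * M / radius p ^ 2 * (dr p b * dt c + dr p c * dt b))
        + dr p d * (2 * M / radius p ^ 2 * (((lapse M p)⁻¹) ^ 2 * dr p b * dr p c - dt b * dt c)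
          + 2 * (1 - (lapse M p)⁻¹) / radius p * (spatialDelta b c - dr p b * dr p c)) := by
    simp only [pd_metric hr hf]
    rw [spatialDelta_comm b d, spatialDelta_comm c d, spatialDelta_comm c b]
    ring
  have e2 (A B : ℝ) : ∑ d, dr p d * (dt d * A + dr p d * B) = B := by
    have := sum_dr_sq hr
    simp [Fin.sum_univ_four, dt]
    linear_combination B * this
  simp only [e, e2]
  simp only [connT, connR, dr_zero, show dt 0 = 1 from rfl]
  field_simp
  ring

end

/-! ### Divergence of transverse two-forms along the null directions -/

section

theorem isOpen_exterior (M : ℝ) : IsOpen (exterior M) := by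
  have : Continuous radius := by unfold radius; fun_prop
  exact isOpen_lt continuous_const this

theorem pd_congr {f g : Point → ℝ} {p : Point} (h : f =ᶠ[nhds p] g) (a : Fin 4) :
    pd a f p = pd a g p := by
  rw [pd, pd, h.fderiv_eq]

theorem exterior_mem_nhds {M : ℝ} {p : Point} (hp : p ∈ exterior M) : exterior M ∈ nhds p :=
  (isOpen_exterior M).mem_nhds hp

/-- A two-form whose `t`-`r` component vanishes. -/
structure IsTransverse (M : ℝ) (T : TensorField) : Prop where
  antisymm : ∀ p ∈ exterior M, ∀ a b, T p a b = -T p b a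
  trace_dr : ∀ p ∈ exterior M, ∑ b, dr p b * T p 0 b = 0

/-- The contraction of a two-form with the radial unit covector. -/
def radial (T : TensorField) (p : Point) (b : Fin 4) : ℝ := ∑ a, dr p a * T p a b

/-- The contraction `(∂_t + s f ∂_r)^a T_{ab}`. -/
def nullContr (M s : ℝ) (T : TensorField) (p : Point) (b : Fin 4) : ℝ :=
  T p 0 b + s * lapse M p * radial T p b

namespace IsTransverse

variable {M : ℝ} {T : TensorField} {p : Point}

theorem time_zero (hT : IsTransverse M T) (hp : p ∈ exterior M) : T p 0 0 = 0 := by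
  linarith [hT.antisymm p hp 0 0]

theorem radial_zero (hT : IsTransverse M T) (hp : p ∈ exterior M) : radial T p 0 = 0 := by
  have h := hT.trace_dr p hp
  simp only [radial]
  rw [← neg_eq_zero, ← h, ← Finset.sum_neg_distrib]
  exact Finset.sum_congr rfl fun b _ => by rw [hT.antisymm p hp 0 b]; ring

theorem sum_dr_radial (hT : IsTransverse M T) (hp : p ∈ exterior M) :
    ∑ b, dr p b * radial T p b = 0 := by
  have e : ∑ b, dr p b * radial T p b = -∑ b, dr p b * radial T p b := by
    simp only [radial, Finset.mul_sum, ← Finset.sum_neg_distrib]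
    rw [Finset.sum_comm]
    refine Finset.sum_congr rfl fun b _ => Finset.sum_congr rfl fun c _ => ?_
    rw [hT.antisymm p hp]
    ring
  linarith

theorem nullContr_zero (hT : IsTransverse M T) (hp : p ∈ exterior M) (s : ℝ) :
    nullContr M s T p 0 = 0 := by
  rw [nullContr, hT.time_zero hp, hT.radial_zero hp]
  ring

theorem sum_dr_nullContr (hT : IsTransverse M T) (hp : p ∈ exterior M) (s : ℝ) :
    ∑ b, dr p b * nullContr M s T p b = 0 := by
  have h1 := hT.trace_dr p hp
  have h2 := hT.sum_dr_radial hp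
  have e : ∀ b, dr p b * nullContr M s T p b
      = dr p b * T p 0 b + s * lapse M p * (dr p b * radial T p b) := by
    intro b; rw [nullContr]; ring
  simp only [e, Finset.sum_add_distrib, ← Finset.mul_sum, h1, h2]
  ring

end IsTransverse

variable {M : ℝ} {T : TensorField} {p : Point}

theorem sum_invMetric_tangent (hM : 0 < M) (hp : p ∈ exterior M) (a : Fin 4) {v : Fin 4 → ℝ}
    (h0 : v 0 = 0) (hn : ∑ b, dr p b * v b = 0) : ∑ b, invMetric M p a b * v b = -v a := by
  rw [sum_invMetric_mul hM hp, h0, hn]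
  ring

theorem sum_invMetric_dr (hM : 0 < M) (hp : p ∈ exterior M) (a : Fin 4) :
    ∑ b, invMetric M p a b * dr p b = -lapse M p * dr p a := by
  rw [sum_invMetric_mul hM hp, sum_dr_mul_dr (radius_pos hM hp), dr_zero]
  ring

theorem sum_invMetric_dt (hM : 0 < M) (hp : p ∈ exterior M) (a : Fin 4) :
    ∑ b, invMetric M p a b * dt b = (lapse M p)⁻¹ * dt a := by
  rw [sum_invMetric_mul hM hp]
  simp [dt]
  split_ifs <;> ring

theorem covDeriv_eq (hM : 0 < M) (hT : IsTransverse M T) (hp : p ∈ exterior M) (c a b : Fin 4) :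
    covDeriv M T p c a b = pd c (fun y => T y a b) p
      - connT M p c a * T p 0 b - connR M p c a * radial T p b
      + connT M p c b * T p 0 a + connR M p c b * radial T p a := by
  have e1 : ∑ d, christoffel M p d c a * T p d b
      = connT M p c a * T p 0 b + connR M p c a * radial T p b := by
    rw [← sum_dt_mul fun d => T p d b]
    simp only [radial, Finset.mul_sum, ← Finset.sum_add_distrib]
    exact Finset.sum_congr rfl fun d _ => by rw [christoffel_eq hM hp]; ring
  have e2 : ∑ d, christoffel M p d c b * T p a d
      = -(connT M p c b * T p 0 a + connR M p c b * radial T p a) := by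
    rw [← sum_dt_mul fun d => T p d a]
    simp only [radial, Finset.mul_sum, ← Finset.sum_add_distrib, ← Finset.sum_neg_distrib]
    exact Finset.sum_congr rfl fun d _ => by
      rw [christoffel_eq hM hp, hT.antisymm p hp a d]; ring
  rw [covDeriv, e1, e2]
  ring

theorem sum_connT_tangent {v : Fin 4 → ℝ}
    (h0 : v 0 = 0) (hn : ∑ b, dr p b * v b = 0) (a : Fin 4) :
    ∑ c, connT M p c a * v c = 0 := by
  have e : ∀ c, connT M p c a * v c = (lapse M p)⁻¹ * (M / radius p ^ 2) *
      (dt a * (dr p c * v c) + dr p a * (dt c * v c)) := by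
    intro c; rw [connT]; ring
  simp only [e, ← Finset.mul_sum, Finset.sum_add_distrib, hn, sum_dt_mul, h0]
  ring

theorem sum_connR_tangent {v : Fin 4 → ℝ}
    (h0 : v 0 = 0) (hn : ∑ b, dr p b * v b = 0) (a : Fin 4) :
    ∑ c, connR M p c a * v c = (1 - lapse M p) / radius p * v a := by
  have e : ∀ c, connR M p c a * v c = lapse M p * (M / radius p ^ 2) * (dt a * (dt c * v c)
      - ((lapse M p)⁻¹) ^ 2 * dr p a * (dr p c * v c)) +
      (1 - lapse M p) / radius p * (spatialDelta a c * v c - dr p a * (dr p c * v c)) := by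
    intro c; rw [connR, spatialDelta_comm c a]; ring
  simp only [e, ← Finset.mul_sum, Finset.sum_add_distrib, Finset.sum_sub_distrib, hn, sum_dt_mul,
    h0, sum_spatialDelta_mul]
  ring

/-- The values of k and l are irrelevant: they multiply covectors tangential to the spheres, which
vanish when the divergence is contracted with ∂_t or ∂_r. -/
theorem exists_divSnd_eq (hM : 0 < M) (hT : IsTransverse M T) (hp : p ∈ exterior M) :
    ∃ k l : ℝ, ∀ a, divSnd M T p a =
      ∑ b, ∑ c, invMetric M p b c * pd c (fun y => T y a b) p
        + k * T p 0 a + l * radial T p a := by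
  refine ⟨∑ b, ∑ c, invMetric M p b c * connT M p c b,
    (∑ b, ∑ c, invMetric M p b c * connR M p c b) + (1 - lapse M p) / radius p, fun a => ?_⟩
  have h1 : ∑ b, ∑ c, invMetric M p b c * (connT M p c a * T p 0 b) = 0 := by
    rw [Finset.sum_comm]
    have e : ∀ c, ∑ b, invMetric M p b c * (connT M p c a * T p 0 b)
        = -(connT M p c a * T p 0 c) := by
      intro c
      rw [← mul_neg, ← sum_invMetric_tangent hM hp c (hT.time_zero hp) (hT.trace_dr p hp),
        Finset.mul_sum]
      exact Finset.sum_congr rfl fun b _ => by rw [invMetric_comm hM hp]; ring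
    simp only [e, Finset.sum_neg_distrib,
      sum_connT_tangent (hT.time_zero hp) (hT.trace_dr p hp), neg_zero]
  have h2 : ∑ b, ∑ c, invMetric M p b c * (connR M p c a * radial T p b)
      = -((1 - lapse M p) / radius p * radial T p a) := by
    rw [Finset.sum_comm]
    have e : ∀ c, ∑ b, invMetric M p b c * (connR M p c a * radial T p b)
        = -(connR M p c a * radial T p c) := by
      intro c
      rw [← mul_neg, ← sum_invMetric_tangent hM hp c (hT.radial_zero hp) (hT.sum_dr_radial hp),
        Finset.mul_sum]
      exact Finset.sum_congr rfl fun b _ => by rw [invMetric_comm hM hp]; ring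
    simp only [e, Finset.sum_neg_distrib,
      sum_connR_tangent (hT.radial_zero hp) (hT.sum_dr_radial hp)]
  have e : ∀ b c, invMetric M p b c * covDeriv M T p c a b =
      invMetric M p b c * pd c (fun y => T y a b) p
      - invMetric M p b c * (connT M p c a * T p 0 b)
      - invMetric M p b c * (connR M p c a * radial T p b)
      + invMetric M p b c * connT M p c b * T p 0 a
      + invMetric M p b c * connR M p c b * radial T p a := by
    intro b c
    rw [covDeriv_eq hM hT hp]
    ring
  simp only [divSnd, e, Finset.sum_add_distrib, Finset.sum_sub_distrib, h1, h2, ← Finset.sum_mul]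
  ring

theorem IsTransverse.pd_nullContr_zero (hT : IsTransverse M T) (hp : p ∈ exterior M) (s : ℝ)
    (c : Fin 4) : pd c (fun y => nullContr M s T y 0) p = 0 := by
  rw [pd_congr (g := fun _ => 0), pd_const]
  filter_upwards [exterior_mem_nhds hp] with y hy
  exact hT.nullContr_zero hy s

/-- Differentiate n · w = 0: the derivative of n is the projection to the sphere divided by r, and w
is tangential. -/
theorem IsTransverse.sum_dr_pd_nullContr (hM : 0 < M) (hT : IsTransverse M T)
    (hp : p ∈ exterior M) (hd : ∀ a b, DifferentiableAt ℝ (fun y => T y a b) p) (s : ℝ)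
    (c : Fin 4) : ∑ b, dr p b * pd c (fun y => nullContr M s T y b) p
      = -nullContr M s T p c / radius p := by
  have hr := radius_pos hM hp
  have hdl : DifferentiableAt ℝ (lapse M) p :=
    (contDiffAt_lapse hr M (n := 1)).differentiableAt (by simp)
  have hdn (a : Fin 4) : DifferentiableAt ℝ (fun y => dr y a) p :=
    (contDiffAt_dr hr a (n := 1)).differentiableAt (by simp)
  have hdw (b : Fin 4) : DifferentiableAt ℝ (fun y => nullContr M s T y b) p := by
    unfold nullContr radial
    fun_prop
  have h : pd c (fun y => ∑ b, dr y b * nullContr M s T y b) p = 0 := by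
    rw [pd_congr (g := fun _ => 0), pd_const]
    filter_upwards [exterior_mem_nhds hp] with y hy
    exact hT.sum_dr_nullContr hy s
  rw [pd_sum _ _ fun a _ => (hdn a).fun_mul (hdw a)] at h
  have e : ∀ a, pd c (fun y => dr y a * nullContr M s T y a) p
      = (spatialDelta c a * nullContr M s T p a - dr p c * (dr p a * nullContr M s T p a))
          / radius p
        + dr p a * pd c (fun y => nullContr M s T y a) p := by
    intro a
    rw [pd_mul c (hdn a) (hdw a), pd_dr hr]
    ring
  simp only [e, Finset.sum_add_distrib, ← Finset.sum_div, Finset.sum_sub_distrib,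
    ← Finset.mul_sum, sum_spatialDelta_mul, hT.sum_dr_nullContr hp s,
    hT.nullContr_zero hp s, mul_zero, sub_zero] at h
  rw [neg_div]
  linarith

/-- Contracting the divergence with ∂_t + s f ∂_r commutes with taking it, and on the tangential
field w that results, the spacetime divergence reduces to minus the Euclidean one, since w has no
time component and n·∂w·n vanishes. -/
theorem divSnd_null (hM : 0 < M) (hT : IsTransverse M T) (hp : p ∈ exterior M)
    (hd : ∀ a b, DifferentiableAt ℝ (fun y => T y a b) p) (s : ℝ) :
    divSnd M T p 0 + s * lapse M p * ∑ a, dr p a * divSnd M T p a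
      = -∑ b, pd b (fun y => nullContr M s T y b) p := by
  have hr := radius_pos hM hp
  have hdl : DifferentiableAt ℝ (lapse M) p :=
    (contDiffAt_lapse hr M (n := 1)).differentiableAt (by simp)
  have hdn (a : Fin 4) : DifferentiableAt ℝ (fun y => dr y a) p :=
    (contDiffAt_dr hr a (n := 1)).differentiableAt (by simp)
  have hdrad (b : Fin 4) : DifferentiableAt ℝ (fun y => radial T y b) p := by
    unfold radial; fun_prop
  have hpr (b c : Fin 4) : pd c (fun y => radial T y b) p
      = (T p c b - dt c * T p 0 b - dr p c * radial T p b) / radius p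
        + ∑ a, dr p a * pd c (fun y => T y a b) p := by
    simp only [radial]
    rw [pd_sum _ _ fun a _ => (hdn a).fun_mul (hd a b)]
    have e : ∀ a, pd c (fun y => dr y a * T y a b) p
        = (spatialDelta c a * T p a b - dr p c * (dr p a * T p a b)) / radius p
          + dr p a * pd c (fun y => T y a b) p := by
      intro a
      rw [pd_mul c (hdn a) (hd a b), pd_dr hr]
      ring
    simp only [e, Finset.sum_add_distrib, ← Finset.sum_div, Finset.sum_sub_distrib,
      ← Finset.mul_sum, sum_spatialDelta_mul]
  have hpw (b c : Fin 4) : pd c (fun y => nullContr M s T y b) p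
      = pd c (fun y => T y 0 b) p + s * (2 * M / radius p ^ 2 * dr p c) * radial T p b
        + s * lapse M p * pd c (fun y => radial T y b) p := by
    simp only [nullContr]
    rw [pd_add c (hd 0 b) ((hdl.const_mul s).fun_mul (hdrad b)), pd_mul c (hdl.const_mul s) (hdrad b),
      pd_mul c (by fun_prop) hdl, pd_const, pd_lapse hr]
    ring
  have hw0 := hT.pd_nullContr_zero hp s
  have hwn := hT.sum_dr_pd_nullContr hM hp hd s
  obtain ⟨k, l, hkl⟩ := exists_divSnd_eq hM hT hp
  -- Moving f and n inside the derivative produces only three traces, of n with the radial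
  -- contraction, of dt with the time contraction, and of T itself. Each vanishes.
  have hX : ∑ b, ∑ c, invMetric M p b c * (dr p c * radial T p b) = 0 := by
    have e : ∀ b, ∑ c, invMetric M p b c * (dr p c * radial T p b)
        = -lapse M p * (dr p b * radial T p b) := by
      intro b
      rw [← mul_assoc, ← sum_invMetric_dr hM hp b, Finset.sum_mul]
      exact Finset.sum_congr rfl fun c _ => by ring
    simp only [e, ← Finset.mul_sum, hT.sum_dr_radial hp, mul_zero]
  have hE : ∑ b, ∑ c, invMetric M p b c * (dt c * T p 0 b) = 0 := by
    have e : ∀ b, ∑ c, invMetric M p b c * (dt c * T p 0 b)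
        = (lapse M p)⁻¹ * (dt b * T p 0 b) := by
      intro b
      rw [← mul_assoc, ← sum_invMetric_dt hM hp b, Finset.sum_mul]
      exact Finset.sum_congr rfl fun c _ => by ring
    simp only [e, ← Finset.mul_sum, sum_dt_mul, hT.time_zero hp, mul_zero]
  have hTT : ∑ b, ∑ c, invMetric M p b c * T p c b = 0 := by
    have e : ∑ b, ∑ c, invMetric M p b c * T p c b
        = -∑ b, ∑ c, invMetric M p b c * T p c b := by
      conv_lhs => rw [Finset.sum_comm]
      simp only [← Finset.sum_neg_distrib]
      refine Finset.sum_congr rfl fun b _ => Finset.sum_congr rfl fun c _ => ?_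
      rw [hT.antisymm p hp b c, invMetric_comm hM hp]
      ring
    linarith
  have hW : ∑ b, ∑ c, invMetric M p b c * pd c (fun y => nullContr M s T y b) p
      = -∑ b, pd b (fun y => nullContr M s T y b) p := by
    rw [Finset.sum_comm]
    have e : ∀ c, ∑ b, invMetric M p b c * pd c (fun y => nullContr M s T y b) p
        = -pd c (fun y => nullContr M s T y c) p
          - (1 - lapse M p) / radius p * (dr p c * nullContr M s T p c) := by
      intro c
      simp only [fun b => invMetric_comm hM hp b c]
      rw [sum_invMetric_mul hM hp, hw0, hwn]
      ring
    simp only [e, Finset.sum_sub_distrib, ← Finset.mul_sum, hT.sum_dr_nullContr hp s,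
      Finset.sum_neg_distrib]
    ring
  have e : ∀ b c, invMetric M p b c * pd c (fun y => T y 0 b) p
      + s * lapse M p * ∑ a, dr p a * (invMetric M p b c * pd c (fun y => T y a b) p)
      = invMetric M p b c * pd c (fun y => nullContr M s T y b) p
        + (s * lapse M p / radius p - s * (2 * M / radius p ^ 2))
          * (invMetric M p b c * (dr p c * radial T p b))
        + s * lapse M p / radius p * (invMetric M p b c * (dt c * T p 0 b))
        - s * lapse M p / radius p * (invMetric M p b c * T p c b) := by
    intro b c
    have e : ∑ a, dr p a * (invMetric M p b c * pd c (fun y => T y a b) p)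
        = invMetric M p b c * ∑ a, dr p a * pd c (fun y => T y a b) p := by
      rw [Finset.mul_sum]
      exact Finset.sum_congr rfl fun a _ => by ring
    rw [e, hpw, hpr]
    ring
  have e1 : ∑ a, dr p a * divSnd M T p a
      = ∑ b, ∑ c, ∑ a, dr p a * (invMetric M p b c * pd c (fun y => T y a b) p) := by
    have e : ∀ a, dr p a * divSnd M T p a
        = ∑ b, ∑ c, dr p a * (invMetric M p b c * pd c (fun y => T y a b) p)
          + k * (dr p a * T p 0 a) + l * (dr p a * radial T p a) := by
      intro a
      rw [hkl]
      simp only [← Finset.mul_sum]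
      ring
    simp only [e, Finset.sum_add_distrib, ← Finset.mul_sum (f := fun a => dr p a * T p 0 a),
      ← Finset.mul_sum (f := fun a => dr p a * radial T p a), hT.trace_dr p hp,
      hT.sum_dr_radial hp]
    rw [Finset.sum_comm]
    simp only [mul_zero, add_zero]
    exact Finset.sum_congr rfl fun b _ => Finset.sum_comm
  rw [e1, hkl, hT.time_zero hp, hT.radial_zero hp, ← hW]
  simp only [Finset.mul_sum (s := Finset.univ) (a := s * lapse M p), mul_zero, add_zero,
    ← Finset.sum_add_distrib]
  simp only [Finset.mul_sum] at e
  simp only [← Finset.mul_sum] at e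
  simp only [← Finset.mul_sum, e, Finset.sum_add_distrib, Finset.sum_sub_distrib, hX, hE, hTT]
  ring

end

/-! ### The Levi-Civita symbol as a Vandermonde product -/

section

-- Both sides alternate in the four indices, and at (0, 1, 2, 3) the product of differences is
-- 1·2·3·1·2·1 = 12. The polynomial form lets `ring` prove the antisymmetries and `simp` evaluate
-- components.
set_option maxRecDepth 100000 in
theorem twelve_mul_det_eq_vandermonde : ∀ a b c d : Fin 4,
    12 * (Matrix.of fun i j : Fin 4 => if ![a, b, c, d] i = j then (1 : ℤ) else 0).det
      = ((b : ℤ) - a) * ((c : ℤ) - a) * ((d : ℤ) - a) * ((c : ℤ) - b) * ((d : ℤ) - b)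
        * ((d : ℤ) - c) := by
  decide

theorem leviCivita_eq (a b c d : Fin 4) : leviCivita a b c d =
    ((b : ℝ) - a) * ((c : ℝ) - a) * ((d : ℝ) - a) * ((c : ℝ) - b) * ((d : ℝ) - b)
      * ((d : ℝ) - c) / 12 := by
  have h := congrArg (Int.cast : ℤ → ℝ) (twelve_mul_det_eq_vandermonde a b c d)
  have e : ((Matrix.of fun i j : Fin 4 => if ![a, b, c, d] i = j then (1 : ℤ) else 0).det : ℝ)
      = leviCivita a b c d := by
    rw [Int.cast_det, leviCivita]
    congr 1
    ext i j
    simp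
  rw [Int.cast_mul, e] at h
  push_cast at h
  rw [← h]
  ring

end

/-! ### Extreme two-forms and their Hodge duals -/

section

theorem leviCivita_swap (a b c d : Fin 4) : leviCivita b a c d = -leviCivita a b c d := by
  rw [leviCivita_eq, leviCivita_eq]
  ring

theorem volForm_eq {M : ℝ} (hM : 0 < M) {p : Point} (hp : p ∈ exterior M) (a b c d : Fin 4) :
    volForm M p a b c d = leviCivita a b c d := by
  rw [volForm, det_metric (radius_pos hM hp) (lapse_pos hM hp).ne']
  simp

theorem hodge_antisymm (M : ℝ) (T : TensorField) (p : Point) (a b : Fin 4) :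
    hodge M T p a b = -hodge M T p b a := by
  simp only [hodge, volForm, leviCivita_swap a b, Finset.mul_sum, ← Finset.sum_neg_distrib]
  ring_nf

theorem killingYano_zero (p : Point) (a : Fin 4) : killingYano p a 0 = 0 := by
  simp [killingYano, leviCivita_eq]

theorem killingYano_antisymm (p : Point) (a b : Fin 4) :
    killingYano p a b = -killingYano p b a := by
  simp only [killingYano, leviCivita_eq, ← Finset.sum_neg_distrib]
  ring_nf

theorem sum_dr_killingYano (p : Point) (a : Fin 4) : ∑ b, dr p b * killingYano p a b = 0 := by
  fin_cases a <;> simp [killingYano, leviCivita_eq, Fin.sum_univ_four, dr] <;> ring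

theorem starFY_eq {M : ℝ} (hM : 0 < M) (F : TensorField) {p : Point} (hp : p ∈ exterior M)
    (a b : Fin 4) : starFY M F p a b = -∑ d, hodge M F p a d * killingYano p b d := by
  rw [starFY, Finset.sum_comm, ← Finset.sum_neg_distrib]
  refine Finset.sum_congr rfl fun d _ => ?_
  rw [← mul_neg, ← sum_invMetric_tangent hM hp d (killingYano_zero p b) (sum_dr_killingYano p b),
    Finset.mul_sum]
  exact Finset.sum_congr rfl fun c _ => by ring

theorem Z_eq {M : ℝ} (hM : 0 < M) (F : TensorField) {p : Point} (hp : p ∈ exterior M)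
    (a b : Fin 4) : Z M F p a b
      = 2 / 3 * ∑ d, (hodge M F p a d * killingYano p b d
        - hodge M F p b d * killingYano p a d) := by
  rw [Z, starFY_eq hM F hp, starFY_eq hM F hp, Finset.sum_sub_distrib]
  ring

/-- A two-form without `t`-`r` component and without component along the spheres. -/
structure IsExtreme (M : ℝ) (T : TensorField) : Prop extends IsTransverse M T where
  trace_sphere : ∀ p ∈ exterior M, dr p 1 * T p 2 3 + dr p 2 * T p 3 1 + dr p 3 * T p 1 2 = 0

/-- The Killing-Yano tensor is a multiple of the area form of the spheres, so each term of Z has a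
slot tangential to the spheres, which excludes a t-r component. If both slots are tangential, the
contraction of two multiples of the area form is symmetric, and antisymmetrization removes it. -/
theorem isExtreme_Z {M : ℝ} (hM : 0 < M) (F : TensorField) : IsExtreme M (Z M F) where
  antisymm p hp a b := by
    rw [Z_eq hM F hp, Z_eq hM F hp, ← mul_neg, ← Finset.sum_neg_distrib]
    simp only [neg_sub]
  trace_dr p hp := by
    have hY : ∀ d, killingYano p 0 d = 0 := fun d => by
      rw [killingYano_antisymm, killingYano_zero, neg_zero]
    have h := fun d => sum_dr_killingYano p d
    have e : ∀ b, dr p b * Z M F p 0 b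
        = -(2 / 3) * ∑ d, hodge M F p 0 d * (dr p b * killingYano p d b) := by
      intro b
      rw [Z_eq hM F hp, Finset.mul_sum, Finset.mul_sum, Finset.mul_sum]
      refine Finset.sum_congr rfl fun d _ => ?_
      rw [hY, killingYano_antisymm p b d]
      ring
    simp only [e, ← Finset.mul_sum]
    rw [Finset.sum_comm]
    simp only [← Finset.mul_sum, h]
    simp
  trace_sphere p hp := by
    have ha := hodge_antisymm M F p
    rw [Z_eq hM F hp, Z_eq hM F hp, Z_eq hM F hp]
    have h11 : hodge M F p 1 1 = 0 := by linarith [ha 1 1]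
    have h22 : hodge M F p 2 2 = 0 := by linarith [ha 2 2]
    have h33 : hodge M F p 3 3 = 0 := by linarith [ha 3 3]
    simp [killingYano, leviCivita_eq, Fin.sum_univ_four, dr, h11, h22, h33, ha 2 1, ha 3 1, ha 3 2]
    norm_num
    ring

namespace IsExtreme

variable {M : ℝ} {T : TensorField} {p : Point}

/-- Of the six components of a two-form the t-r and the sphere component vanish. The other four are
those of dt ∧ E + n ∧ X, with E and X the tangential time and radial contractions. -/
theorem eq_wedge (hM : 0 < M) (hT : IsExtreme M T) (hp : p ∈ exterior M) (a b : Fin 4) :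
    T p a b = dt a * T p 0 b - dt b * T p 0 a + dr p a * radial T p b - dr p b * radial T p a := by
  have h1 := sum_dr_sq (radius_pos hM hp)
  have h2 := hT.trace_sphere p hp
  have h3 := hT.trace_dr p hp
  have ha := hT.antisymm p hp
  have h00 : T p 0 0 = 0 := by linarith [ha 0 0]
  have h11 : T p 1 1 = 0 := by linarith [ha 1 1]
  have h22 : T p 2 2 = 0 := by linarith [ha 2 2]
  have h33 : T p 3 3 = 0 := by linarith [ha 3 3]
  have h10 := ha 1 0
  have h20 := ha 2 0
  have h30 := ha 3 0
  have h21 := ha 2 1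
  have h31 := ha 3 1
  have h32 := ha 3 2
  clear ha
  have h0 := dr_zero p
  simp only [radial, Fin.sum_univ_four, h0, zero_mul, zero_add] at h1 h2 h3 ⊢
  generalize T p = T at *
  generalize dr p = n at *
  fin_cases a <;> fin_cases b <;> simp [dt] <;> grind

/-- Raising both indices of an extreme two-form. -/
theorem raise_eq (hM : 0 < M) (hT : IsExtreme M T) (hp : p ∈ exterior M) (c d : Fin 4) :
    ∑ e, ∑ f, invMetric M p c e * invMetric M p d f * T p e f
      = -(lapse M p)⁻¹ * (dt c * T p 0 d - dt d * T p 0 c)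
        + lapse M p * (dr p c * radial T p d - dr p d * radial T p c) := by
  have hE := fun a => sum_invMetric_tangent hM hp a (hT.time_zero hp) (hT.trace_dr p hp)
  have hX := fun a => sum_invMetric_tangent hM hp a (hT.radial_zero hp) (hT.sum_dr_radial hp)
  have ht := fun a => sum_invMetric_dt hM hp a
  have hn := fun a => sum_invMetric_dr hM hp a
  have e1 : ∀ e f, invMetric M p c e * invMetric M p d f * T p e f
      = (invMetric M p c e * dt e) * (invMetric M p d f * T p 0 f)
        - (invMetric M p c e * T p 0 e) * (invMetric M p d f * dt f)
        + (invMetric M p c e * dr p e) * (invMetric M p d f * radial T p f)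
        - (invMetric M p c e * radial T p e) * (invMetric M p d f * dr p f) := by
    intro e f
    rw [hT.eq_wedge hM hp e f]
    ring
  simp only [e1, Finset.sum_add_distrib, Finset.sum_sub_distrib, ← Finset.mul_sum,
    ← Finset.sum_mul, hE, hX, ht, hn]
  ring

theorem hodge_eq (hM : 0 < M) (hT : IsExtreme M T) (hp : p ∈ exterior M) (a b : Fin 4) :
    hodge M T p a b = ∑ c, ∑ d, leviCivita a b c d *
      (-(lapse M p)⁻¹ * dt c * T p 0 d + lapse M p * dr p c * radial T p d) := by
  have h (c d : Fin 4) : ∑ e, ∑ f, volForm M p a b c d * invMetric M p c e * invMetric M p d f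
      * T p e f = leviCivita a b c d * (-(lapse M p)⁻¹ * (dt c * T p 0 d - dt d * T p 0 c)
        + lapse M p * (dr p c * radial T p d - dr p d * radial T p c)) := by
    rw [← hT.raise_eq hM hp, volForm_eq hM hp, Finset.mul_sum]
    refine Finset.sum_congr rfl fun e _ => ?_
    rw [Finset.mul_sum]
    exact Finset.sum_congr rfl fun f _ => by ring
  simp only [hodge, h]
  have hs : ∀ c d, leviCivita a b d c = -leviCivita a b c d := fun c d => by
    rw [leviCivita_eq, leviCivita_eq]; ring
  have e : ∀ c d, leviCivita a b c d * (-(lapse M p)⁻¹ * (dt c * T p 0 d - dt d * T p 0 c)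
        + lapse M p * (dr p c * radial T p d - dr p d * radial T p c))
      = leviCivita a b c d *
          (-(lapse M p)⁻¹ * dt c * T p 0 d + lapse M p * dr p c * radial T p d)
        + leviCivita a b d c *
          (-(lapse M p)⁻¹ * dt d * T p 0 c + lapse M p * dr p d * radial T p c) := by
    intro c d
    rw [hs c d]
    ring
  simp only [e, Finset.sum_add_distrib]
  conv_lhs => arg 2; arg 2; rw [Finset.sum_comm]
  ring

/-- Only the part n ∧ X contributes, since the symbol already carries a time index. Together with
`radial_hodge`: duality exchanges E and X, with a quarter turn and a factor f or f⁻¹. -/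
theorem hodge_time (hM : 0 < M) (hT : IsExtreme M T) (hp : p ∈ exterior M) (b : Fin 4) :
    hodge M T p 0 b = lapse M p * ∑ c, ∑ d, leviCivita 0 b c d * dr p c * radial T p d := by
  have h0 := hT.radial_zero hp
  rw [hT.hodge_eq hM hp]
  simp only [Finset.mul_sum]
  refine Finset.sum_congr rfl fun c _ => Finset.sum_congr rfl fun d _ => ?_
  by_cases hc : c = 0
  · subst hc
    simp [leviCivita_eq]
  · simp [dt, hc]
    ring

theorem radial_hodge (hM : 0 < M) (hT : IsExtreme M T) (hp : p ∈ exterior M) (b : Fin 4) :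
    radial (hodge M T) p b
      = (lapse M p)⁻¹ * ∑ c, ∑ d, leviCivita 0 b c d * dr p c * T p 0 d := by
  have h00 := hT.time_zero hp
  simp only [radial, hT.hodge_eq hM hp] at *
  generalize radial T p = X at *
  generalize T p 0 = E at *
  fin_cases b <;>
  simp [Fin.sum_univ_four, leviCivita_eq, dt, h00] <;> ring

end IsExtreme

end

/-! ### The null components of β as a divergence and a curl -/

section

section Smoothness

variable {M : ℝ} {n : WithTop ℕ∞} {p : Point}

theorem contDiffAt_invMetric (hM : 0 < M) (hp : p ∈ exterior M) (a b : Fin 4) :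
    ContDiffAt ℝ n (fun y => invMetric M y a b) p := by
  have hr := radius_pos hM hp
  have h1 := contDiffAt_lapse hr M (n := n)
  have h2 := contDiffAt_dr hr a (n := n)
  have h3 := contDiffAt_dr hr b (n := n)
  have h4 := (lapse_pos hM hp).ne'
  have h : ContDiffAt ℝ n (fun y => (lapse M y)⁻¹ * dt a * dt b - spatialDelta a b
      + (1 - lapse M y) * dr y a * dr y b) p := by fun_prop (disch := assumption)
  refine h.congr_of_eventuallyEq ?_
  filter_upwards [exterior_mem_nhds hp] with y hy
  exact invMetric_eq hM hy a b

theorem contDiffAt_hodge (hM : 0 < M) (hp : p ∈ exterior M) {T : TensorField}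
    (hT : ∀ a b, ContDiffAt ℝ n (fun y => T y a b) p) (a b : Fin 4) :
    ContDiffAt ℝ n (fun y => hodge M T y a b) p := by
  have hg := fun a b => contDiffAt_invMetric hM hp a b (n := n)
  have h : ContDiffAt ℝ n (fun y => 1 / 2 * ∑ c, ∑ d, ∑ e, ∑ f,
      leviCivita a b c d * invMetric M y c e * invMetric M y d f * T y e f) p := by fun_prop
  refine h.congr_of_eventuallyEq ?_
  filter_upwards [exterior_mem_nhds hp] with y hy
  simp only [hodge, volForm_eq hM hy]

theorem contDiffAt_Z (hM : 0 < M) (hp : p ∈ exterior M) {F : TensorField}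
    (hF : ∀ a b, ContDiffAt ℝ n (fun y => F y a b) p) (a b : Fin 4) :
    ContDiffAt ℝ n (fun y => Z M F y a b) p := by
  have hg := fun a b => contDiffAt_invMetric hM hp a b (n := n)
  have hh := contDiffAt_hodge hM hp hF
  unfold Z starFY killingYano
  fun_prop

theorem contDiffAt_radial (hM : 0 < M) (hp : p ∈ exterior M) {T : TensorField}
    (hT : ∀ a b, ContDiffAt ℝ n (fun y => T y a b) p) (b : Fin 4) :
    ContDiffAt ℝ n (fun y => radial T y b) p := by
  have h2 := fun a => contDiffAt_dr (radius_pos hM hp) a (n := n)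
  unfold radial
  fun_prop

theorem contDiffAt_nullContr (hM : 0 < M) (hp : p ∈ exterior M) {T : TensorField}
    (hT : ∀ a b, ContDiffAt ℝ n (fun y => T y a b) p) (s : ℝ) (b : Fin 4) :
    ContDiffAt ℝ n (fun y => nullContr M s T y b) p := by
  have h1 := contDiffAt_lapse (radius_pos hM hp) M (n := n)
  have h2 := contDiffAt_radial hM hp hT
  unfold nullContr
  fun_prop

end Smoothness

variable {M : ℝ} {T : TensorField} {p : Point}

theorem isTransverse_hodge (hM : 0 < M) (hT : IsExtreme M T) :
    IsTransverse M (hodge M T) where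
  antisymm p _ := hodge_antisymm M T p
  trace_dr p hp := by
    simp only [hT.hodge_time hM hp]
    simp [Fin.sum_univ_four, leviCivita_eq]
    norm_num
    ring

/-- The rotated vector `(n × w)_b`, with `n` the radial unit vector. -/
def rotate (p : Point) (w : Fin 4 → ℝ) (b : Fin 4) : ℝ :=
  ∑ c, ∑ d, leviCivita 0 b c d * dr p c * w d

/-- The factors f and f⁻¹ from the exchange of the two parts of T match exactly along a null
direction. So w_s is only rotated, in a sense given by s. -/
theorem nullContr_hodge (hM : 0 < M) (hT : IsExtreme M T) (hp : p ∈ exterior M) {s : ℝ}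
    (hs : s ^ 2 = 1) (b : Fin 4) :
    nullContr M s (hodge M T) p b = s * rotate p (nullContr M s T p) b := by
  have hf := (lapse_pos hM hp).ne'
  have e : ∀ c d, leviCivita 0 b c d * dr p c * nullContr M s T p d
      = leviCivita 0 b c d * dr p c * T p 0 d
        + s * lapse M p * (leviCivita 0 b c d * dr p c * radial T p d) := by
    intro c d
    rw [nullContr]
    ring
  rw [nullContr, hT.hodge_time hM hp, hT.radial_hodge hM hp]
  simp only [rotate, e, Finset.sum_add_distrib, ← Finset.mul_sum]
  rw [show ∀ x y : ℝ, s * lapse M p * ((lapse M p)⁻¹ * x) = s * x * (lapse M p * (lapse M p)⁻¹)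
    from fun _ _ => by ring, mul_inv_cancel₀ hf]
  · linear_combination -(lapse M p * ∑ c, ∑ d, leviCivita 0 b c d * dr p c * radial T p d) * hs
  · exact 0

/-- The divergence of a tangential covector field. -/
def divergence (w : Point → Fin 4 → ℝ) (p : Point) : ℝ := ∑ b, pd b (fun y => w y b) p

/-- The radial component of the curl of a tangential covector field. -/
def radialCurl (w : Point → Fin 4 → ℝ) (p : Point) : ℝ :=
  ∑ b, ∑ c, ∑ d, leviCivita 0 b c d * dr p c * pd b (fun y => w y d) p

/-- The derivative of n is symmetric in its two indices, so it drops out against the alternating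
symbol. -/
theorem divergence_rotate (hr : 0 < radius p) {w : Point → Fin 4 → ℝ}
    (hw : ∀ b, DifferentiableAt ℝ (fun y => w y b) p) :
    divergence (fun y => rotate y (w y)) p = radialCurl w p := by
  have hdn (a : Fin 4) : DifferentiableAt ℝ (fun y => dr y a) p :=
    (contDiffAt_dr hr a (n := 1)).differentiableAt (by simp)
  have e : ∀ b, pd b (fun y => rotate y (w y) b) p
      = ∑ c, ∑ d, (leviCivita 0 b c d * ((spatialDelta b c - dr p b * dr p c) / radius p) * w p d
        + leviCivita 0 b c d * dr p c * pd b (fun y => w y d) p) := by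
    intro b
    simp only [rotate]
    rw [pd_sum _ _ fun c _ => by fun_prop]
    refine Finset.sum_congr rfl fun c _ => ?_
    rw [pd_sum _ _ fun d _ => by fun_prop]
    refine Finset.sum_congr rfl fun d _ => ?_
    rw [pd_mul b (by fun_prop) (hw d), pd_mul b (by fun_prop) (hdn c), pd_const, pd_dr hr]
    ring
  simp only [divergence, e, Finset.sum_add_distrib, radialCurl]
  rw [add_eq_right]
  have e2 : ∑ b, ∑ c, ∑ d,
      leviCivita 0 b c d * ((spatialDelta b c - dr p b * dr p c) / radius p) * w p d
      = -∑ b, ∑ c, ∑ d,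
      leviCivita 0 b c d * ((spatialDelta b c - dr p b * dr p c) / radius p) * w p d := by
    conv_lhs => rw [Finset.sum_comm]
    simp only [← Finset.sum_neg_distrib]
    refine Finset.sum_congr rfl fun b _ => Finset.sum_congr rfl fun c _ =>
      Finset.sum_congr rfl fun d _ => ?_
    rw [spatialDelta_comm, leviCivita_eq, leviCivita_eq]
    ring
  linarith

theorem divSnd_hodge_null (hM : 0 < M) (hT : IsExtreme M T) (hp : p ∈ exterior M)
    (hd : ∀ a b, ContDiffAt ℝ 1 (fun y => T y a b) p) {s : ℝ} (hs : s ^ 2 = 1) :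
    divSnd M (hodge M T) p 0 + s * lapse M p * ∑ a, dr p a * divSnd M (hodge M T) p a
      = -(s * radialCurl (nullContr M s T) p) := by
  have hw (b : Fin 4) : DifferentiableAt ℝ (fun y => nullContr M s T y b) p :=
    (contDiffAt_nullContr hM hp hd s b).differentiableAt (by simp)
  rw [divSnd_null hM (isTransverse_hodge hM hT) hp
    (fun a b => (contDiffAt_hodge hM hp hd a b).differentiableAt (by simp)),
    ← divergence_rotate (radius_pos hM hp) hw, divergence, Finset.mul_sum]
  congr 1
  refine Finset.sum_congr rfl fun b _ => ?_
  have hn (a : Fin 4) : DifferentiableAt ℝ (fun y => dr y a) p :=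
    (contDiffAt_dr (radius_pos hM hp) a (n := 1)).differentiableAt (by simp)
  rw [pd_congr (g := fun y => s * rotate y (nullContr M s T y) b), pd_mul _ (by fun_prop), pd_const]
  · ring
  · unfold rotate
    fun_prop
  · filter_upwards [exterior_mem_nhds hp] with y hy
    exact nullContr_hodge hM hT hy hs b

theorem Uup_eq (hM : 0 < M) (hp : p ∈ exterior M) (a : Fin 4) :
    Uup M p a = lapse M p / radius p * dr p a := by
  have e : ∀ b, invMetric M p a b * U p b = -(radius p)⁻¹ * (invMetric M p a b * dr p b) := by
    intro b
    rw [U, pd_radius (radius_pos hM hp)]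
    ring
  simp only [Uup, e, ← Finset.mul_sum, sum_invMetric_dr hM hp]
  ring

theorem beta_re (M : ℝ) (F : TensorField) (p : Point) (a : Fin 4) : (beta M F p a).re
    = -(1 / 2) * (∑ b, Uup M p b * Z M F p a b) - 1 / 2 * divSnd M (Z M F) p a := by
  rw [beta, show -(1 / 2 : ℂ) = ((-(1 / 2) : ℝ) : ℂ) by push_cast; rfl,
    show (1 / 2 : ℂ) = ((1 / 2 : ℝ) : ℂ) by push_cast; rfl]
  simp only [Complex.sub_re, Complex.mul_re, Complex.mul_im, Complex.ofReal_re, Complex.ofReal_im,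
    Complex.I_re, Complex.I_im]
  ring

theorem beta_im (M : ℝ) (F : TensorField) (p : Point) (a : Fin 4) : (beta M F p a).im
    = -(1 / 2) * (∑ b, Uup M p b * hodge M (Z M F) p a b)
      - 1 / 2 * divSnd M (hodge M (Z M F)) p a := by
  rw [beta, show -(1 / 2 : ℂ) = ((-(1 / 2) : ℝ) : ℂ) by push_cast; rfl,
    show (1 / 2 : ℂ) = ((1 / 2 : ℝ) : ℂ) by push_cast; rfl]
  simp only [Complex.sub_im, Complex.mul_re, Complex.mul_im, Complex.ofReal_re, Complex.ofReal_im,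
    Complex.I_re, Complex.I_im]
  ring

/-- The component of `β` along `∂_r`. -/
def betaRadial (M : ℝ) (F : TensorField) (p : Point) : ℂ := ∑ a, (dr p a : ℂ) * beta M F p a

/-- The component of `β` along `∂_t + s f ∂_r`. -/
def betaNull (M s : ℝ) (F : TensorField) (p : Point) : ℂ :=
  beta M F p 0 + (s * lapse M p : ℝ) * betaRadial M F p

/-- The real part is the null divergence of Z and the imaginary part that of its dual, whose null
contraction is the rotated w_s. The divergence of a rotated field is a curl. -/
theorem betaNull_eq (hM : 0 < M) (hp : p ∈ exterior M) {F : TensorField}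
    (hF : ∀ a b, ContDiffAt ℝ 1 (fun y => F y a b) p) {s : ℝ} (hs : s ^ 2 = 1) :
    betaNull M s F p = ⟨1 / 2 * divergence (nullContr M s (Z M F)) p,
      1 / 2 * (s * radialCurl (nullContr M s (Z M F)) p)⟩ := by
  have hZ := isExtreme_Z hM F
  have hdZ := contDiffAt_Z hM hp hF
  -- U is radial and T has no t-r component, so the contraction with U is tangential and contributes
  -- nothing to the null components of β.
  have hU {T : TensorField} (hT : IsTransverse M T) :
      ∑ b, Uup M p b * T p 0 b = 0 ∧ ∑ a, dr p a * ∑ b, Uup M p b * T p a b = 0 := by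
    simp only [Uup_eq hM hp, mul_assoc, ← Finset.mul_sum, hT.trace_dr p hp, mul_zero, true_and]
    have h := hT.sum_dr_radial hp
    simp only [radial, Finset.mul_sum] at h ⊢
    rw [← mul_zero (lapse M p / radius p), ← h, Finset.mul_sum, Finset.sum_comm]
    simp only [Finset.mul_sum]
    refine Finset.sum_congr rfl fun b _ => Finset.sum_congr rfl fun c _ => ?_
    ring
  obtain ⟨u1, u2⟩ := hU hZ.toIsTransverse
  obtain ⟨u3, u4⟩ := hU (isTransverse_hodge hM hZ)
  have d1 := divSnd_null hM hZ.toIsTransverse hp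
    (fun a b => (hdZ a b).differentiableAt (by simp)) s
  have d2 := divSnd_hodge_null hM hZ hp hdZ hs
  rw [divergence]
  refine Complex.ext ?_ ?_
  · have e : ∑ a, dr p a * (beta M F p a).re
        = -(1 / 2) * ∑ a, dr p a * (∑ b, Uup M p b * Z M F p a b)
          - 1 / 2 * ∑ a, dr p a * divSnd M (Z M F) p a := by
      simp only [beta_re, Finset.mul_sum (s := Finset.univ) (a := (-(1 / 2) : ℝ)),
        Finset.mul_sum (s := Finset.univ) (a := (1 / 2 : ℝ)), ← Finset.sum_sub_distrib]
      exact Finset.sum_congr rfl fun a _ => by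
        rw [← Finset.mul_sum]
        ring
    simp only [betaNull, betaRadial, Complex.add_re, Complex.re_ofReal_mul, Complex.re_sum]
    rw [e, beta_re, u1, u2]
    linear_combination -(1 / 2) * d1
  · have e : ∑ a, dr p a * (beta M F p a).im
        = -(1 / 2) * ∑ a, dr p a * (∑ b, Uup M p b * hodge M (Z M F) p a b)
          - 1 / 2 * ∑ a, dr p a * divSnd M (hodge M (Z M F)) p a := by
      simp only [beta_im, Finset.mul_sum (s := Finset.univ) (a := (-(1 / 2) : ℝ)),
        Finset.mul_sum (s := Finset.univ) (a := (1 / 2 : ℝ)), ← Finset.sum_sub_distrib]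
      exact Finset.sum_congr rfl fun a _ => by
        rw [← Finset.mul_sum]
        ring
    simp only [betaNull, betaRadial, Complex.add_im, Complex.im_ofReal_mul, Complex.im_sum]
    rw [e, beta_im, u3, u4]
    linear_combination -(1 / 2) * d2

end

/-! ### The null components of the currents -/

section

/-- The component along `∂_t + s f ∂_r` of a covector. -/
def nullComp (M s : ℝ) (p : Point) (v : Fin 4 → ℝ) : ℝ := v 0 + s * lapse M p * ∑ a, dr p a * v a

/-- The part of a covector tangential to the spheres. -/
def tangential (p : Point) (v : Fin 4 → ℝ) (a : Fin 4) : ℝ :=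
  v a - dt a * v 0 - dr p a * ∑ b, dr p b * v b

variable {M : ℝ} {p : Point}

theorem nullComp_add (M s : ℝ) (p : Point) (v w : Fin 4 → ℝ) :
    nullComp M s p (fun a => v a + w a) = nullComp M s p v + nullComp M s p w := by
  simp only [nullComp, mul_add, Finset.sum_add_distrib]
  ring

theorem nullComp_mul (M s : ℝ) (p : Point) (c : ℝ) (v : Fin 4 → ℝ) :
    nullComp M s p (fun a => c * v a) = c * nullComp M s p v := by
  simp only [nullComp, mul_left_comm _ c, ← Finset.mul_sum]
  ring

theorem nullComp_sum (M s : ℝ) (p : Point) {ι : Type*} (t : Finset ι) (v : ι → Fin 4 → ℝ) :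
    nullComp M s p (fun a => ∑ i ∈ t, v i a) = ∑ i ∈ t, nullComp M s p (v i) := by
  simp only [nullComp, Finset.sum_add_distrib, Finset.mul_sum]
  rw [Finset.sum_comm]

theorem nullComp_tensor (M s : ℝ) (T : TensorField) (p : Point) (b : Fin 4) :
    nullComp M s p (fun a => T p a b) = nullContr M s T p b := rfl

theorem nullComp_dr (hr : 0 < radius p) (s : ℝ) : nullComp M s p (dr p) = s * lapse M p := by
  rw [nullComp, sum_dr_mul_dr hr, dr_zero]
  ring

theorem nullComp_metric (hM : 0 < M) (hp : p ∈ exterior M) (s : ℝ) (b : Fin 4) :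
    nullComp M s p (fun a => metric M p a b) = lapse M p * dt b - s * dr p b := by
  have hf := (lapse_pos hM hp).ne'
  have e : ∀ a, dr p a * metric M p a b = dt b * lapse M p * (dt a * dr p a)
      - spatialDelta b a * dr p a + (1 - (lapse M p)⁻¹) * dr p b * (dr p a * dr p a) := by
    intro a
    rw [metric_eq, spatialDelta_comm]
    ring
  have h0 : metric M p 0 b = lapse M p * dt b := by
    rw [metric_eq]
    simp [spatialDelta, dt]
  simp only [nullComp, h0, e, Finset.sum_add_distrib, Finset.sum_sub_distrib, ← Finset.mul_sum,
    sum_dt_mul, sum_spatialDelta_mul, sum_dr_mul_dr (radius_pos hM hp), dr_zero]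
  field_simp
  ring

theorem sum_sq_tangential (hr : 0 < radius p) (v : Fin 4 → ℝ) :
    ∑ a, tangential p v a ^ 2 = ∑ a, v a ^ 2 - v 0 ^ 2 - (∑ b, dr p b * v b) ^ 2 := by
  have h := sum_dr_sq hr
  simp only [tangential]
  obtain ⟨k, hk⟩ : ∃ k, k = ∑ b, dr p b * v b := ⟨_, rfl⟩
  rw [← hk]
  simp only [Fin.sum_univ_four, dr_zero] at hk
  simp [Fin.sum_univ_four, dt]
  linear_combination k ^ 2 * h + 2 * k * hk

theorem sum_tangential_mul (v : Fin 4 → ℝ) {w : Fin 4 → ℝ} (h0 : w 0 = 0)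
    (hn : ∑ b, dr p b * w b = 0) : ∑ a, tangential p v a * w a = ∑ a, v a * w a := by
  have e : ∀ a, tangential p v a * w a = v a * w a - v 0 * (dt a * w a)
      - (∑ b, dr p b * v b) * (dr p a * w a) := by
    intro a
    rw [tangential]
    ring
  simp only [e, Finset.sum_sub_distrib, ← Finset.mul_sum, sum_dt_mul, h0, hn]
  ring

theorem sum_invMetric_sq (hM : 0 < M) (hp : p ∈ exterior M) (v : Fin 4 → ℝ) :
    ∑ c, (∑ b, invMetric M p c b * v b) * v c = (lapse M p)⁻¹ * v 0 ^ 2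
      - lapse M p * (∑ b, dr p b * v b) ^ 2 - ∑ a, tangential p v a ^ 2 := by
  have e : ∀ c, (∑ b, invMetric M p c b * v b) * v c = ((lapse M p)⁻¹ + 1) * v 0 * (dt c * v c)
      - v c ^ 2 + (1 - lapse M p) * (∑ b, dr p b * v b) * (dr p c * v c) := by
    intro c
    rw [sum_invMetric_mul hM hp]
    ring
  rw [sum_sq_tangential (radius_pos hM hp)]
  simp only [e, Finset.sum_add_distrib, Finset.sum_sub_distrib, ← Finset.mul_sum, sum_dt_mul]
  ring

section Superenergy

variable (F : TensorField)

/-- The squared length of the part of `β` tangential to the spheres. -/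
def betaTanSq (F : TensorField) (M : ℝ) (p : Point) : ℝ :=
  ∑ a, (tangential p (fun b => (beta M F p b).re) a ^ 2
    + tangential p (fun b => (beta M F p b).im) a ^ 2)

theorem betaTanSq_nonneg : 0 ≤ betaTanSq F M p :=
  Finset.sum_nonneg fun _ _ => by positivity

theorem betaUp_re (a : Fin 4) :
    (betaUp M F p a).re = ∑ b, invMetric M p a b * (beta M F p b).re := by
  simp [betaUp]

theorem betaUp_im (a : Fin 4) :
    (betaUp M F p a).im = ∑ b, invMetric M p a b * (beta M F p b).im := by
  simp [betaUp]

theorem beta_norm_eq (hM : 0 < M) (hp : p ∈ exterior M) :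
    (∑ c, betaUp M F p c * star (beta M F p c)).re
      = (lapse M p)⁻¹ * Complex.normSq (beta M F p 0)
        - lapse M p * Complex.normSq (betaRadial M F p) - betaTanSq F M p := by
  have h1 := sum_invMetric_sq hM hp fun b => (beta M F p b).re
  have h2 := sum_invMetric_sq hM hp fun b => (beta M F p b).im
  simp only [← betaUp_re, ← betaUp_im] at h1 h2
  simp only [Complex.re_sum, Complex.mul_re, Complex.star_def, Complex.conj_re, Complex.conj_im,
    mul_neg, sub_neg_eq_add, Finset.sum_add_distrib, h1, h2, betaTanSq, Complex.normSq_apply,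
    betaRadial, Complex.im_sum, Complex.ofReal_re, Complex.ofReal_im, zero_mul, sub_zero, Complex.im_ofReal_mul]
  ring

theorem nullComp_H (hM : 0 < M) (hp : p ∈ exterior M) (s : ℝ) (b : Fin 4) :
    nullComp M s p (fun a => H M F p a b) = (betaNull M s F p * star (beta M F p b)).re
      - 1 / 2 * (lapse M p * dt b - s * dr p b) * ((lapse M p)⁻¹ * Complex.normSq (beta M F p 0)
        - lapse M p * Complex.normSq (betaRadial M F p) - betaTanSq F M p) := by
  have e : (fun a => H M F p a b) = fun a => ((beta M F p b).re * (beta M F p a).re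
      + (beta M F p b).im * (beta M F p a).im)
      + (-1 / 2 * (∑ c, betaUp M F p c * star (beta M F p c)).re) * metric M p a b := by
    ext a
    simp only [H, Complex.mul_re, Complex.star_def, Complex.conj_re, Complex.conj_im]
    ring
  rw [e, nullComp_add, nullComp_add, nullComp_mul, nullComp_mul, nullComp_mul,
    nullComp_metric hM hp, beta_norm_eq F hM hp]
  simp only [betaNull, nullComp, Complex.mul_re, Complex.star_def, Complex.conj_re,
    Complex.conj_im, Complex.add_re, Complex.add_im, Complex.ofReal_re, Complex.ofReal_im, zero_mul, sub_zero, Complex.im_ofReal_mul,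
    betaRadial, Complex.im_sum, Complex.re_sum]
  ring

/-- Here ξ = ½(ℓ₊ + ℓ₋), while H(ℓ_s, ℓ_s) = |β(ℓ_s)|² because ℓ_s is null, and H(ℓ₊, ℓ₋) =
f|β_tan|² because the products of null components cancel against the trace term. -/
theorem nullComp_currentXi (hM : 0 < M) (hp : p ∈ exterior M) {s : ℝ} (hs : s ^ 2 = 1) :
    nullComp M s p (currentXi M F p)
      = 1 / 2 * (Complex.normSq (betaNull M s F p) + lapse M p * betaTanSq F M p) := by
  have hf := (lapse_pos hM hp).ne'
  have e : currentXi M F p = fun a => H M F p a 0 := by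
    ext a
    simp [currentXi, xi]
  rw [e, nullComp_H F hM hp]
  simp only [dr_zero, show dt 0 = 1 from rfl, betaNull, Complex.normSq_apply, Complex.mul_re,
    Complex.star_def, Complex.conj_re, Complex.conj_im, Complex.add_re, Complex.add_im,
    Complex.ofReal_re, Complex.ofReal_im, zero_mul, sub_zero, Complex.im_ofReal_mul]
  field_simp
  linear_combination (lapse M p) ^ 3 * (-(betaRadial M F p).re ^ 2 - (betaRadial M F p).im ^ 2) * hs

/-- The vector A equals ½α(ℓ₊ - ℓ₋) with α = (r - 3M)/(2r), so the two values of H from the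
ξ-current now enter with opposite signs. -/
theorem nullComp_HA (hM : 0 < M) (hp : p ∈ exterior M) {s : ℝ} (hs : s ^ 2 = 1) :
    nullComp M s p (fun a => ∑ b, H M F p a b * A M p b)
      = s * ((radius p - 3 * M) / (2 * radius p))
        * (1 / 2 * (Complex.normSq (betaNull M s F p) - lapse M p * betaTanSq F M p)) := by
  have hf := (lapse_pos hM hp).ne'
  have hr := radius_pos hM hp
  have hA : ∀ b, A M p b = lapse M p * ((radius p - 3 * M) / (2 * radius p)) * dr p b := by
    intro b
    simp only [A, lapse, dr]
    split_ifs <;> field_simp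
  have e : (fun a => ∑ b, H M F p a b * A M p b) = fun a =>
      ∑ b, (lapse M p * ((radius p - 3 * M) / (2 * radius p)) * dr p b) * H M F p a b := by
    ext a
    exact Finset.sum_congr rfl fun b _ => by rw [hA]; ring
  rw [e, nullComp_sum]
  simp only [nullComp_mul, nullComp_H F hM hp]
  set Q := ((lapse M p)⁻¹ * Complex.normSq (beta M F p 0)
        - lapse M p * Complex.normSq (betaRadial M F p) - betaTanSq F M p) with hQ
  have e2 : ∀ b, lapse M p * ((radius p - 3 * M) / (2 * radius p)) * dr p b *
      ((betaNull M s F p * star (beta M F p b)).re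
        - 1 / 2 * (lapse M p * dt b - s * dr p b) * Q)
      = lapse M p * ((radius p - 3 * M) / (2 * radius p)) *
        ((betaNull M s F p).re * (dr p b * (beta M F p b).re)
          + (betaNull M s F p).im * (dr p b * (beta M F p b).im)
          - 1 / 2 * lapse M p * Q * (dt b * dr p b) + 1 / 2 * s * Q * (dr p b * dr p b)) := by
    intro b
    simp only [Complex.mul_re, Complex.star_def, Complex.conj_re, Complex.conj_im]
    ring
  have h1 : ∑ b, dr p b * (beta M F p b).re = (betaRadial M F p).re := by simp [betaRadial]
  have h2 : ∑ b, dr p b * (beta M F p b).im = (betaRadial M F p).im := by simp [betaRadial]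
  simp only [e2, ← Finset.mul_sum, Finset.sum_add_distrib, Finset.sum_sub_distrib, sum_dt_mul,
    dr_zero, sum_dr_mul_dr hr, h1, h2]
  rw [hQ]
  simp only [betaNull, Complex.normSq_apply, Complex.add_re, Complex.add_im,
    Complex.re_ofReal_mul, Complex.im_ofReal_mul]
  generalize (betaRadial M F p).re = x
  generalize (betaRadial M F p).im = y
  generalize (beta M F p 0).re = u
  generalize (beta M F p 0).im = v
  have hg : lapse M p * (lapse M p)⁻¹ = 1 := mul_inv_cancel₀ hf
  generalize (lapse M p)⁻¹ = g at *
  generalize lapse M p = f at *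
  generalize (radius p - 3 * M) / (2 * radius p) = α
  linear_combination -α * (f * (u * x + v * y) + 1 / 2 * s * f ^ 2 * (x ^ 2 + y ^ 2)) * hs
    + α / 2 * s * (u ^ 2 + v ^ 2) * hg

theorem crossTerm_re (a : Fin 4) : (crossTerm M F p a).re = ∑ b, 1 / 2 * q M p *
    ((betaUp M F p b).re * Z M F p a b + (betaUp M F p b).im * hodge M (Z M F) p a b) := by
  rw [crossTerm, Complex.re_sum]
  refine Finset.sum_congr rfl fun b _ => ?_
  rw [show (1 / 4 : ℂ) = ((1 / 4 : ℝ) : ℂ) by push_cast; rfl]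
  simp only [Complex.add_re, Complex.sub_re, Complex.mul_re, Complex.mul_im, Complex.ofReal_re,
    Complex.ofReal_im, Complex.I_re, Complex.I_im, Complex.star_def, Complex.conj_re,
    Complex.conj_im]
  ring

theorem sum_betaUp_mul (hM : 0 < M) (hp : p ∈ exterior M) (v : Fin 4 → ℝ) {w : Fin 4 → ℝ}
    (h0 : w 0 = 0) (hn : ∑ b, dr p b * w b = 0) :
    ∑ b, (∑ c, invMetric M p b c * v c) * w b = -∑ b, tangential p v b * w b := by
  rw [sum_tangential_mul v h0 hn, ← Finset.sum_neg_distrib]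
  simp only [Finset.sum_mul]
  rw [Finset.sum_comm]
  refine Finset.sum_congr rfl fun b _ => ?_
  rw [← mul_neg, ← sum_invMetric_tangent hM hp b h0 hn, Finset.mul_sum]
  exact Finset.sum_congr rfl fun c _ => by rw [invMetric_comm hM hp]; ring

/-- The null contractions of Z and of its dual are tangential, so they see only the tangential part
of β. The sign comes from raising an index on the spheres. -/
theorem nullComp_crossTerm (hM : 0 < M) (hp : p ∈ exterior M) (s : ℝ) :
    nullComp M s p (fun a => (crossTerm M F p a).re) = -(1 / 2) * q M p *
      ∑ b, (tangential p (fun b => (beta M F p b).re) b * nullContr M s (Z M F) p b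
        + tangential p (fun b => (beta M F p b).im) b
          * nullContr M s (hodge M (Z M F)) p b) := by
  have hZ := isExtreme_Z hM F
  have hH := isTransverse_hodge hM hZ
  have h1 := sum_betaUp_mul hM hp (fun b => (beta M F p b).re) (hZ.nullContr_zero hp s)
    (hZ.sum_dr_nullContr hp s)
  have h2 := sum_betaUp_mul hM hp (fun b => (beta M F p b).im) (hH.nullContr_zero hp s)
    (hH.sum_dr_nullContr hp s)
  have e : (fun a => (crossTerm M F p a).re) = fun a => ∑ b, 
      ((1 / 2 * q M p * (betaUp M F p b).re) * Z M F p a b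
        + (1 / 2 * q M p * (betaUp M F p b).im) * hodge M (Z M F) p a b) := by
    ext a
    rw [crossTerm_re]
    exact Finset.sum_congr rfl fun b _ => by ring
  rw [e, nullComp_sum]
  simp only [nullComp_add, nullComp_mul, nullComp_tensor, mul_assoc, Finset.sum_add_distrib,
    ← Finset.mul_sum]
  simp only [betaUp_re, betaUp_im, h1, h2]
  ring

/-- The radial derivative of `q`. -/
def qDeriv (M : ℝ) (p : Point) : ℝ :=
  9 * M ^ 2 * (-6 * radius p ^ 2 + 28 * M * radius p - 30 * M ^ 2) / (4 * radius p ^ 6)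

theorem pd_q (hr : 0 < radius p) (a : Fin 4) : pd a (q M) p = qDeriv M p * dr p a := by
  have hd : HasFDerivAt radius (fderiv ℝ radius p) p :=
    ((contDiffAt_radius hr (n := 1)).differentiableAt (by simp)).hasFDerivAt
  have h : HasDerivAt (fun r : ℝ => 9 * M ^ 2 * (r - 2 * M) * (2 * r - 3 * M) / (4 * r ^ 5))
      (qDeriv M p) (radius p) := by
    have h1 : HasDerivAt (fun r : ℝ => 9 * M ^ 2 * (r - 2 * M) * (2 * r - 3 * M))
        (9 * M ^ 2 * (4 * radius p - 7 * M)) (radius p) := by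
      refine ((((hasDerivAt_id' (radius p)).sub_const (2 * M)).const_mul (9 * M ^ 2)).fun_mul
        (((hasDerivAt_id' (radius p)).const_mul 2).sub_const (3 * M))).congr_deriv ?_
      ring
    have h2 : HasDerivAt (fun r : ℝ => 4 * r ^ 5) (4 * (5 * radius p ^ 4)) (radius p) := by
      simpa using (hasDerivAt_pow 5 (radius p)).const_mul 4
    refine (h1.fun_div h2 (by positivity)).congr_deriv ?_
    rw [qDeriv]
    field_simp
    ring
  have h' := h.comp_hasFDerivAt p hd
  rw [pd, show q M = (fun r : ℝ => 9 * M ^ 2 * (r - 2 * M) * (2 * r - 3 * M) / (4 * r ^ 5)) ∘ radius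
    from rfl, h'.fderiv, ← pd_radius hr]
  rfl

theorem nullComp_ZZ (hM : 0 < M) (hp : p ∈ exterior M) (s : ℝ) (b : Fin 4) :
    nullComp M s p (fun a => ZZ M F p a b)
      = -∑ c, nullContr M s (Z M F) p c * Z M F p b c := by
  have hZ := isExtreme_Z hM F
  have e : (fun a => ZZ M F p a b) = fun a =>
      ∑ c, ∑ d, (invMetric M p d c * Z M F p b c) * Z M F p a d := by
    ext a
    exact Finset.sum_congr rfl fun c _ => Finset.sum_congr rfl fun d _ => by ring
  rw [e, nullComp_sum, ← Finset.sum_neg_distrib]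
  refine Finset.sum_congr rfl fun c _ => ?_
  rw [nullComp_sum, ← neg_mul, ← sum_invMetric_tangent hM hp c (hZ.nullContr_zero hp s)
    (hZ.sum_dr_nullContr hp s), Finset.sum_mul]
  refine Finset.sum_congr rfl fun d _ => ?_
  rw [nullComp_mul, nullComp_tensor, invMetric_comm hM hp]
  ring

theorem trace_ZZ (hM : 0 < M) (hp : p ∈ exterior M) :
    ∑ b, ∑ c, invMetric M p b c * ZZ M F p b c
      = 2 * lapse M p * ∑ b, radial (Z M F) p b ^ 2 - 2 * (lapse M p)⁻¹ * ∑ b, Z M F p 0 b ^ 2 := by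
  have hZ := isExtreme_Z hM F
  have e1 : ∀ b, ∑ c, invMetric M p b c * ZZ M F p b c = ∑ d, Z M F p b d *
      (-(lapse M p)⁻¹ * (dt b * Z M F p 0 d - dt d * Z M F p 0 b)
        + lapse M p * (dr p b * radial (Z M F) p d - dr p d * radial (Z M F) p b)) := by
    intro b
    simp only [← hZ.raise_eq hM hp, ZZ, Finset.mul_sum]
    rw [Finset.sum_congr rfl fun _ _ => Finset.sum_comm]
    rw [Finset.sum_comm]
    exact Finset.sum_congr rfl fun d _ => Finset.sum_congr rfl fun c _ =>
      Finset.sum_congr rfl fun e _ => by ring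
  have e2 : ∀ b, ∑ d, Z M F p b d *
      (-(lapse M p)⁻¹ * (dt b * Z M F p 0 d - dt d * Z M F p 0 b)
        + lapse M p * (dr p b * radial (Z M F) p d - dr p d * radial (Z M F) p b))
      = -(lapse M p)⁻¹ * (dt b * ∑ d, Z M F p b d * Z M F p 0 d + Z M F p 0 b ^ 2)
        + lapse M p * (∑ d, dr p b * Z M F p b d * radial (Z M F) p d
          + radial (Z M F) p b ^ 2) := by
    intro b
    have e3 : Z M F p 0 b = -∑ d, dt d * Z M F p b d := by
      rw [sum_dt_mul, hZ.antisymm p hp]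
    have e4 : radial (Z M F) p b = -∑ d, dr p d * Z M F p b d := by
      rw [radial, ← Finset.sum_neg_distrib]
      exact Finset.sum_congr rfl fun d _ => by rw [hZ.antisymm p hp]; ring
    have e5 : Z M F p 0 b ^ 2 = -∑ d, dt d * Z M F p b d * Z M F p 0 b := by
      rw [← Finset.sum_mul, ← neg_mul, ← e3, sq]
    have e6 : radial (Z M F) p b ^ 2 = -∑ d, dr p d * Z M F p b d * radial (Z M F) p b := by
      rw [← Finset.sum_mul, ← neg_mul, ← e4, sq]
    rw [e5, e6]
    simp only [Finset.mul_sum, ← Finset.sum_neg_distrib, ← Finset.sum_add_distrib]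
    exact Finset.sum_congr rfl fun d _ => by ring
  simp only [e1, e2, Finset.sum_add_distrib, ← Finset.mul_sum, sum_dt_mul]
  rw [Finset.sum_comm (f := fun b d => dr p b * Z M F p b d * radial (Z M F) p d)]
  simp only [← Finset.sum_mul]
  simp only [show ∀ d, ∑ b, dr p b * Z M F p b d = radial (Z M F) p d from fun _ => rfl, ← sq]
  ring

/-- The two terms are -¼ times the trace-free stress tensor of Z, applied to ∇q = -½q'(ℓ₊ - ℓ₋). For
an extreme form this tensor vanishes on (ℓ₊, ℓ₋), and on (ℓ_s, ℓ_s) it is -|w_s|². -/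
theorem nullComp_qTerms (hM : 0 < M) (hp : p ∈ exterior M) {s : ℝ} (hs : s ^ 2 = 1) :
    nullComp M s p (fun a => 1 / 16 * (∑ b, ∑ c, invMetric M p b c * ZZ M F p b c) * pd a (q M) p
      + -(1 / 4) * ∑ b, ∑ c, ZZ M F p a b * invMetric M p b c * pd c (q M) p)
      = -(1 / 8) * s * qDeriv M p * ∑ b, nullContr M s (Z M F) p b ^ 2 := by
  have hr := radius_pos hM hp
  have hg : lapse M p * (lapse M p)⁻¹ = 1 := mul_inv_cancel₀ (lapse_pos hM hp).ne'
  have e : ∀ a, ∑ b, ∑ c, ZZ M F p a b * invMetric M p b c * pd c (q M) p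
      = ∑ b, (-lapse M p * qDeriv M p * dr p b) * ZZ M F p a b := by
    intro a
    refine Finset.sum_congr rfl fun b _ => ?_
    rw [show (-lapse M p * qDeriv M p * dr p b) * ZZ M F p a b
      = (-lapse M p * dr p b) * (qDeriv M p * ZZ M F p a b) by ring, ← sum_invMetric_dr hM hp b,
      Finset.sum_mul]
    exact Finset.sum_congr rfl fun c _ => by rw [pd_q hr]; ring
  have e' : (fun a => 1 / 16 * (∑ b, ∑ c, invMetric M p b c * ZZ M F p b c) * pd a (q M) p
      + -(1 / 4) * ∑ b, ∑ c, ZZ M F p a b * invMetric M p b c * pd c (q M) p)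
      = fun a => (1 / 16 * (∑ b, ∑ c, invMetric M p b c * ZZ M F p b c) * qDeriv M p) * dr p a
        + -(1 / 4) * ∑ b, (-lapse M p * qDeriv M p * dr p b) * ZZ M F p a b := by
    ext a
    rw [e, pd_q hr]
    ring
  rw [e', nullComp_add, nullComp_mul, nullComp_mul, nullComp_sum, nullComp_dr hr, trace_ZZ F hM hp]
  simp only [nullComp_mul, nullComp_ZZ F hM hp]
  have e2 : ∑ b, -lapse M p * qDeriv M p * dr p b * -∑ c, nullContr M s (Z M F) p c * Z M F p b c
      = lapse M p * qDeriv M p * ∑ c, nullContr M s (Z M F) p c * radial (Z M F) p c := by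
    simp only [radial, Finset.mul_sum, ← Finset.sum_neg_distrib]
    rw [Finset.sum_comm]
    exact Finset.sum_congr rfl fun b _ => Finset.sum_congr rfl fun c _ => by ring
  rw [e2]
  have e3 : ∀ c, nullContr M s (Z M F) p c * radial (Z M F) p c = Z M F p 0 c * radial (Z M F) p c
      + s * lapse M p * radial (Z M F) p c ^ 2 := by
    intro c
    rw [nullContr]
    ring
  have e4 : ∀ c, nullContr M s (Z M F) p c ^ 2 = Z M F p 0 c ^ 2
      + 2 * s * lapse M p * (Z M F p 0 c * radial (Z M F) p c)
      + s ^ 2 * lapse M p ^ 2 * radial (Z M F) p c ^ 2 := by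
    intro c
    rw [nullContr]
    ring
  simp only [e3, e4, Finset.sum_add_distrib, ← Finset.mul_sum]
  generalize ∑ b, Z M F p 0 b * radial (Z M F) p b = EX
  generalize ∑ b, Z M F p 0 b ^ 2 = E2
  generalize ∑ b, radial (Z M F) p b ^ 2 = X2
  linear_combination qDeriv M p * (-(1 / 8) * s * E2 * hg
    + (1 / 4 * lapse M p * EX + 1 / 8 * s * lapse M p ^ 2 * X2) * hs)

theorem nullComp_currentXiAq (hM : 0 < M) (hp : p ∈ exterior M) {s : ℝ} (hs : s ^ 2 = 1) :
    nullComp M s p (currentXiAq M F p)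
      = 1 / 2 * ((1 + s * ((radius p - 3 * M) / (2 * radius p)))
            * Complex.normSq (betaNull M s F p)
          + (1 - s * ((radius p - 3 * M) / (2 * radius p))) * (lapse M p * betaTanSq F M p))
        - 1 / 2 * q M p * ∑ b, (tangential p (fun b => (beta M F p b).re) b
            * nullContr M s (Z M F) p b
          + tangential p (fun b => (beta M F p b).im) b
            * nullContr M s (hodge M (Z M F)) p b)
        - 1 / 8 * s * qDeriv M p * ∑ b, nullContr M s (Z M F) p b ^ 2 := by
  have e : currentXiAq M F p = fun a => currentXi M F p a + (((∑ b, H M F p a b * A M p b)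
      + (crossTerm M F p a).re)
      + (1 / 16 * (∑ b, ∑ c, invMetric M p b c * ZZ M F p b c) * pd a (q M) p
      + -(1 / 4) * ∑ b, ∑ c, ZZ M F p a b * invMetric M p b c * pd c (q M) p)) := by
    ext a
    rw [currentXiAq, P]
    ring
  rw [e, nullComp_add, nullComp_add, nullComp_add, nullComp_currentXi F hM hp hs,
    nullComp_HA F hM hp hs, nullComp_crossTerm F hM hp, nullComp_qTerms F hM hp hs]
  ring

end Superenergy

end

/-! ### Pointwise positivity modulo the Poincaré defect -/

section

/-- With x = M/r this is r² times the coefficient of |w|²: the first summand is what the Poincaré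
inequality supplies, the second comes from q'. The value 1/5 is approached for s = -1 as x → 0, that
is, at infinity. -/
theorem potential_lower_bound {x s : ℝ} (h0 : 0 < x) (h1 : x < 1 / 2) (hs : s = 1 ∨ s = -1) :
    1 / 5 ≤ (9 / 10 + s * ((1 - 3 * x) / 2)) / 2
      - s * (9 / 16 * (-6 * x ^ 2 + 28 * x ^ 3 - 30 * x ^ 4)) := by
  rcases hs with rfl | rfl
  -- The bound is the minimum of the quadratic, attained at x = 7/15.
  · have hb : -(8 / 15) ≤ 6 - 28 * x + 30 * x ^ 2 := by nlinarith [sq_nonneg (x - 7 / 15)]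
    have hx : x ^ 2 ≤ 1 / 4 := by nlinarith
    have : -(2 / 15) ≤ x ^ 2 * (6 - 28 * x + 30 * x ^ 2) := by nlinarith [sq_nonneg x]
    nlinarith
  · have h3 : x ^ 3 ≤ x ^ 2 / 2 := by nlinarith [sq_nonneg x]
    -- With 4/3 the loss is at most 9/16 · 4/3 · x = 3x/4, exactly the gain over 1/5 in the first
    -- summand. By the cubic bound the left side is at most 6x - 13x², which peaks at x = 3/13.
    have hb : 6 * x - 28 * x ^ 2 + 30 * x ^ 3 ≤ 4 / 3 := by nlinarith [sq_nonneg (x - 3 / 13)]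
    have : x * (6 * x - 28 * x ^ 2 + 30 * x ^ 3) ≤ x * (4 / 3) :=
      mul_le_mul_of_nonneg_left hb h0.le
    nlinarith

/-- The right side 4/25 is 2 · 2/5 · 1/5, twice the product of the lower bounds for the two diagonal
coefficients of the quadratic form. -/
theorem cross_coefficient_bound {x : ℝ} (h0 : 0 < x) (h1 : x < 1 / 2) :
    81 / 16 * (x ^ 4 * (1 - 2 * x) * (2 - 3 * x) ^ 2) ≤ 4 / 25 := by
  have ha : x * (1 - 2 * x) ≤ 1 / 8 := by nlinarith [sq_nonneg (x - 1 / 4)]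
  have hb : x * (2 - 3 * x) ≤ 1 / 3 := by nlinarith [sq_nonneg (x - 1 / 3)]
  have ha0 : 0 ≤ x * (1 - 2 * x) := by nlinarith
  have hb0 : 0 ≤ x * (2 - 3 * x) := by nlinarith
  have hc : (x * (2 - 3 * x)) ^ 2 ≤ 1 / 9 := by nlinarith
  have hd : x * (x * (1 - 2 * x)) ≤ 1 / 16 := by nlinarith
  have hd0 : 0 ≤ x * (x * (1 - 2 * x)) := by positivity
  calc 81 / 16 * (x ^ 4 * (1 - 2 * x) * (2 - 3 * x) ^ 2)
      = 81 / 16 * (x * (x * (1 - 2 * x)) * (x * (2 - 3 * x)) ^ 2) := by ring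
    _ ≤ 81 / 16 * (1 / 16 * (1 / 9)) := by gcongr
    _ ≤ 4 / 25 := by norm_num

/-- The quadratic form in `(β, Z)` left over after the Hardy-Poincaré estimate is positive. -/
theorem two_mul_abs_le {M : ℝ} (hM : 0 < M) {p : Point} (hp : p ∈ exterior M) {s B W c : ℝ}
    (hs : s = 1 ∨ s = -1) (hB : 0 ≤ B) (hW : 0 ≤ W) (hc : c ^ 2 ≤ 1 / 2 * q M p ^ 2 * B * W) :
    2 * |c| ≤ (9 / 10 - s * ((radius p - 3 * M) / (2 * radius p))) * (lapse M p * B)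
      + (9 / 10 + s * ((radius p - 3 * M) / (2 * radius p))) * (W / (2 * radius p ^ 2))
      - 1 / 4 * s * qDeriv M p * W := by
  have hr := radius_pos hM hp
  have hr' : 2 * M < radius p := hp
  obtain ⟨r, hrr⟩ : ∃ r, r = radius p := ⟨_, rfl⟩
  obtain ⟨x, hx⟩ : ∃ x, x = M / r := ⟨_, rfl⟩
  rw [← hrr] at hr hr'
  have hMx : M = x * r := by rw [hx]; field_simp
  have hx0 : 0 < x := by rw [hx]; positivity
  have hx1 : x < 1 / 2 := by rw [hx, div_lt_iff₀ hr]; linarith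
  have hK := potential_lower_bound hx0 hx1 hs
  set K := (9 / 10 + s * ((1 - 3 * x) / 2)) / 2
      - s * (9 / 16 * (-6 * x ^ 2 + 28 * x ^ 3 - 30 * x ^ 4)) with hKdef
  have hα : (radius p - 3 * M) / (2 * radius p) = (1 - 3 * x) / 2 := by
    rw [← hrr, hMx]; field_simp
  have hf : lapse M p = 1 - 2 * x := by
    rw [lapse, ← hrr, hMx]; field_simp
  have hq : q M p = 9 / 4 * (x ^ 2 * (1 - 2 * x) * (2 - 3 * x)) / r := by
    rw [q, ← hrr, hMx]; field_simp
  have hq' : qDeriv M p = 9 / 4 * (-6 * x ^ 2 + 28 * x ^ 3 - 30 * x ^ 4) / r ^ 2 := by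
    rw [qDeriv, ← hrr, hMx]; field_simp
  set P := 9 / 10 - s * ((1 - 3 * x) / 2) with hP
  -- For s = 1 this coefficient is 2/5 + 3x/2; for s = -1 it exceeds 9/10 - 1/4.
  have hP0 : 2 / 5 ≤ P := by
    rcases hs with rfl | rfl <;> linarith
  have e : (9 / 10 - s * ((radius p - 3 * M) / (2 * radius p))) * (lapse M p * B)
      + (9 / 10 + s * ((radius p - 3 * M) / (2 * radius p))) * (W / (2 * radius p ^ 2))
      - 1 / 4 * s * qDeriv M p * W = P * (1 - 2 * x) * B + K * (W / r ^ 2) := by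
    rw [hα, hf, hq', ← hrr, hKdef]
    field_simp
    ring
  rw [e]
  have hw : 0 ≤ W / r ^ 2 := by positivity
  -- This is the discriminant condition. The claim then follows from the arithmetic-geometric mean
  -- inequality.
  have hc' : c ^ 2 ≤ (P * (1 - 2 * x) * B) * (K * (W / r ^ 2)) := by
    refine hc.trans ?_
    have h1 : 1 / 2 * q M p ^ 2 * B * W = (1 / 2 * (1 - 2 * x) * B * (W / r ^ 2))
        * (81 / 16 * (x ^ 4 * (1 - 2 * x) * (2 - 3 * x) ^ 2)) := by
      rw [hq]
      field_simp
      ring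
    rw [h1]
    have h2 : 0 ≤ 1 / 2 * (1 - 2 * x) * B * (W / r ^ 2) := by
      have : 0 ≤ 1 - 2 * x := by linarith
      positivity
    calc _ ≤ (1 / 2 * (1 - 2 * x) * B * (W / r ^ 2)) * (4 / 25) :=
          mul_le_mul_of_nonneg_left (cross_coefficient_bound hx0 hx1) h2
      _ ≤ (1 / 2 * (1 - 2 * x) * B * (W / r ^ 2)) * (2 * P * K) := by
          apply mul_le_mul_of_nonneg_left _ h2
          have : 2 / 5 * (1 / 5) ≤ P * K := mul_le_mul hP0 hK (by norm_num) (by linarith)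
          linarith
      _ = _ := by ring
  have hn1 : 0 ≤ P * (1 - 2 * x) * B := by
    have : 0 ≤ 1 - 2 * x := by linarith
    positivity
  have hn2 : 0 ≤ K * (W / r ^ 2) := by positivity
  have : (2 * |c|) ^ 2 ≤ (P * (1 - 2 * x) * B + K * (W / r ^ 2)) ^ 2 := by
    rw [mul_pow, sq_abs]
    linear_combination 4 * hc' + sq_nonneg (P * (1 - 2 * x) * B - K * (W / r ^ 2))
  exact le_of_sq_le_sq this (by positivity)

theorem sum_sq_rotate {p : Point} (hr : 0 < radius p) {w : Fin 4 → ℝ} (h0 : w 0 = 0)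
    (hn : ∑ b, dr p b * w b = 0) : ∑ b, rotate p w b ^ 2 = ∑ b, w b ^ 2 := by
  have h := sum_dr_sq hr
  simp only [Fin.sum_univ_four, dr_zero, h0, mul_zero, zero_add] at hn
  simp [rotate, Fin.sum_univ_four, leviCivita_eq, h0]
  norm_num
  linear_combination (w 1 ^ 2 + w 2 ^ 2 + w 3 ^ 2) * h
    - (dr p 1 * w 1 + dr p 2 * w 2 + dr p 3 * w 3) * hn

/-- Cauchy-Schwarz for each product, then (a + b)² ≤ 2a² + 2b². It is applied with w the null
contraction of Z and z that of the dual, which have equal length. -/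
theorem cross_sq_le {u v w z : Fin 4 → ℝ} (h : ∑ b, z b ^ 2 = ∑ b, w b ^ 2) :
    (∑ b, (u b * w b + v b * z b)) ^ 2 ≤ 2 * (∑ b, (u b ^ 2 + v b ^ 2)) * ∑ b, w b ^ 2 := by
  have h1 := Finset.sum_mul_sq_le_sq_mul_sq Finset.univ u w
  have h2 := Finset.sum_mul_sq_le_sq_mul_sq Finset.univ v z
  rw [h] at h2
  simp only [Finset.sum_add_distrib]
  nlinarith [sq_nonneg (∑ b, u b * w b - ∑ b, v b * z b)]

variable {M : ℝ} {p : Point} (F : TensorField)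

/-- The defect in the Poincaré inequality for the null component `w` of `Z`:
`|div w|² + |curl w|² - 2 |w|² / r²`. -/
def poincareDefect (M s : ℝ) (F : TensorField) (p : Point) : ℝ :=
  divergence (nullContr M s (Z M F)) p ^ 2 + radialCurl (nullContr M s (Z M F)) p ^ 2
    - 2 * (∑ b, nullContr M s (Z M F) p b ^ 2) / radius p ^ 2

theorem normSq_betaNull (hM : 0 < M) (hp : p ∈ exterior M)
    (hF : ∀ a b, ContDiffAt ℝ 1 (fun y => F y a b) p) {s : ℝ} (hs : s ^ 2 = 1) :
    Complex.normSq (betaNull M s F p) = 1 / 4 * (divergence (nullContr M s (Z M F)) p ^ 2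
      + radialCurl (nullContr M s (Z M F)) p ^ 2) := by
  rw [betaNull_eq hM hp hF hs, Complex.normSq_mk]
  linear_combination 1 / 4 * radialCurl (nullContr M s (Z M F)) p ^ 2 * hs

/-- Substitute |β(ℓ_s)|² = ¼ defect + |w|²/(2r²). The rest is the quadratic form of
`two_mul_abs_le`, with s for the lower bound and -s for the upper one: the coefficients 1 ± sα
become 9/10 ± sα in the first and 9/10 ∓ sα in the second. -/
theorem nullComp_bounds (hM : 0 < M) (hp : p ∈ exterior M)
    (hF : ∀ a b, ContDiffAt ℝ 1 (fun y => F y a b) p) {s : ℝ} (hs : s = 1 ∨ s = -1) :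
    1 / 8 * (9 / 10 + s * ((radius p - 3 * M) / (2 * radius p))) * poincareDefect M s F p
        ≤ nullComp M s p (currentXiAq M F p) - 1 / 10 * nullComp M s p (currentXi M F p) ∧
      1 / 8 * (9 / 10 - s * ((radius p - 3 * M) / (2 * radius p))) * poincareDefect M s F p
        ≤ 19 / 10 * nullComp M s p (currentXi M F p) - nullComp M s p (currentXiAq M F p) := by
  have hs2 : s ^ 2 = 1 := by rcases hs with rfl | rfl <;> norm_num
  have hs' : -s = 1 ∨ -s = -1 := by rcases hs with rfl | rfl <;> simp
  have hZ := isExtreme_Z hM F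
  have h1 : ∑ b, nullContr M s (hodge M (Z M F)) p b ^ 2 = ∑ b, nullContr M s (Z M F) p b ^ 2 := by
    rw [← sum_sq_rotate (radius_pos hM hp) (hZ.nullContr_zero hp s) (hZ.sum_dr_nullContr hp s)]
    refine Finset.sum_congr rfl fun b _ => ?_
    rw [nullContr_hodge hM hZ hp hs2, mul_pow, hs2, one_mul]
  have h2 := cross_sq_le (u := tangential p (fun b => (beta M F p b).re))
    (v := tangential p (fun b => (beta M F p b).im)) h1
  rw [← betaTanSq] at h2
  rw [nullComp_currentXiAq F hM hp hs2, nullComp_currentXi F hM hp hs2,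
    normSq_betaNull F hM hp hF hs2, poincareDefect]
  set C := ∑ b, (tangential p (fun b => (beta M F p b).re) b * nullContr M s (Z M F) p b
          + tangential p (fun b => (beta M F p b).im) b
            * nullContr M s (hodge M (Z M F)) p b)
  have hB : 0 ≤ betaTanSq F M p := betaTanSq_nonneg F
  have hW : 0 ≤ ∑ b, nullContr M s (Z M F) p b ^ 2 := Finset.sum_nonneg fun _ _ => by positivity
  set W := ∑ b, nullContr M s (Z M F) p b ^ 2
  have hc : (1 / 2 * q M p * C) ^ 2 ≤ 1 / 2 * q M p ^ 2 * betaTanSq F M p * W := by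
    nlinarith [mul_le_mul_of_nonneg_left h2 (sq_nonneg (q M p))]
  have k1 := two_mul_abs_le hM hp hs hB hW hc
  have k2 := two_mul_abs_le hM hp hs' hB hW hc
  have a1 := le_abs_self (1 / 2 * q M p * C)
  have a2 := neg_abs_le (1 / 2 * q M p * C)
  have e : 2 * W / radius p ^ 2 = 4 * (W / (2 * radius p ^ 2)) := by
    have := radius_pos hM hp
    field_simp
    ring
  rw [e]
  constructor
  · linarith
  · linarith

end

/-! ### Rotations of space and integration by parts along them -/

section

/-- The vector `e_i × x`, generating the rotations about the `i`-th axis. -/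
def rotGen (i : Fin 3) : Space →L[ℝ] Space :=
  LinearMap.toContinuousLinearMap
    { toFun := fun x => WithLp.toLp 2 fun m =>
        if m = i + 1 then -x (i + 2) else if m = i + 2 then x (i + 1) else 0
      map_add' := fun x y => by
        ext m
        simp only [PiLp.add_apply]
        split_ifs <;> ring
      map_smul' := fun c x => by
        ext m
        simp only [PiLp.smul_apply, smul_eq_mul, RingHom.id_apply]
        split_ifs <;> ring }

theorem rotGen_apply (i : Fin 3) (x : Space) (m : Fin 3) : rotGen i x m =
    if m = i + 1 then -x (i + 2) else if m = i + 2 then x (i + 1) else 0 := rfl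

/-- The rotation by the angle `s` about the `i`-th axis, by Rodrigues' formula. -/
def rotMap (i : Fin 3) (s : ℝ) : Space →ₗ[ℝ] Space :=
  LinearMap.id + Real.sin s • (rotGen i : Space →ₗ[ℝ] Space)
    + (1 - Real.cos s) • ((rotGen i : Space →ₗ[ℝ] Space) ∘ₗ (rotGen i : Space →ₗ[ℝ] Space))

theorem rotMap_apply (i : Fin 3) (s : ℝ) (x : Space) :
    rotMap i s x = x + Real.sin s • rotGen i x + (1 - Real.cos s) • rotGen i (rotGen i x) := rfl

theorem norm_rotMap (i : Fin 3) (s : ℝ) (x : Space) : ‖rotMap i s x‖ = ‖x‖ := by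
  have h := Real.sin_sq_add_cos_sq s
  rw [EuclideanSpace.norm_eq, EuclideanSpace.norm_eq]
  congr 1
  simp only [Real.norm_eq_abs, sq_abs, Fin.sum_univ_three, rotMap_apply, PiLp.add_apply,
    PiLp.smul_apply, smul_eq_mul, rotGen_apply]
  fin_cases i <;> simp <;> grind

/-- The rotation by the angle `s` about the `i`-th axis, as an isometry. -/
def rot (i : Fin 3) (s : ℝ) : Space ≃ₗᵢ[ℝ] Space :=
  LinearIsometry.toLinearIsometryEquiv ⟨rotMap i s, norm_rotMap i s⟩ rfl

theorem rot_apply (i : Fin 3) (s : ℝ) (x : Space) :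
    rot i s x = x + Real.sin s • rotGen i x + (1 - Real.cos s) • rotGen i (rotGen i x) := rfl

theorem det_rot (i : Fin 3) (s : ℝ) :
    LinearMap.det ((rot i s).toLinearEquiv : Space →ₗ[ℝ] Space) = 1 := by
  have h := Real.sin_sq_add_cos_sq s
  have e : ((rot i s).toLinearEquiv : Space →ₗ[ℝ] Space) = rotMap i s := rfl
  rw [e, ← LinearMap.det_toMatrix (EuclideanSpace.basisFun (Fin 3) ℝ).toBasis, Matrix.det_fin_three]
  simp only [LinearMap.toMatrix_apply, OrthonormalBasis.coe_toBasis, EuclideanSpace.basisFun_apply,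
    OrthonormalBasis.coe_toBasis_repr_apply, EuclideanSpace.basisFun_repr, rotMap_apply,
    PiLp.add_apply, PiLp.smul_apply, smul_eq_mul, rotGen_apply]
  fin_cases i <;> simp <;> grind

theorem rot_zero (i : Fin 3) (x : Space) : rot i 0 x = x := by
  simp [rot_apply]

theorem hasDerivAt_rot (i : Fin 3) (s : ℝ) (x : Space) :
    HasDerivAt (fun t => rot i t x)
      (Real.cos s • rotGen i x + Real.sin s • rotGen i (rotGen i x)) s := by
  have h1 := (Real.hasDerivAt_sin s).smul_const (rotGen i x)
  have h2 := ((Real.hasDerivAt_cos s).const_sub 1).smul_const (rotGen i (rotGen i x))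
  exact ((h1.const_add x).fun_add h2).congr_deriv (by simp)

/-- A set that is invariant under rotations about the axes. -/
def RotInvariant (K : Set Space) : Prop := ∀ i s, ∀ x ∈ K, rot i s x ∈ K

theorem rot_symm_mem {K : Set Space} (hK : RotInvariant K) (i : Fin 3) (s : ℝ) {x : Space}
    (hx : rot i s x ∈ K) : x ∈ K := by
  have h := hK i (-s) _ hx
  have hs := Real.sin_sq_add_cos_sq s
  convert h
  ext m
  simp only [rot_apply, PiLp.add_apply, PiLp.smul_apply, smul_eq_mul, rotGen_apply, Real.sin_neg,
    Real.cos_neg]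
  fin_cases i <;> fin_cases m <;> simp <;> grind

theorem preimage_rot {K : Set Space} (hK : RotInvariant K) (i : Fin 3) (s : ℝ) :
    rot i s ⁻¹' K = K :=
  Set.ext fun _ => ⟨rot_symm_mem hK i s, hK i s _⟩

theorem setIntegral_comp_rot {K : Set Space} (hK : RotInvariant K) (i : Fin 3) (s : ℝ)
    (g : Space → ℝ) : ∫ x in K, g (rot i s x) = ∫ x in K, g x := by
  have h := (rot i s).measurePreserving.setIntegral_preimage_emb
    (rot i s).toHomeomorph.measurableEmbedding g K
  rwa [preimage_rot hK] at h

/-- Integration by parts along the rotations. -/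
theorem setIntegral_rotGen_eq_zero {D K : Set Space} (hD : IsOpen D) (hK : IsCompact K)
    (hKD : K ⊆ D) (hinv : RotInvariant K) {φ g : Space → ℝ} (hφ : ContinuousOn φ K) (i : Fin 3)
    (hφi : ∀ s, ∀ x ∈ K, φ (rot i s x) = φ x) (hg : ContDiffOn ℝ 1 g D) :
    ∫ x in K, φ x * fderiv ℝ g x (rotGen i x) = 0 := by
  have hdg : ∀ x ∈ K, DifferentiableAt ℝ g x := fun x hx =>
    (hg.differentiableOn (by simp)).differentiableAt (hD.mem_nhds (hKD hx))
  have hcf : ContinuousOn (fderiv ℝ g) K :=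
    (hg.continuousOn_fderiv_of_isOpen hD (by simp)).mono hKD
  have hcg : ContinuousOn g K := hg.continuousOn.mono hKD
  obtain ⟨C1, hC1⟩ := hK.exists_bound_of_continuousOn hφ
  obtain ⟨C2, hC2⟩ := hK.exists_bound_of_continuousOn hcf
  obtain ⟨C3, hC3⟩ := hK.exists_bound_of_continuousOn
    (f := fun x => rotGen i x) (by fun_prop)
  obtain ⟨C4, hC4⟩ := hK.exists_bound_of_continuousOn
    (f := fun x => rotGen i (rotGen i x)) (by fun_prop)
  -- Rotations preserve Lebesgue measure, K and φ, so this integral does not depend on s. Its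
  -- derivative at s = 0, taken under the integral sign, is the integral in question.
  have hconst : ∀ s, ∫ x in K, φ x * g (rot i s x) = ∫ x in K, φ x * g x := by
    intro s
    rw [← setIntegral_comp_rot hinv i s fun x => φ x * g x]
    exact setIntegral_congr_fun hK.measurableSet fun x hx => by simp only [hφi s x hx]
  have hrc : ∀ s, Continuous (rot i s) := fun s => (rot i s).continuous
  have hmap : ∀ s, Set.MapsTo (rot i s) K K := fun s x hx => hinv i s x hx
  have hm1 : ∀ s, ContinuousOn (fun x => φ x * g (rot i s x)) K := fun s =>
    hφ.mul (hcg.comp (hrc s).continuousOn (hmap s))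
  have hder := hasDerivAt_integral_of_dominated_loc_of_deriv_le (μ := volume.restrict K)
    (F := fun s x => φ x * g (rot i s x)) (x₀ := (0 : ℝ)) (s := Set.univ)
    (bound := fun _ => C1 * (C2 * (C3 + C4)))
    (F' := fun s x => φ x * fderiv ℝ g (rot i s x)
      (Real.cos s • rotGen i x + Real.sin s • rotGen i (rotGen i x)))
    Filter.univ_mem
    (Filter.Eventually.of_forall fun s => (hm1 s).aestronglyMeasurable hK.measurableSet)
    ((hm1 0).integrableOn_compact hK)
    (by
      apply ContinuousOn.aestronglyMeasurable _ hK.measurableSet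
      refine hφ.mul (ContinuousOn.clm_apply (hcf.comp (hrc 0).continuousOn (hmap 0)) ?_)
      fun_prop)
    (by
      filter_upwards [ae_restrict_mem hK.measurableSet] with x hx s _
      have h1 := hC1 x hx
      have h2 := hC2 _ (hinv i s x hx)
      have h3 : ‖Real.cos s • rotGen i x + Real.sin s • rotGen i (rotGen i x)‖ ≤ C3 + C4 := by
        refine (norm_add_le _ _).trans (add_le_add ?_ ?_)
        · rw [norm_smul]
          exact (mul_le_of_le_one_left (norm_nonneg _) (Real.abs_cos_le_one s)).trans (hC3 x hx)
        · rw [norm_smul]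
          exact (mul_le_of_le_one_left (norm_nonneg _) (Real.abs_sin_le_one s)).trans (hC4 x hx)
      rw [norm_mul]
      refine mul_le_mul h1 ?_ (norm_nonneg _) ((norm_nonneg _).trans h1)
      refine (ContinuousLinearMap.le_opNorm _ _).trans ?_
      exact mul_le_mul h2 h3 (norm_nonneg _) ((norm_nonneg _).trans h2))
    ((continuousOn_const (s := K)).integrableOn_compact hK)
    (by
      filter_upwards [ae_restrict_mem hK.measurableSet] with x hx s _
      exact (((hdg _ (hinv i s x hx)).hasFDerivAt).comp_hasDerivAt s
        (hasDerivAt_rot i s x)).const_mul (φ x))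
  have h := hder.2
  simp only [hconst] at h
  have h0 := h.unique (hasDerivAt_const 0 _)
  simpa [rot_zero] using h0

end

/-! ### The Poincaré inequality for tangential fields -/

section

/-- The derivative along the rotation about the `i`-th axis. -/
def rotDer (i : Fin 3) (g : Space → ℝ) (x : Space) : ℝ := fderiv ℝ g x (rotGen i x)

theorem fderiv_rotGen (i : Fin 3) (g : Space → ℝ) (x : Space) :
    fderiv ℝ g x (rotGen i x) = rotDer i g x := rfl

theorem rotDer_eq (i : Fin 3) (g : Space → ℝ) (x : Space) :
    rotDer i g x = x (i + 1) * spd (i + 2) g x - x (i + 2) * spd (i + 1) g x := by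
  have e : rotGen i x = x (i + 1) • EuclideanSpace.single (i + 2) (1 : ℝ)
      - x (i + 2) • EuclideanSpace.single (i + 1) (1 : ℝ) := by
    ext m
    simp only [rotGen_apply, PiLp.sub_apply, PiLp.smul_apply, PiLp.single_apply,
      smul_eq_mul]
    fin_cases i <;> fin_cases m <;> simp
  rw [rotDer, e, map_sub, map_smul, map_smul]
  rfl

/-- The Euclidean divergence. -/
def flatDiv (X : Fin 3 → Space → ℝ) (x : Space) : ℝ := ∑ i, spd i (X i) x

/-- The scalar product of the position vector with the Euclidean curl. -/
def positionCurl (X : Fin 3 → Space → ℝ) (x : Space) : ℝ := ∑ i, rotDer i (X i) x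

/-- The pointwise inequality behind the Poincaré inequality for tangential fields: the difference
of the two sides is the square of the conformal Killing operator. -/
theorem two_mul_minors_le {x X : Fin 3 → ℝ} {J : Fin 3 → Fin 3 → ℝ} {L : Fin 3 → Fin 3 → ℝ}
    (hL : ∀ i j, L i j = x (i + 1) * J (i + 2) j - x (i + 2) * J (i + 1) j)
    (hx : 0 < ∑ i, x i ^ 2)
    (hX : ∑ i, x i * X i = 0) (hJ : ∀ b, ∑ j, x j * J b j = -X b) :
    2 * ((∑ i, L i i) ^ 2 - ∑ i, ∑ j, L i j * L j i)
      ≤ (∑ i, x i ^ 2) * (∑ i, J i i) ^ 2 + (∑ i, L i i) ^ 2 := by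
  have hk : ∑ b, x b * ∑ j, x j * J b j = 0 := by
    simp only [hJ, mul_neg, Finset.sum_neg_distrib, hX, neg_zero]
  set ρ := ∑ i, x i ^ 2 with hρ
  have key : 2 * ρ ^ 2 * ((ρ * (∑ i, J i i) ^ 2 + (∑ i, L i i) ^ 2)
      - 2 * ((∑ i, L i i) ^ 2 - ∑ i, ∑ j, L i j * L j i))
      = ∑ i, ∑ j, (ρ * (L i j + L j i) - (∑ k, L i k * x k) * x j - (∑ k, L j k * x k) * x i
        - (∑ k, L k k) * ((if i = j then ρ else 0) - x i * x j)) ^ 2 := by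
    -- Subtracting the doubly radial component of J, which is zero, turns `key` into a polynomial
    -- identity in x and J free of side conditions.
    have e : ρ * (∑ i, J i i) ^ 2 * ρ ^ 2
        = ρ * (ρ * (∑ i, J i i) - ∑ b, x b * ∑ j, x j * J b j) ^ 2 := by
      rw [hk]; ring
    have e2 : 2 * ρ ^ 2 * ((ρ * (∑ i, J i i) ^ 2 + (∑ i, L i i) ^ 2)
      - 2 * ((∑ i, L i i) ^ 2 - ∑ i, ∑ j, L i j * L j i))
      = 2 * (ρ * (∑ i, J i i) ^ 2 * ρ ^ 2) + 2 * ρ ^ 2 * ((∑ i, L i i) ^ 2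
      - 2 * ((∑ i, L i i) ^ 2 - ∑ i, ∑ j, L i j * L j i)) := by ring
    rw [e2, e]
    simp only [Fin.sum_univ_three, hL, hρ]
    simp
    ring
  have h0 : 0 ≤ 2 * ρ ^ 2 * ((ρ * (∑ i, J i i) ^ 2 + (∑ i, L i i) ^ 2)
      - 2 * ((∑ i, L i i) ^ 2 - ∑ i, ∑ j, L i j * L j i)) := by
    rw [key]
    exact Finset.sum_nonneg fun _ _ => Finset.sum_nonneg fun _ _ => sq_nonneg _
  have h1 : 0 < 2 * ρ ^ 2 := by positivity
  linarith [nonneg_of_mul_nonneg_right h0 h1]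

variable {D : Set Space}

theorem contDiffOn_rotDer (hD : IsOpen D) {g : Space → ℝ} {n : WithTop ℕ∞}
    (hg : ContDiffOn ℝ (n + 1) g D) (i : Fin 3) : ContDiffOn ℝ n (rotDer i g) D := by
  unfold rotDer
  exact (hg.fderiv_of_isOpen hD le_rfl).clm_apply (by fun_prop)

/-- The second derivative of g is symmetric, so the commutator retains only the derivatives of the
generating fields. -/
theorem rotDer_comm (hD : IsOpen D) {g : Space → ℝ} (hg : ContDiffOn ℝ 2 g D) {x : Space}
    (hx : x ∈ D) (i j : Fin 3) : rotDer i (rotDer j g) x - rotDer j (rotDer i g) x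
      = fderiv ℝ g x (rotGen j (rotGen i x) - rotGen i (rotGen j x)) := by
  have hgx : ContDiffAt ℝ 2 g x := hg.contDiffAt (hD.mem_nhds hx)
  have hd : DifferentiableAt ℝ (fderiv ℝ g) x :=
    (hgx.fderiv_right (m := 1) (by norm_num)).differentiableAt (by simp)
  have e : ∀ k, HasFDerivAt (rotDer k g) _ x := fun k =>
    hd.hasFDerivAt.clm_apply (rotGen k).hasFDerivAt
  have hs : IsSymmSndFDerivAt ℝ g x := hgx.isSymmSndFDerivAt (by simp)
  rw [rotDer, rotDer, (e j).fderiv, (e i).fderiv]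
  simp only [add_apply, ContinuousLinearMap.comp_apply,
    ContinuousLinearMap.flip_apply, map_sub]
  rw [hs.eq (rotGen i x) (rotGen j x)]
  ring

/-- These are the relations of so(3); through them the curvature of the spheres enters the Bochner
identity. -/
theorem rotDer_comm_succ (hD : IsOpen D) {g : Space → ℝ} (hg : ContDiffOn ℝ 2 g D) {x : Space}
    (hx : x ∈ D) (i : Fin 3) :
    rotDer i (rotDer (i + 1) g) x = rotDer (i + 1) (rotDer i g) x - rotDer (i + 2) g x := by
  have h := rotDer_comm hD hg hx i (i + 1)
  have e : rotGen (i + 1) (rotGen i x) - rotGen i (rotGen (i + 1) x) = -rotGen (i + 2) x := by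
    ext m
    simp only [rotGen_apply, PiLp.sub_apply, PiLp.neg_apply]
    fin_cases i <;> fin_cases m <;> simp
  rw [e, map_neg] at h
  rw [fderiv_rotGen] at h
  linarith

/-- Differentiate the tangency condition x · X = 0 in the direction b. -/
theorem sum_mul_spd (hD : IsOpen D) {X : Fin 3 → Space → ℝ}
    (hX : ∀ j, DifferentiableOn ℝ (X j) D) (ht : ∀ x ∈ D, ∑ j, x j * X j x = 0) {x : Space}
    (hx : x ∈ D) (b : Fin 3) : ∑ j, x j * spd b (X j) x = -X b x := by
  have hdX : ∀ j, DifferentiableAt ℝ (X j) x := fun j =>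
    (hX j).differentiableAt (hD.mem_nhds hx)
  have h : HasFDerivAt (fun y : Space => ∑ j, y j * X j y) _ x :=
    HasFDerivAt.fun_sum (u := Finset.univ) fun j _ =>
      (EuclideanSpace.proj (𝕜 := ℝ) (ι := Fin 3) j).hasFDerivAt.fun_mul (hdX j).hasFDerivAt
  have h0 : fderiv ℝ (fun y : Space => ∑ j, y j * X j y) x = 0 := by
    rw [Filter.EventuallyEq.fderiv_eq (f := fun _ => (0 : ℝ))]
    · simp
    · filter_upwards [hD.mem_nhds hx] with y hy using ht y hy
  rw [h.fderiv] at h0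
  have h1 := congrArg (fun l => l (EuclideanSpace.single b (1 : ℝ))) h0
  simp only [sum_apply, add_apply, smul_apply, smul_eq_mul, PiLp.proj_apply,
    PiLp.single_apply, zero_apply, Finset.sum_add_distrib, mul_ite, mul_one,
    mul_zero, Finset.sum_ite_eq', Finset.mem_univ, if_true] at h1
  simp only [spd]
  linarith

/-- The field whose rotational divergence appears in the Bochner identity. -/
def bochnerField (X : Fin 3 → Space → ℝ) (i : Fin 3) (x : Space) : ℝ :=
  ∑ j, (X j x * rotDer j (X i) x - X i x * rotDer j (X j) x)

/-- The second derivatives pair up into commutators, so only first rotational derivatives remain.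
For tangential X the commutator terms sum to |X|². -/
theorem rotDer_bochnerField (hD : IsOpen D) {X : Fin 3 → Space → ℝ}
    (hX : ∀ j, ContDiffOn ℝ 2 (X j) D) (ht : ∀ x ∈ D, ∑ j, x j * X j x = 0) {x : Space}
    (hx : x ∈ D) : ∑ i, rotDer i (bochnerField X i) x
      = ∑ i, ∑ j, rotDer i (X j) x * rotDer j (X i) x - positionCurl X x ^ 2
        + ∑ j, X j x ^ 2 := by
  have hdX : ∀ j, DifferentiableAt ℝ (X j) x := fun j =>
    ((hX j).differentiableOn (by simp)).differentiableAt (hD.mem_nhds hx)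
  have hdR : ∀ i j, DifferentiableAt ℝ (rotDer i (X j)) x := fun i j =>
    ((contDiffOn_rotDer hD (n := 1) (one_add_one_eq_two (R := WithTop ℕ∞) ▸ hX j) i).differentiableOn
      (by simp)).differentiableAt (hD.mem_nhds hx)
  have e : ∀ i, rotDer i (bochnerField X i) x = ∑ j,
      (rotDer i (X j) x * rotDer j (X i) x + X j x * rotDer i (rotDer j (X i)) x
        - rotDer i (X i) x * rotDer j (X j) x - X i x * rotDer i (rotDer j (X j)) x) := by
    intro i
    have h : HasFDerivAt (bochnerField X i) _ x :=
      HasFDerivAt.fun_sum (u := Finset.univ) fun j _ =>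
        ((hdX j).hasFDerivAt.fun_mul (hdR j i).hasFDerivAt).fun_sub
          ((hdX i).hasFDerivAt.fun_mul (hdR j j).hasFDerivAt)
    rw [rotDer, h.fderiv]
    simp only [sum_apply, sub_apply,
      add_apply, smul_apply, smul_eq_mul]
    refine Finset.sum_congr rfl fun j _ => ?_
    simp only [fderiv_rotGen]
    ring
  have hc := fun i j => rotDer_comm_succ hD (hX j) hx i
  have hJ := sum_mul_spd hD (fun j => (hX j).differentiableOn (by simp)) ht hx
  have hdiv : X 0 x * (∑ j, x j * spd 0 (X j) x) + X 1 x * (∑ j, x j * spd 1 (X j) x)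
     + X 2 x * (∑ j, x j * spd 2 (X j) x) = -∑ j, X j x ^ 2 := by
    rw [hJ, hJ, hJ, Fin.sum_univ_three]
    ring
  have h0 := ht x hx
  have c0 := fun j => hc 0 j
  have c1 := fun j => hc 1 j
  have c2 := fun j => hc 2 j
  simp only [Fin.isValue, zero_add, show (1 : Fin 3) + 1 = 2 from rfl,
    show (1 : Fin 3) + 2 = 0 from rfl, show (2 : Fin 3) + 1 = 0 from rfl,
    show (2 : Fin 3) + 2 = 1 from rfl] at c0 c1 c2
  simp only [e, positionCurl, Fin.sum_univ_three] at *
  have r0 := fun j => rotDer_eq 0 (X j) x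
  have r1 := fun j => rotDer_eq 1 (X j) x
  have r2 := fun j => rotDer_eq 2 (X j) x
  simp only [Fin.isValue, zero_add, show (1 : Fin 3) + 1 = 2 from rfl,
    show (1 : Fin 3) + 2 = 0 from rfl, show (2 : Fin 3) + 1 = 0 from rfl,
    show (2 : Fin 3) + 2 = 1 from rfl] at r0 r1 r2
  -- The sum of the commutator terms. Written with partial derivatives it is -∑ X_b x_j ∂_b X_j plus
  -- div X times x · X, and tangency evaluates both.
  have hA : X 0 x * (rotDer 2 (X 1) x) - X 1 x * rotDer 2 (X 0) x
      + X 1 x * rotDer 0 (X 2) x - X 2 x * rotDer 0 (X 1) x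
      + X 2 x * rotDer 1 (X 0) x - X 0 x * rotDer 1 (X 2) x = X 0 x ^ 2 + X 1 x ^ 2 + X 2 x ^ 2 := by
    rw [r0, r0, r1, r1, r2, r2]
    linear_combination -hdiv
      + (spd 0 (X 0) x + spd 1 (X 1) x + spd 2 (X 2) x) * h0
  linear_combination X 1 x * c0 0 - X 0 x * c0 1 + X 2 x * c1 1 - X 1 x * c1 2 + X 0 x * c2 2
    - X 2 x * c2 0 + hA

/-- The Poincaré inequality for tangential vector fields on the spheres. -/
theorem poincare_inequality {K : Set Space} (hD : IsOpen D) (hD0 : (0 : Space) ∉ D)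
    (hK : IsCompact K) (hKD : K ⊆ D) (hinv : RotInvariant K) {φ : Space → ℝ}
    (hφ : ContinuousOn φ K) (hφ0 : ∀ x ∈ K, 0 ≤ φ x) (hφi : ∀ i s, ∀ x ∈ K, φ (rot i s x) = φ x)
    {X : Fin 3 → Space → ℝ} (hX : ∀ j, ContDiffOn ℝ 2 (X j) D)
    (ht : ∀ x ∈ D, ∑ j, x j * X j x = 0) :
    0 ≤ ∫ x in K, φ x * (‖x‖ ^ 2 * flatDiv X x ^ 2 + positionCurl X x ^ 2
      - 2 * ∑ j, X j x ^ 2) := by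
  have hcX : ∀ j, ContinuousOn (X j) K := fun j => (hX j).continuousOn.mono hKD
  have hR : ∀ i j, ContDiffOn ℝ 1 (rotDer i (X j)) D := fun i j =>
    contDiffOn_rotDer hD (one_add_one_eq_two (R := WithTop ℕ∞) ▸ hX j) i
  have hcR : ∀ i j, ContinuousOn (rotDer i (X j)) K := fun i j => (hR i j).continuousOn.mono hKD
  have hcS : ∀ i j, ContinuousOn (spd i (X j)) K := fun i j => by
    unfold spd
    exact (((hX j).continuousOn_fderiv_of_isOpen hD (by simp)).mono hKD).clm_apply
      continuousOn_const
  have hB : ∀ i, ContDiffOn ℝ 1 (bochnerField X i) D := fun i =>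
    ContDiffOn.sum fun j _ => (((hX j).of_le (by simp)).mul (hR j i)).sub
      (((hX i).of_le (by simp)).mul (hR j j))
  have hcB : ∀ i, ContinuousOn (rotDer i (bochnerField X i)) K := fun i => by
    unfold rotDer
    exact (((hB i).continuousOn_fderiv_of_isOpen hD (by simp)).mono hKD).clm_apply
      (by fun_prop)
  have h1 : ∫ x in K, φ x * ∑ i, rotDer i (bochnerField X i) x = 0 := by
    simp only [Finset.mul_sum]
    rw [integral_finsetSum _ fun i _ => (hφ.fun_mul (hcB i)).integrableOn_compact hK]
    exact Finset.sum_eq_zero fun i _ =>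
      setIntegral_rotGen_eq_zero hD hK hKD hinv hφ i (hφi i) (hB i)
  have h2 : IntegrableOn (fun x => φ x * ∑ i, rotDer i (bochnerField X i) x) K :=
    (hφ.mul (continuousOn_finsetSum _ fun i _ => hcB i)).integrableOn_compact hK
  have h3 : IntegrableOn (fun x => φ x * (‖x‖ ^ 2 * flatDiv X x ^ 2 + positionCurl X x ^ 2
      - 2 * ∑ j, X j x ^ 2)) K := by
    refine ContinuousOn.integrableOn_compact hK ?_
    unfold flatDiv positionCurl
    fun_prop
  -- Adding twice the rotational divergence, whose integral is zero, removes |X|² and leaves exactly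
  -- the pointwise nonnegative difference in `two_mul_minors_le`.
  have h4 : ∫ x in K, φ x * (‖x‖ ^ 2 * flatDiv X x ^ 2 + positionCurl X x ^ 2
      - 2 * ∑ j, X j x ^ 2) = ∫ x in K, (φ x * (‖x‖ ^ 2 * flatDiv X x ^ 2 + positionCurl X x ^ 2
      - 2 * ∑ j, X j x ^ 2) + 2 * (φ x * ∑ i, rotDer i (bochnerField X i) x)) := by
    rw [integral_add h3 (h2.const_mul 2), integral_const_mul, h1]
    ring
  rw [h4]
  refine setIntegral_nonneg hK.measurableSet fun x hx => ?_
  rw [rotDer_bochnerField hD hX ht (hKD hx)]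
  have hx0 : x ≠ 0 := fun h => hD0 (h ▸ hKD hx)
  have hn : ‖x‖ ^ 2 = ∑ i, x i ^ 2 := by simp [EuclideanSpace.norm_sq_eq]
  have hpos : 0 < ∑ i, x i ^ 2 := by
    rw [← hn]
    have := norm_pos_iff.mpr hx0
    positivity
  have key := two_mul_minors_le (x := fun i => x i) (X := fun j => X j x)
    (J := fun b j => spd b (X j) x)
    (L := fun i j => rotDer i (X j) x) (fun i j => rotDer_eq i (X j) x) hpos
    (ht x (hKD hx)) (sum_mul_spd hD (fun j => (hX j).differentiableOn (by simp)) ht (hKD hx))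
  rw [hn, flatDiv]
  rw [positionCurl]
  nlinarith [mul_nonneg (hφ0 x hx) (sub_nonneg.mpr key)]

end

/-! ### Geometry of spherically symmetric slices -/

section

@[simp] theorem point_zero (t : ℝ) (x : Space) : point t x 0 = t := rfl

@[simp] theorem point_succ (t : ℝ) (x : Space) (i : Fin 3) : point t x i.succ = x i := by
  fin_cases i <;> rfl

theorem point_injective {t t' : ℝ} {x x' : Space} (h : point t x = point t' x') :
    t = t' ∧ x = x' := by
  refine ⟨by simpa using congrFun h 0, ?_⟩
  ext i
  simpa using congrFun h i.succ

theorem radius_point (t : ℝ) (x : Space) : radius (point t x) = ‖x‖ := by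
  rw [EuclideanSpace.norm_eq, radius]
  simp [Fin.sum_univ_three, point]

theorem dr_point (t : ℝ) (x : Space) (i : Fin 3) : dr (point t x) i.succ = x i / ‖x‖ := by
  rw [dr_spatial, radius_point, point_succ]

theorem sum_dr_point_mul (t : ℝ) (x : Space) (v : Fin 4 → ℝ) :
    ∑ b, dr (point t x) b * v b = (∑ i : Fin 3, x i * v i.succ) / ‖x‖ := by
  rw [Fin.sum_univ_succ, dr_zero, zero_mul, zero_add, Finset.sum_div]
  exact Finset.sum_congr rfl fun i _ => by rw [dr_point]; ring

namespace SpacelikeSlice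

variable {M : ℝ} (S : SpacelikeSlice M)

/-- The embedding of the slice in spacetime. -/
def graph (x : Space) : Point := point (S.height x) x

/-- The radial derivative of the time function. -/
def slope (x : Space) : ℝ := fderiv ℝ S.height x x / ‖x‖

variable {S} {x : Space}

theorem graph_mem (hx : x ∈ S.dom) : S.graph x ∈ exterior M := by
  have := S.dom_subset x hx
  rwa [exterior, Set.mem_ofPred_eq, graph, radius_point]

theorem norm_pos (hM : 0 < M) (hx : x ∈ S.dom) : 0 < ‖x‖ := by
  linarith [S.dom_subset x hx]

theorem differentiableAt_height (hx : x ∈ S.dom) : DifferentiableAt ℝ S.height x :=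
  (S.smooth.differentiableOn (by simp)).differentiableAt (S.isOpen_dom.mem_nhds hx)

theorem rot_mem_and_height (hS : S.IsSphericallySymmetric) (i : Fin 3) (s : ℝ) (hx : x ∈ S.dom) :
    rot i s x ∈ S.dom ∧ S.height (rot i s x) = S.height x := by
  obtain ⟨y, hy, h⟩ := hS (rot i s) (det_rot i s) (S.height x) x ⟨x, hx, rfl⟩
  obtain ⟨h1, h2⟩ := point_injective h
  exact ⟨h2 ▸ hy, by rw [h1, h2]⟩

theorem rotInvariant_dom (hS : S.IsSphericallySymmetric) : RotInvariant S.dom :=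
  fun i s _ hx => (rot_mem_and_height hS i s hx).1

theorem rotDer_height (hS : S.IsSphericallySymmetric) (hx : x ∈ S.dom) (i : Fin 3) :
    rotDer i S.height x = 0 := by
  have h1 : HasDerivAt (fun s => S.height (rot i s x)) _ 0 :=
    HasFDerivAt.comp_hasDerivAt 0 (f := fun s => rot i s x) (by
      rw [rot_zero]
      exact (differentiableAt_height hx).hasFDerivAt) (hasDerivAt_rot i 0 x)
  simp only [(rot_mem_and_height hS i _ hx).2] at h1
  simpa [fderiv_rotGen] using h1.unique (hasDerivAt_const 0 _)

/-- All rotational derivatives of the height vanish, so x × ∇h = 0 and the gradient is radial. -/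
theorem spd_height (hM : 0 < M) (hS : S.IsSphericallySymmetric) (hx : x ∈ S.dom) (i : Fin 3) :
    spd i S.height x = S.slope x * (x i / ‖x‖) := by
  have h : ∀ j, _ := fun j => rotDer_height hS hx j
  simp only [rotDer_eq] at h
  have h0 := h 0
  have h1 := h 1
  have h2 := h 2
  have hn := norm_pos hM hx
  have hn2 : ‖x‖ ^ 2 = ∑ i, x i ^ 2 := by simp [EuclideanSpace.norm_sq_eq]
  have e : fderiv ℝ S.height x x = ∑ j, x j * spd j S.height x := by
    conv_lhs => arg 2; rw [show x = ∑ j, x j • EuclideanSpace.single j (1 : ℝ) by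
      ext m; simp [Fin.sum_univ_three]; fin_cases m <;> simp]
    simp only [map_sum, map_smul, smul_eq_mul]
    rfl
  rw [slope, e]
  have : spd i S.height x * ‖x‖ ^ 2 = (∑ j, x j * spd j S.height x) * x i := by
    rw [hn2]
    simp only [Fin.sum_univ_three]
    simp at h0 h1 h2
    fin_cases i <;> simp
    · linear_combination x 2 * h1 - x 1 * h2
    · linear_combination x 0 * h2 - x 2 * h0
    · linear_combination x 1 * h0 - x 0 * h1
  field_simp
  linarith

theorem conormal_eq (hM : 0 < M) (hS : S.IsSphericallySymmetric) (hx : x ∈ S.dom) (b : Fin 4) :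
    S.conormal x b = dt b - S.slope x * dr (S.graph x) b := by
  refine Fin.cases ?_ (fun i => ?_) b
  · simp [conormal, dt]
  · rw [graph, dr_point, ← spd_height hM hS hx]
    fin_cases i <;> simp [conormal, dt]

theorem sum_invMetric_conormal (hM : 0 < M) (hS : S.IsSphericallySymmetric) (hx : x ∈ S.dom)
    (a : Fin 4) : ∑ b, invMetric M (S.graph x) a b * S.conormal x b
      = (lapse M (S.graph x))⁻¹ * dt a + lapse M (S.graph x) * S.slope x * dr (S.graph x) a := by
  have hp := graph_mem hx
  have e : ∀ b, invMetric M (S.graph x) a b * S.conormal x b = invMetric M (S.graph x) a b * dt b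
      - S.slope x * (invMetric M (S.graph x) a b * dr (S.graph x) b) := by
    intro b
    rw [conormal_eq hM hS hx]
    ring
  simp only [e, Finset.sum_sub_distrib, ← Finset.mul_sum, sum_invMetric_dt hM hp,
    sum_invMetric_dr hM hp]
  ring

theorem conormal_sq (hM : 0 < M) (hS : S.IsSphericallySymmetric) (hx : x ∈ S.dom) :
    ∑ b, ∑ c, invMetric M (S.graph x) b c * S.conormal x b * S.conormal x c
      = (lapse M (S.graph x))⁻¹ - lapse M (S.graph x) * S.slope x ^ 2 := by
  have hr := radius_pos hM (graph_mem hx)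
  have e : ∀ b, ∑ c, invMetric M (S.graph x) b c * S.conormal x b * S.conormal x c
      = (lapse M (S.graph x))⁻¹ * (dt b * dt b)
        + (lapse M (S.graph x) * S.slope x - S.slope x * (lapse M (S.graph x))⁻¹)
          * (dt b * dr (S.graph x) b)
        - lapse M (S.graph x) * S.slope x ^ 2 * (dr (S.graph x) b * dr (S.graph x) b) := by
    intro b
    have e : ∀ c, invMetric M (S.graph x) b c * S.conormal x b * S.conormal x c
        = S.conormal x b * (invMetric M (S.graph x) b c * S.conormal x c) := fun c => by ring
    simp only [e, ← Finset.mul_sum, sum_invMetric_conormal hM hS hx]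
    rw [conormal_eq hM hS hx]
    ring
  simp only [e, Finset.sum_add_distrib, Finset.sum_sub_distrib, ← Finset.mul_sum, sum_dt_mul,
    sum_dr_mul_dr hr, dr_zero, show dt 0 = 1 from rfl]
  ring

theorem neg_inducedMetric (hM : 0 < M) (hS : S.IsSphericallySymmetric) (hx : x ∈ S.dom)
    (i j : Fin 3) : (-inducedMetric M S.height x) i j = (if i = j then 1 else 0)
      - (1 - (lapse M (S.graph x))⁻¹ + lapse M (S.graph x) * S.slope x ^ 2)
        * (dr (S.graph x) i.succ * dr (S.graph x) j.succ) := by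
  have e : ∀ i : Fin 3, spd i S.height x = S.slope x * dr (S.graph x) i.succ := fun i => by
    rw [graph, dr_point, spd_height hM hS hx]
  have ht : ∀ i j : Fin 3, graphTangent S.height x i j.succ = if i = j then 1 else 0 := by
    intro i j
    rw [graphTangent, point_succ, PiLp.single_apply]
    simp [eq_comm]
  have ht0 : ∀ i : Fin 3, graphTangent S.height x i 0 = S.slope x * dr (S.graph x) i.succ := by
    intro i
    rw [graphTangent, point_zero, e]
  rw [Matrix.neg_apply, inducedMetric]
  change -(∑ a, ∑ b, metric M (S.graph x) a b * _ * _) = _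
  rw [Fin.sum_univ_succ]
  simp only [Fin.sum_univ_succ (n := 3), ht, ht0, mul_ite, mul_one, mul_zero,
    Finset.sum_ite_eq, Finset.mem_univ, if_true, metric_eq, dr_zero]
  simp [dt, spatialDelta, Fin.succ_ne_zero, Finset.sum_ite_eq]
  split_ifs <;> ring

theorem det_neg_inducedMetric (hM : 0 < M) (hS : S.IsSphericallySymmetric) (hx : x ∈ S.dom) :
    (-inducedMetric M S.height x).det
      = (lapse M (S.graph x))⁻¹ - lapse M (S.graph x) * S.slope x ^ 2 := by
  have h := sum_dr_sq (radius_pos hM (graph_mem hx))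
  rw [Matrix.det_fin_three]
  simp only [neg_inducedMetric hM hS hx]
  simp
  linear_combination -(1 - (lapse M (S.graph x))⁻¹ + lapse M (S.graph x) * S.slope x ^ 2) * h

theorem conormal_sq_pos (hM : 0 < M) (hS : S.IsSphericallySymmetric) (hx : x ∈ S.dom) :
    0 < (lapse M (S.graph x))⁻¹ - lapse M (S.graph x) * S.slope x ^ 2 := by
  rw [← det_neg_inducedMetric hM hS hx]
  exact (S.spacelike x hx).det_pos

/-- The velocity of the slice relative to the static observers. -/
def velocity (S : SpacelikeSlice M) (x : Space) : ℝ := lapse M (S.graph x) * S.slope x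

/-- The determinant of the negative induced metric is f⁻¹(1 - v²), and it is positive because the
slice is spacelike. -/
theorem abs_velocity_lt (hM : 0 < M) (hS : S.IsSphericallySymmetric) (hx : x ∈ S.dom) :
    |S.velocity x| < 1 := by
  have h := conormal_sq_pos hM hS hx
  have hf := lapse_pos hM (graph_mem hx)
  have : S.velocity x ^ 2 < 1 := by
    have e : 1 - S.velocity x ^ 2 = lapse M (S.graph x) * ((lapse M (S.graph x))⁻¹
        - lapse M (S.graph x) * S.slope x ^ 2) := by
      rw [velocity]
      field_simp
    have := mul_pos hf h
    linarith
  rwa [← sq_lt_one_iff_abs_lt_one]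

/-- The conormal norm and the volume density are square roots of the same quantity, so they cancel.
The remaining vector f⁻¹∂_t + v ∂_r is split along ℓ₊ and ℓ₋, with positive coefficients since |v| <
1. -/
theorem fluxDensity_eq (hM : 0 < M) (hS : S.IsSphericallySymmetric) (hx : x ∈ S.dom)
    (J : Point → Fin 4 → ℝ) : S.fluxDensity J x = (2 * lapse M (S.graph x))⁻¹
      * ((1 + S.velocity x) * nullComp M 1 (S.graph x) (J (S.graph x))
        + (1 - S.velocity x) * nullComp M (-1) (S.graph x) (J (S.graph x))) := by
  have hf := (lapse_pos hM (graph_mem hx)).ne'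
  have hpos := conormal_sq_pos hM hS hx
  have e : ∀ a, J (S.graph x) a * S.normal x a * S.volDensity x
      = (lapse M (S.graph x))⁻¹ * (dt a * J (S.graph x) a)
        + S.velocity x * (dr (S.graph x) a * J (S.graph x) a) := by
    intro a
    have e1 : S.normal x a = (∑ b, invMetric M (S.graph x) a b * S.conormal x b) /
      Real.sqrt (∑ b, ∑ c, invMetric M (S.graph x) b c * S.conormal x b * S.conormal x c) := rfl
    rw [e1, volDensity, det_neg_inducedMetric hM hS hx, conormal_sq hM hS hx,
      sum_invMetric_conormal hM hS hx, mul_assoc, div_mul_cancel₀ _ (Real.sqrt_pos.mpr hpos).ne',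
      velocity]
    ring
  have e2 : S.fluxDensity J x = ∑ a, J (S.graph x) a * S.normal x a * S.volDensity x := by
    rw [fluxDensity, Finset.sum_mul]
    rfl
  rw [e2]
  simp only [e, Finset.sum_add_distrib, ← Finset.mul_sum, sum_dt_mul, nullComp]
  field_simp
  ring

theorem rot_velocity (hS : S.IsSphericallySymmetric) (hx : x ∈ S.dom) (i : Fin 3) (s : ℝ) :
    S.velocity (rot i s x) = S.velocity x := by
  have hy := (rot_mem_and_height hS i s hx).1
  have e : fderiv ℝ S.height (rot i s x) (rot i s x) = fderiv ℝ S.height x x := by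
    have h1 : HasFDerivAt (fun y => S.height (rot i s y)) _ x :=
      HasFDerivAt.comp x (f := fun y => rot i s y) (differentiableAt_height hy).hasFDerivAt
        (rot i s).toContinuousLinearEquiv.hasFDerivAt
    have h2 : fderiv ℝ (fun y => S.height (rot i s y)) x = fderiv ℝ S.height x := by
      apply Filter.EventuallyEq.fderiv_eq
      filter_upwards [S.isOpen_dom.mem_nhds hx] with y hy
      exact (rot_mem_and_height hS i s hy).2
    rw [← h2, h1.fderiv]
    rfl
  simp only [velocity, slope, lapse, graph, radius_point, e, LinearIsometryEquiv.norm_map]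

end SpacelikeSlice

end

/-! ### Invariant compact exhaustions and comparison of integrals -/

section

/-- An exhaustion of an open set by compact sets that respects its symmetries. -/
def exhaustion (D : Set Space) (n : ℕ) : Set Space :=
  {x | 1 / ((n : ℝ) + 1) ≤ Metric.infDist x Dᶜ} ∩ Metric.closedBall 0 n

variable {D : Set Space}

theorem isCompact_exhaustion (n : ℕ) : IsCompact (exhaustion D n) :=
  (isCompact_closedBall 0 (n : ℝ)).inter_left
    (isClosed_le continuous_const (Metric.continuous_infDist_pt _))

theorem exhaustion_subset (n : ℕ) : exhaustion D n ⊆ D := by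
  intro x hx
  by_contra h
  have h1 : 1 / ((n : ℝ) + 1) ≤ Metric.infDist x Dᶜ := hx.1
  rw [Metric.infDist_zero_of_mem (by exact h)] at h1
  have : 0 < 1 / ((n : ℝ) + 1) := by positivity
  linarith

theorem eventually_mem_exhaustion (hD : IsOpen D) (hne : Dᶜ.Nonempty) {x : Space} (hx : x ∈ D) :
    ∀ᶠ n in Filter.atTop, x ∈ exhaustion D n := by
  have hpos : 0 < Metric.infDist x Dᶜ :=
    (hD.isClosed_compl.notMem_iff_infDist_pos hne).mp (by simpa using hx)
  have h1 : ∀ᶠ n : ℕ in Filter.atTop, 1 / ((n : ℝ) + 1) < Metric.infDist x Dᶜ :=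
    tendsto_one_div_add_atTop_nhds_zero_nat.eventually (gt_mem_nhds hpos)
  have h2 : ∀ᶠ n : ℕ in Filter.atTop, ‖x‖ ≤ (n : ℝ) :=
    tendsto_natCast_atTop_atTop.eventually_ge_atTop _
  filter_upwards [h1, h2] with n h1 h2
  exact ⟨h1.le, by simpa using h2⟩

/-- A rotation is an isometry fixing the origin and preserving Dᶜ, so it preserves both distances
that define the exhaustion. -/
theorem rotInvariant_exhaustion (h : RotInvariant D) (n : ℕ) : RotInvariant (exhaustion D n) := by
  intro i s x hx
  have e : rot i s '' Dᶜ = Dᶜ := by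
    conv_lhs => rw [← preimage_rot h i s, ← Set.preimage_compl]
    exact Set.image_preimage_eq _ (rot i s).surjective
  refine ⟨?_, ?_⟩
  · have h1 := Metric.infDist_image (t := Dᶜ) (x := x) (rot i s).isometry
    rw [e] at h1
    show 1 / ((n : ℝ) + 1) ≤ Metric.infDist (rot i s x) Dᶜ
    rw [h1]
    exact hx.1
  · have h2 := hx.2
    simp only [mem_closedBall_zero_iff] at h2 ⊢
    rwa [LinearIsometryEquiv.norm_map]

theorem aecover_exhaustion (hD : IsOpen D) (hne : Dᶜ.Nonempty) :
    AECover (volume.restrict D) Filter.atTop (exhaustion D) where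
  ae_eventually_mem := by
    filter_upwards [ae_restrict_mem hD.measurableSet] with x hx
    exact eventually_mem_exhaustion hD hne hx
  measurableSet n := (isCompact_exhaustion n).measurableSet

theorem restrict_exhaustion (n : ℕ) :
    (volume.restrict D).restrict (exhaustion D n) = volume.restrict (exhaustion D n) := by
  rw [Measure.restrict_restrict (isCompact_exhaustion n).measurableSet,
    Set.inter_eq_left.mpr (exhaustion_subset n)]

/-- Two densities that are comparable up to terms with nonnegative integrals over an exhaustion
have comparable integrals. -/
theorem integral_comparison (hD : IsOpen D) (hne : Dᶜ.Nonempty) {a b e₁ e₂ : Space → ℝ}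
    {k₁ k₂ k₃ : ℝ} (hk₁ : 0 < k₁) (hk₃ : 0 ≤ k₃)
    (ha : ContinuousOn a D) (hb : ContinuousOn b D) (he₁ : ContinuousOn e₁ D)
    (he₂ : ContinuousOn e₂ D) (ha0 : ∀ x ∈ D, 0 ≤ a x)
    (h1 : ∀ x ∈ D, e₁ x ≤ b x - k₁ * a x) (h2 : ∀ x ∈ D, e₂ x ≤ k₂ * a x - b x)
    (h3 : ∀ x ∈ D, e₁ x ≤ k₃ * a x) (h4 : ∀ x ∈ D, e₂ x ≤ k₃ * a x)
    (hi₁ : ∀ n, 0 ≤ ∫ x in exhaustion D n, e₁ x) (hi₂ : ∀ n, 0 ≤ ∫ x in exhaustion D n, e₂ x) :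
    (IntegrableOn a D ↔ IntegrableOn b D) ∧ k₁ * ∫ x in D, a x ≤ ∫ x in D, b x ∧
      ∫ x in D, b x ≤ k₂ * ∫ x in D, a x := by
  have hint {f : Space → ℝ} (hf : ContinuousOn f D) (n : ℕ) : IntegrableOn f (exhaustion D n) :=
    (hf.mono (exhaustion_subset n)).integrableOn_compact (isCompact_exhaustion n)
  have hcover := aecover_exhaustion hD hne
  have hms (n : ℕ) := (isCompact_exhaustion (D := D) n).measurableSet
  have hlow (n : ℕ) : k₁ * ∫ x in exhaustion D n, a x ≤ ∫ x in exhaustion D n, b x := by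
    have h : ∫ x in exhaustion D n, e₁ x ≤ ∫ x in exhaustion D n, (b x - k₁ * a x) :=
      setIntegral_mono_on (hint he₁ n) ((hint hb n).sub ((hint ha n).const_mul k₁)) (hms n)
        fun x hx => h1 x (exhaustion_subset n hx)
    rw [integral_sub (hint hb n) ((hint ha n).const_mul k₁), integral_const_mul] at h
    linarith [hi₁ n]
  have hup (n : ℕ) : ∫ x in exhaustion D n, b x ≤ k₂ * ∫ x in exhaustion D n, a x := by
    have h : ∫ x in exhaustion D n, e₂ x ≤ ∫ x in exhaustion D n, (k₂ * a x - b x) :=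
      setIntegral_mono_on (hint he₂ n) (((hint ha n).const_mul k₂).sub (hint hb n)) (hms n)
        fun x hx => h2 x (exhaustion_subset n hx)
    rw [integral_sub ((hint ha n).const_mul k₂) (hint hb n), integral_const_mul] at h
    linarith [hi₂ n]
  -- The density b has no sign and is not bounded by a pointwise. It is bounded by a multiple of a
  -- minus e₁ and e₂, and subtracting these cannot increase the integral; the term 2k₃ a compensates
  -- for the points where they are positive.
  have habs (n : ℕ) : ∫ x in exhaustion D n, ‖b x‖
      ≤ (|k₂| + 2 * k₃) * ∫ x in exhaustion D n, a x := by
    have h : ∫ x in exhaustion D n, ‖b x‖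
        ≤ ∫ x in exhaustion D n, ((|k₂| + 2 * k₃) * a x - e₁ x - e₂ x) := by
      refine setIntegral_mono_on (hint hb n).norm
        ((((hint ha n).const_mul _).sub (hint he₁ n)).sub (hint he₂ n)) (hms n) fun x hx => ?_
      have hx' := exhaustion_subset n hx
      have g1 := h1 x hx'
      have g2 := h2 x hx'
      have g3 := h3 x hx'
      have g4 := h4 x hx'
      have g5 : k₂ * a x ≤ |k₂| * a x := mul_le_mul_of_nonneg_right (le_abs_self _) (ha0 x hx')
      have g6 : 0 ≤ k₁ * a x := mul_nonneg hk₁.le (ha0 x hx')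
      have g7 : 0 ≤ |k₂| * a x := mul_nonneg (abs_nonneg _) (ha0 x hx')
      have g8 : 0 ≤ k₃ * a x := mul_nonneg hk₃ (ha0 x hx')
      rw [Real.norm_eq_abs, abs_le, add_mul, mul_assoc]
      constructor <;> linarith
    have h' := integral_sub (((hint ha n).const_mul (|k₂| + 2 * k₃)).sub (hint he₁ n)) (hint he₂ n)
    simp only [Pi.sub_apply] at h'
    rw [h', integral_sub ((hint ha n).const_mul _) (hint he₁ n), integral_const_mul] at h
    linarith [hi₁ n, hi₂ n]
  have hmono {f : Space → ℝ} (hf : IntegrableOn f D) (h0 : ∀ x ∈ D, 0 ≤ f x) (n : ℕ) :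
      ∫ x in exhaustion D n, f x ≤ ∫ x in D, f x :=
    setIntegral_mono_set hf (by
      filter_upwards [ae_restrict_mem hD.measurableSet] with x hx using h0 x hx)
      (exhaustion_subset n).eventuallyLE
  have hab : IntegrableOn a D → IntegrableOn b D := by
    intro h
    refine hcover.integrable_of_integral_norm_bounded ((|k₂| + 2 * k₃) * ∫ x in D, a x)
      (fun n => ?_) (Filter.Eventually.of_forall fun n => ?_)
    · rw [IntegrableOn, restrict_exhaustion]
      exact hint hb n
    · rw [restrict_exhaustion]
      exact (habs n).trans (mul_le_mul_of_nonneg_left (hmono h ha0 n) (by positivity))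
  have hba : IntegrableOn b D → IntegrableOn a D := by
    intro h
    refine hcover.integrable_of_integral_bounded_of_nonneg_ae (k₁⁻¹ * ∫ x in D, ‖b x‖)
        (fun n => ?_) ?_ (Filter.Eventually.of_forall fun n => ?_)
    · rw [IntegrableOn, restrict_exhaustion]
      exact hint ha n
    · filter_upwards [ae_restrict_mem hD.measurableSet] with x hx using ha0 x hx
    · rw [restrict_exhaustion, le_inv_mul_iff₀ hk₁]
      refine (hlow n).trans (le_trans ?_ (hmono h.norm (fun _ _ => norm_nonneg _) n))
      exact (Real.le_norm_self _).trans (norm_integral_le_integral_norm _)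
  refine ⟨⟨hab, hba⟩, ?_⟩
  by_cases h : IntegrableOn a D
  · have ta := hcover.integral_tendsto_of_countably_generated h
    have tb := hcover.integral_tendsto_of_countably_generated (hab h)
    simp only [restrict_exhaustion] at ta tb
    exact ⟨le_of_tendsto_of_tendsto' (ta.const_mul k₁) tb hlow,
      le_of_tendsto_of_tendsto' tb (ta.const_mul k₂) hup⟩
  -- Without integrability both integrals are 0 by convention, and the inequalities are trivial.
  · rw [integral_undef h, integral_undef (mt hba h)]
    simp

end

/-! ### Continuity of the densities -/

section

variable {M : ℝ} {p : Point} {T : TensorField}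

theorem continuousAt_pd {f : Point → ℝ} (hf : ContDiffAt ℝ 1 f p) (a : Fin 4) :
    ContinuousAt (pd a f) p :=
  ((hf.fderiv_right (m := 0) (by simp)).continuousAt).clm_apply continuousAt_const

theorem contDiffAt_metric (hM : 0 < M) (hp : p ∈ exterior M) {n : WithTop ℕ∞} (a b : Fin 4) :
    ContDiffAt ℝ n (fun y => metric M y a b) p := by
  have h1 := contDiffAt_lapse (radius_pos hM hp) M (n := n)
  have h2 := fun a => contDiffAt_dr (radius_pos hM hp) a (n := n)
  have h3 := (lapse_pos hM hp).ne'
  simp only [metric_eq]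
  fun_prop (disch := assumption)

theorem continuousAt_invMetric (hM : 0 < M) (hp : p ∈ exterior M) (a b : Fin 4) :
    ContinuousAt (fun y => invMetric M y a b) p :=
  (contDiffAt_invMetric hM hp a b (n := 0)).continuousAt

theorem continuousAt_divSnd (hM : 0 < M) (hp : p ∈ exterior M)
    (hT : ∀ a b, ContDiffAt ℝ 1 (fun y => T y a b) p) (a : Fin 4) :
    ContinuousAt (fun y => divSnd M T y a) p := by
  have h1 := continuousAt_invMetric hM hp
  have h2 := fun a b => (hT a b).continuousAt
  have h3 := fun c a b => continuousAt_pd (hT a b) c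
  have h4 := fun c a b => continuousAt_pd (contDiffAt_metric hM hp a b) c
  unfold divSnd covDeriv christoffel
  fun_prop

theorem continuousAt_beta (hM : 0 < M) (hp : p ∈ exterior M) {F : TensorField}
    (hF : ∀ a b, ContDiffAt ℝ 1 (fun y => F y a b) p) (a : Fin 4) :
    ContinuousAt (fun y => beta M F y a) p := by
  have hZ := contDiffAt_Z hM hp hF
  have hhZ := contDiffAt_hodge hM hp hZ
  have h1 := continuousAt_divSnd hM hp hZ
  have h2 := continuousAt_divSnd hM hp hhZ
  have h3 := fun a b => (hZ a b).continuousAt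
  have h4 := fun a b => (hhZ a b).continuousAt
  have h5 (a : Fin 4) : ContinuousAt (fun y => Uup M y a) p := by
    have h1 := continuousAt_invMetric hM hp
    have h2 := fun c => continuousAt_pd (contDiffAt_radius (radius_pos hM hp)) c
    have h3 : ContinuousAt radius p := (contDiffAt_radius (radius_pos hM hp) (n := 0)).continuousAt
    have h4 := (radius_pos hM hp).ne'
    unfold Uup U
    fun_prop (disch := assumption)
  have h6 : ContinuousAt (fun y => ∑ b, Uup M y b * Z M F y a b) p := by fun_prop
  have h7 : ContinuousAt (fun y => ∑ b, Uup M y b * hodge M (Z M F) y a b) p := by fun_prop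
  have hc {g : Point → ℝ} (hg : ContinuousAt g p) : ContinuousAt (fun y => (g y : ℂ)) p :=
    Complex.continuous_ofReal.continuousAt.comp hg
  exact (((continuousAt_const.mul (hc h6)).sub (continuousAt_const.mul (hc h7))).sub
    (continuousAt_const.mul (hc (h1 a)))).sub (continuousAt_const.mul (hc (h2 a)))

theorem contDiffAt_q (hM : 0 < M) (hp : p ∈ exterior M) {n : WithTop ℕ∞} :
    ContDiffAt ℝ n (q M) p := by
  have h1 := contDiffAt_radius (radius_pos hM hp) (n := n)
  have h2 := radius_pos hM hp
  unfold q
  fun_prop (disch := positivity)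

theorem continuousAt_re {g : Point → ℂ} (hg : ContinuousAt g p) :
    ContinuousAt (fun y => (g y).re) p :=
  Complex.continuous_re.continuousAt.comp hg

theorem continuousAt_betaUp (hM : 0 < M) (hp : p ∈ exterior M) {F : TensorField}
    (hF : ∀ a b, ContDiffAt ℝ 1 (fun y => F y a b) p) (a : Fin 4) :
    ContinuousAt (fun y => betaUp M F y a) p := by
  have h1 := continuousAt_invMetric hM hp
  have h3 := continuousAt_beta hM hp hF
  unfold betaUp
  fun_prop

theorem continuousAt_H (hM : 0 < M) (hp : p ∈ exterior M) {F : TensorField}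
    (hF : ∀ a b, ContDiffAt ℝ 1 (fun y => F y a b) p) (a b : Fin 4) :
    ContinuousAt (fun y => H M F y a b) p := by
  have h2 := (contDiffAt_metric hM hp a b (n := 0)).continuousAt
  have h3 := continuousAt_beta hM hp hF
  have h4 := continuousAt_betaUp hM hp hF
  have h5 : ContinuousAt (fun y => beta M F y a * star (beta M F y b)) p :=
    (h3 a).mul (h3 b).star
  have h6 : ContinuousAt (fun y => ∑ c, betaUp M F y c * star (beta M F y c)) p :=
    tendsto_finsetSum _ fun c _ => (h4 c).mul (h3 c).star
  exact (continuousAt_re h5).sub ((continuousAt_const.mul h2).mul (continuousAt_re h6))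

theorem continuousAt_currentXi (hM : 0 < M) (hp : p ∈ exterior M) {F : TensorField}
    (hF : ∀ a b, ContDiffAt ℝ 1 (fun y => F y a b) p) (a : Fin 4) :
    ContinuousAt (fun y => currentXi M F y a) p :=
  tendsto_finsetSum _ fun b _ => (continuousAt_H hM hp hF a b).mul continuousAt_const

theorem continuousAt_currentXiAq (hM : 0 < M) (hp : p ∈ exterior M) {F : TensorField}
    (hF : ∀ a b, ContDiffAt ℝ 1 (fun y => F y a b) p) (a : Fin 4) :
    ContinuousAt (fun y => currentXiAq M F y a) p := by
  have h1 := continuousAt_invMetric hM hp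
  have h4 := fun a b => (contDiffAt_Z hM hp hF a b).continuousAt
  have h5 := fun a b => (contDiffAt_hodge hM hp (contDiffAt_Z hM hp hF) a b).continuousAt
  have h6 := (contDiffAt_q hM hp (n := 0)).continuousAt
  have h7 := continuousAt_pd (contDiffAt_q hM hp)
  have h8 := (contDiffAt_radius (radius_pos hM hp) (n := 0)).continuousAt
  have h9 := radius_pos hM hp
  have hU := continuousAt_betaUp hM hp hF
  have hU' := fun b => (hU b).star
  have hA (b : Fin 4) : ContinuousAt (fun y => A M y b) p := by
    refine ContinuousAt.mul (by fun_prop (disch := positivity)) ?_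
    split_ifs
    · exact continuousAt_const
    · exact (continuous_apply b).continuousAt.div h8 h9.ne'
  have hC : ContinuousAt (fun y => crossTerm M F y a) p := by
    unfold crossTerm
    fun_prop
  have hHA : ContinuousAt (fun y => ∑ b, H M F y a b * A M y b) p :=
    tendsto_finsetSum _ fun b _ => (continuousAt_H hM hp hF a b).mul (hA b)
  have hZZ (a b : Fin 4) : ContinuousAt (fun y => ZZ M F y a b) p := by
    unfold ZZ
    fun_prop
  exact (continuousAt_currentXi hM hp hF a).add
    (((hHA.add (continuousAt_re hC)).add (by fun_prop)).sub (by fun_prop))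

theorem continuousAt_nullComp (hM : 0 < M) (hp : p ∈ exterior M) {J : Point → Fin 4 → ℝ}
    (hJ : ∀ a, ContinuousAt (fun y => J y a) p) (s : ℝ) :
    ContinuousAt (fun y => nullComp M s y (J y)) p := by
  have h1 := (contDiffAt_lapse (radius_pos hM hp) M (n := 0)).continuousAt
  have h2 := fun a => (contDiffAt_dr (radius_pos hM hp) a (n := 0)).continuousAt
  unfold nullComp
  fun_prop

theorem continuousAt_poincareDefect (hM : 0 < M) (hp : p ∈ exterior M) {F : TensorField}
    (hF : ∀ a b, ContDiffAt ℝ 1 (fun y => F y a b) p) (s : ℝ) :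
    ContinuousAt (poincareDefect M s F) p := by
  have hw := contDiffAt_nullContr hM hp (contDiffAt_Z hM hp hF) s
  have h1 := fun b => (hw b).continuousAt
  have h2 := fun a b => continuousAt_pd (hw b) a
  have h3 := fun a => (contDiffAt_dr (radius_pos hM hp) a (n := 0)).continuousAt
  have h4 := (contDiffAt_radius (radius_pos hM hp) (n := 0)).continuousAt
  have h5 := radius_pos hM hp
  unfold poincareDefect divergence radialCurl
  fun_prop (disch := positivity)

end

/-! ### The Poincaré defect on a slice and the bounds on the fluxes -/

section

variable {M : ℝ}

/-- The defect drops a nonnegative multiple of |w|² from 4|β(ℓ_s)|². This supplies the pointwise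
upper bound on the error terms that `integral_comparison` requires. -/
theorem poincareDefect_le {p : Point} (F : TensorField) (hM : 0 < M) (hp : p ∈ exterior M)
    (hF : ∀ a b, ContDiffAt ℝ 1 (fun y => F y a b) p) {s : ℝ} (hs : s ^ 2 = 1) :
    poincareDefect M s F p ≤ 8 * nullComp M s p (currentXi M F p) := by
  have h1 : 0 ≤ 2 * (∑ b, nullContr M s (Z M F) p b ^ 2) / radius p ^ 2 := by positivity
  have h2 := mul_nonneg (lapse_pos hM hp).le (betaTanSq_nonneg F (M := M) (p := p))
  rw [nullComp_currentXi F hM hp hs, normSq_betaNull F hM hp hF hs, poincareDefect]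
  linarith

theorem nullComp_currentXi_nonneg {p : Point} (F : TensorField) (hM : 0 < M) (hp : p ∈ exterior M)
    {s : ℝ} (hs : s ^ 2 = 1) : 0 ≤ nullComp M s p (currentXi M F p) := by
  have h2 := mul_nonneg (lapse_pos hM hp).le (betaTanSq_nonneg F (M := M) (p := p))
  have h3 := Complex.normSq_nonneg (betaNull M s F p)
  rw [nullComp_currentXi F hM hp hs]
  linarith

namespace SpacelikeSlice

variable {S : SpacelikeSlice M} {x : Space}

theorem hasFDerivAt_graph (hx : x ∈ S.dom) :
    HasFDerivAt S.graph (ContinuousLinearMap.pi (Fin.cases (fderiv ℝ S.height x)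
      fun j => (EuclideanSpace.proj j : Space →L[ℝ] ℝ))) x := by
  refine hasFDerivAt_pi.mpr fun b => Fin.cases ?_ (fun j => ?_) b
  · exact (differentiableAt_height hx).hasFDerivAt
  · simp only [graph, point_succ, Fin.cases_succ]
    exact (EuclideanSpace.proj j : Space →L[ℝ] ℝ).hasFDerivAt

theorem contDiffOn_graph (S : SpacelikeSlice M) : ContDiffOn ℝ ∞ S.graph S.dom := by
  refine contDiffOn_pi.mpr fun b => Fin.cases ?_ (fun j => ?_) b
  · exact S.smooth
  · simp only [graph, point_succ]
    exact (EuclideanSpace.proj j : Space →L[ℝ] ℝ).contDiff.contDiffOn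

theorem spd_comp_graph (hx : x ∈ S.dom) {w : Point → ℝ} (hw : DifferentiableAt ℝ w (S.graph x))
    (i : Fin 3) : spd i (fun y => w (S.graph y)) x
      = spd i S.height x * pd 0 w (S.graph x) + pd i.succ w (S.graph x) := by
  have h : HasFDerivAt (fun y => w (S.graph y)) _ x := hw.hasFDerivAt.comp x (hasFDerivAt_graph hx)
  have e : (ContinuousLinearMap.pi (Fin.cases (fderiv ℝ S.height x)
      fun j => (EuclideanSpace.proj j : Space →L[ℝ] ℝ)) : Space →L[ℝ] Point)
        (EuclideanSpace.single i 1)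
      = spd i S.height x • Pi.single 0 1 + Pi.single i.succ 1 := by
    funext b
    refine Fin.cases ?_ (fun j => ?_) b
    · simp [spd, (Fin.succ_ne_zero i).symm]
    · simp [Pi.single_apply, Fin.succ_ne_zero]
  rw [spd, h.fderiv, ContinuousLinearMap.comp_apply, e, map_add, map_smul, smul_eq_mul]
  rfl

/-- The null component of `Z` on a slice, as a vector field on space. -/
def nullField (S : SpacelikeSlice M) (s : ℝ) (F : TensorField) (j : Fin 3) (x : Space) : ℝ :=
  nullContr M s (Z M F) (S.graph x) j.succ

variable {F : TensorField}

theorem contDiffOn_nullField (hM : 0 < M) (hF : ∀ a b, ContDiffOn ℝ ∞ (fun y => F y a b) (exterior M))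
    (s : ℝ) (j : Fin 3) : ContDiffOn ℝ ∞ (S.nullField s F j) S.dom := by
  intro x hx
  have hp := graph_mem hx
  have h := contDiffAt_nullContr hM hp (contDiffAt_Z hM hp
    fun a b => (hF a b).contDiffAt (exterior_mem_nhds hp)) s j.succ
  exact h.comp_contDiffWithinAt x (S.contDiffOn_graph x hx)

theorem sum_mul_nullField (hM : 0 < M) (hx : x ∈ S.dom) (s : ℝ) :
    ∑ j, x j * S.nullField s F j x = 0 := by
  have h := (isExtreme_Z hM F).sum_dr_nullContr (graph_mem hx) s
  rw [graph, sum_dr_point_mul, div_eq_zero_iff] at h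
  exact h.resolve_right (norm_pos hM hx).ne'

theorem sum_nullField_sq (hM : 0 < M) (hx : x ∈ S.dom) (s : ℝ) :
    ∑ j, S.nullField s F j x ^ 2 = ∑ b, nullContr M s (Z M F) (S.graph x) b ^ 2 := by
  rw [Fin.sum_univ_succ (n := 3), (isExtreme_Z hM F).nullContr_zero (graph_mem hx)]
  simp [nullField]

section

variable (hM : 0 < M) (hS : S.IsSphericallySymmetric) (hx : x ∈ S.dom)
  (hF : ∀ a b, ContDiffAt ℝ 1 (fun y => F y a b) (S.graph x))

include hM hS hx hF

theorem spd_nullField (s : ℝ) (i j : Fin 3) : spd i (S.nullField s F j) x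
    = S.slope x * (x i / ‖x‖) * pd 0 (fun y => nullContr M s (Z M F) y j.succ) (S.graph x)
      + pd i.succ (fun y => nullContr M s (Z M F) y j.succ) (S.graph x) := by
  have hp := graph_mem hx
  rw [← spd_height hM hS hx, ← spd_comp_graph hx]
  · rfl
  · exact (contDiffAt_nullContr hM hp (contDiffAt_Z hM hp hF) s _).differentiableAt (by simp)

/-- Tilting the slice adds slope times n · ∂_t w, which vanishes because w stays tangential. So the
Euclidean divergence along the slice is the one taken at fixed t. -/
theorem flatDiv_nullField (s : ℝ) :
    flatDiv (S.nullField s F) x = divergence (nullContr M s (Z M F)) (S.graph x) := by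
  have hp := graph_mem hx
  have hZ := isExtreme_Z hM F
  have h := hZ.toIsTransverse.sum_dr_pd_nullContr hM hp
    (fun a b => (contDiffAt_Z hM hp hF a b).differentiableAt (by simp)) s 0
  rw [hZ.nullContr_zero hp, neg_zero, zero_div, graph, sum_dr_point_mul] at h
  simp only [flatDiv, spd_nullField hM hS hx hF, Finset.sum_add_distrib]
  rw [divergence, Fin.sum_univ_succ (n := 3), hZ.pd_nullContr_zero hp, zero_add, add_eq_right,
    ← mul_zero (S.slope x), ← h, Finset.sum_div, Finset.mul_sum]
  exact Finset.sum_congr rfl fun i _ => by rw [graph]; ring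

/-- The contribution of the slope involves x × x and vanishes. The sign reflects the order of the
indices in `radialCurl`. -/
theorem positionCurl_nullField (s : ℝ) : positionCurl (S.nullField s F) x
    = -(‖x‖ * radialCurl (nullContr M s (Z M F)) (S.graph x)) := by
  have hn := (norm_pos hM hx).ne'
  have e0 (i : Fin 3) : dr (S.graph x) i.succ = x i / ‖x‖ := dr_point _ _ _
  have e1 : dr (S.graph x) 1 = x 0 / ‖x‖ := e0 0
  have e2 : dr (S.graph x) 2 = x 1 / ‖x‖ := e0 1
  have e3 : dr (S.graph x) 3 = x 2 / ‖x‖ := e0 2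
  simp only [positionCurl, rotDer_eq, spd_nullField hM hS hx hF, Fin.sum_univ_three]
  simp [radialCurl, Fin.sum_univ_four, leviCivita_eq, e1, e2, e3]
  norm_num
  field_simp
  ring

theorem poincareDefect_graph (s : ℝ) :
    ‖x‖ ^ 2 * flatDiv (S.nullField s F) x ^ 2 + positionCurl (S.nullField s F) x ^ 2
      - 2 * ∑ j, S.nullField s F j x ^ 2 = ‖x‖ ^ 2 * poincareDefect M s F (S.graph x) := by
  have hn := (norm_pos hM hx).ne'
  rw [flatDiv_nullField hM hS hx hF, positionCurl_nullField hM hS hx hF, sum_nullField_sq hM hx,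
    poincareDefect, show radius (S.graph x) = ‖x‖ from radius_point _ _]
  field_simp

end

/-- The Euclidean inequality is applied with the weight ψ/‖x‖², since its integrand is ‖x‖² times
the defect. -/
theorem setIntegral_poincareDefect_nonneg (hM : 0 < M) (hS : S.IsSphericallySymmetric)
    (hF : ∀ a b, ContDiffOn ℝ ∞ (fun y => F y a b) (exterior M)) (s : ℝ) {K : Set Space}
    (hK : IsCompact K) (hKD : K ⊆ S.dom) (hinv : RotInvariant K) {ψ : Space → ℝ}
    (hψ : ContinuousOn ψ K) (hψ0 : ∀ x ∈ K, 0 ≤ ψ x)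
    (hψi : ∀ i s, ∀ x ∈ K, ψ (rot i s x) = ψ x) :
    0 ≤ ∫ x in K, ψ x * poincareDefect M s F (S.graph x) := by
  have h := poincare_inequality S.isOpen_dom (fun h => by
      have := norm_pos hM h
      simp at this) hK hKD hinv (φ := fun x => ψ x / ‖x‖ ^ 2)
    (hψ.div (by fun_prop) fun x hx => by
      have := norm_pos hM (hKD hx)
      positivity)
    (fun x hx => div_nonneg (hψ0 x hx) (by positivity))
    (fun i s x hx => by rw [hψi i s x hx, LinearIsometryEquiv.norm_map])
    (fun j => (contDiffOn_nullField hM hF s j).of_le (WithTop.coe_le_coe.mpr (le_top : (2 : ℕ∞) ≤ ⊤)))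
    (fun x hx => sum_mul_nullField hM hx s)
  refine h.trans_eq (setIntegral_congr_fun hK.measurableSet fun x hx => ?_)
  have hp := graph_mem (hKD hx)
  have hn := (norm_pos hM (hKD hx)).ne'
  rw [poincareDefect_graph hM hS (hKD hx) fun a b =>
    ((hF a b).contDiffAt (exterior_mem_nhds hp)).of_le (by simp)]
  field_simp

theorem continuousOn_comp_graph {f : Point → ℝ} (hf : ∀ p ∈ exterior M, ContinuousAt f p) :
    ContinuousOn (fun x => f (S.graph x)) S.dom := fun x hx =>
  ((hf _ (graph_mem hx)).comp_continuousWithinAt (S.contDiffOn_graph.continuousOn x hx))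

theorem continuousOn_velocity (hM : 0 < M) : ContinuousOn S.velocity S.dom := by
  have h1 : ContinuousOn (fun x => lapse M (S.graph x)) S.dom := continuousOn_comp_graph
    fun p hp => (contDiffAt_lapse (radius_pos hM hp) M (n := 0)).continuousAt
  have h2 := S.smooth.continuousOn_fderiv_of_isOpen S.isOpen_dom (by simp)
  exact h1.mul ((h2.clm_apply continuousOn_id).div continuousOn_id.norm
    fun x hx => (norm_pos hM hx).ne')

theorem continuousOn_fluxDensity (hM : 0 < M) (hS : S.IsSphericallySymmetric)
    {J : Point → Fin 4 → ℝ} (hJ : ∀ p ∈ exterior M, ∀ a, ContinuousAt (fun y => J y a) p) :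
    ContinuousOn (S.fluxDensity J) S.dom := by
  have h1 : ContinuousOn (fun x => lapse M (S.graph x)) S.dom := continuousOn_comp_graph
    fun p hp => (contDiffAt_lapse (radius_pos hM hp) M (n := 0)).continuousAt
  have h2 := continuousOn_velocity (S := S) hM
  have h3 := fun s => continuousOn_comp_graph (S := S)
    fun p hp => continuousAt_nullComp hM hp (hJ p hp) s
  refine ContinuousOn.congr ?_ fun x hx => fluxDensity_eq hM hS hx J
  refine ContinuousOn.mul ((continuousOn_const.mul h1).inv₀ fun x hx => ?_) ?_
  · exact mul_ne_zero two_ne_zero (lapse_pos hM (graph_mem hx)).ne'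
  · exact ((continuousOn_const.add h2).mul (h3 1)).add ((continuousOn_const.sub h2).mul (h3 (-1)))

/-- The coefficient of the Poincaré defect in the comparison of the flux densities. -/
def defectWeight (S : SpacelikeSlice M) (s k : ℝ) (x : Space) : ℝ :=
  (2 * lapse M (S.graph x))⁻¹ * (1 + s * S.velocity x)
    * (1 / 8 * (9 / 10 + k * ((‖x‖ - 3 * M) / (2 * ‖x‖))))

theorem continuousOn_defectWeight (hM : 0 < M) (s k : ℝ) :
    ContinuousOn (S.defectWeight s k) S.dom := by
  have h1 : ContinuousOn (fun x => lapse M (S.graph x)) S.dom := continuousOn_comp_graph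
    fun p hp => (contDiffAt_lapse (radius_pos hM hp) M (n := 0)).continuousAt
  have h2 := continuousOn_velocity (S := S) hM
  have h3 : ∀ x ∈ S.dom, 2 * ‖x‖ ≠ 0 := fun x hx => (mul_pos two_pos (norm_pos hM hx)).ne'
  have h4 : ∀ x ∈ S.dom, 2 * lapse M (S.graph x) ≠ 0 := fun x hx =>
    (mul_pos two_pos (lapse_pos hM (graph_mem hx))).ne'
  unfold defectWeight
  fun_prop (disch := assumption)

/-- Outside the horizon |(r - 3M)/(2r)| ≤ 1/2, so its last factor lies between 2/5 and 7/5, up to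
the 1/8. Nonnegativity permits the Poincaré inequality; the upper bound serves `excess_le`. -/
theorem defectWeight_bounds (hM : 0 < M) (hS : S.IsSphericallySymmetric) (hx : x ∈ S.dom)
    {s k : ℝ} (hs : s = 1 ∨ s = -1) (hk : k = 1 ∨ k = -1) : 0 ≤ S.defectWeight s k x ∧
      S.defectWeight s k x
        ≤ (2 * lapse M (S.graph x))⁻¹ * (1 + s * S.velocity x) * (1 / 8 * (7 / 5)) := by
  have hn := norm_pos hM hx
  have hr := S.dom_subset x hx
  have hv := abs_lt.mp (abs_velocity_lt hM hS hx)
  have hf := lapse_pos hM (graph_mem hx)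
  have h1 : (‖x‖ - 3 * M) / (2 * ‖x‖) ≤ 1 / 2 := by
    rw [div_le_iff₀ (by positivity)]
    linarith
  have h2 : -(1 / 2) ≤ (‖x‖ - 3 * M) / (2 * ‖x‖) := by
    rw [le_div_iff₀ (by positivity)]
    linarith
  have h3 : 0 ≤ (2 * lapse M (S.graph x))⁻¹ * (1 + s * S.velocity x) := by
    have : 0 ≤ 1 + s * S.velocity x := by rcases hs with rfl | rfl <;> linarith
    positivity
  constructor
  · refine mul_nonneg h3 ?_
    rcases hk with rfl | rfl <;> linarith
  · refine mul_le_mul_of_nonneg_left ?_ h3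
    rcases hk with rfl | rfl <;> linarith

theorem defectWeight_rot (hS : S.IsSphericallySymmetric) (hx : x ∈ S.dom) (s k : ℝ) (i : Fin 3)
    (u : ℝ) : S.defectWeight s k (rot i u x) = S.defectWeight s k x := by
  simp only [defectWeight, rot_velocity hS hx, LinearIsometryEquiv.norm_map, lapse, graph,
    radius_point]

/-- A lower bound for the excess of the flux densities, up to nonnegative terms. -/
def excess (S : SpacelikeSlice M) (F : TensorField) (k : ℝ) (x : Space) : ℝ :=
  S.defectWeight 1 k x * poincareDefect M 1 F (S.graph x)
    + S.defectWeight (-1) (-k) x * poincareDefect M (-1) F (S.graph x)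

section

variable (hM : 0 < M) (hS : S.IsSphericallySymmetric)
  (hF : ∀ a b, ContDiffOn ℝ ∞ (fun y => F y a b) (exterior M))

include hM hF

theorem continuousOn_defectWeight_mul (s k : ℝ) : ContinuousOn
    (fun x => S.defectWeight s k x * poincareDefect M s F (S.graph x)) S.dom :=
  (continuousOn_defectWeight hM s k).mul (continuousOn_comp_graph fun _ hp =>
    continuousAt_poincareDefect hM hp (fun a b =>
      ((hF a b).contDiffAt (exterior_mem_nhds hp)).of_le (by simp)) s)

include hS

theorem setIntegral_excess_nonneg {k : ℝ} (hk : k = 1 ∨ k = -1) {K : Set Space}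
    (hK : IsCompact K) (hKD : K ⊆ S.dom) (hinv : RotInvariant K) :
    0 ≤ ∫ x in K, S.excess F k x := by
  have hk' : -k = 1 ∨ -k = -1 := by rcases hk with rfl | rfl <;> simp
  have h {s k : ℝ} (hs : s = 1 ∨ s = -1) (hk : k = 1 ∨ k = -1) :
      0 ≤ ∫ x in K, S.defectWeight s k x * poincareDefect M s F (S.graph x) :=
    setIntegral_poincareDefect_nonneg hM hS hF s hK hKD hinv
      ((continuousOn_defectWeight hM s k).mono hKD)
      (fun x hx => (defectWeight_bounds hM hS (hKD hx) hs hk).1)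
      fun i u x hx => defectWeight_rot hS (hKD hx) s k i u
  have hi (s k : ℝ) : IntegrableOn _ K volume := ((continuousOn_defectWeight_mul (S := S) hM hF s k).mono
    hKD).integrableOn_compact hK
  simp only [excess]
  rw [integral_add (hi 1 k) (hi (-1) (-k))]
  exact add_nonneg (h (Or.inl rfl) hk) (h (Or.inr rfl) hk')

theorem excess_le {k : ℝ} (hk : k = 1 ∨ k = -1) (hx : x ∈ S.dom) :
    S.excess F k x ≤ 7 / 5 * S.fluxDensity (currentXi M F) x := by
  have hp := graph_mem hx
  have hk' : -k = 1 ∨ -k = -1 := by rcases hk with rfl | rfl <;> simp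
  have h {s k : ℝ} (hs : s = 1 ∨ s = -1) (hk : k = 1 ∨ k = -1) :
      S.defectWeight s k x * poincareDefect M s F (S.graph x)
        ≤ (2 * lapse M (S.graph x))⁻¹ * (1 + s * S.velocity x) * (1 / 8 * (7 / 5))
          * (8 * nullComp M s (S.graph x) (currentXi M F (S.graph x))) := by
    have hs2 : s ^ 2 = 1 := by rcases hs with rfl | rfl <;> norm_num
    obtain ⟨h1, h2⟩ := defectWeight_bounds hM hS hx hs hk
    have h3 := nullComp_currentXi_nonneg F hM hp hs2
    exact (mul_le_mul_of_nonneg_left (poincareDefect_le F hM hp (fun a b =>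
      ((hF a b).contDiffAt (exterior_mem_nhds hp)).of_le (by simp)) hs2) h1).trans
      (mul_le_mul_of_nonneg_right h2 (by positivity))
  rw [excess, fluxDensity_eq hM hS hx]
  refine (add_le_add (h (Or.inl rfl) hk) (h (Or.inr rfl) hk')).trans_eq ?_
  ring

/-- Both null bounds of `nullComp_bounds` are added with the nonnegative coefficients (1 ± v)/(2f)
of the flux. -/
theorem excess_bounds (hx : x ∈ S.dom) :
    S.excess F 1 x ≤ S.fluxDensity (currentXiAq M F) x
        - 1 / 10 * S.fluxDensity (currentXi M F) x ∧
      S.excess F (-1) x ≤ 19 / 10 * S.fluxDensity (currentXi M F) x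
        - S.fluxDensity (currentXiAq M F) x := by
  have hp := graph_mem hx
  have hF' : ∀ a b, ContDiffAt ℝ 1 (fun y => F y a b) (S.graph x) := fun a b =>
    ((hF a b).contDiffAt (exterior_mem_nhds hp)).of_le (by simp)
  have hv := abs_lt.mp (abs_velocity_lt hM hS hx)
  have hf := lapse_pos hM hp
  have c1 : 0 ≤ (2 * lapse M (S.graph x))⁻¹ * (1 + S.velocity x) :=
    mul_nonneg (by positivity) (by linarith)
  have c2 : 0 ≤ (2 * lapse M (S.graph x))⁻¹ * (1 - S.velocity x) :=
    mul_nonneg (by positivity) (by linarith)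
  obtain ⟨a1, a2⟩ := nullComp_bounds F hM hp hF' (s := 1) (Or.inl rfl)
  obtain ⟨b1, b2⟩ := nullComp_bounds F hM hp hF' (s := -1) (Or.inr rfl)
  simp only [show radius (S.graph x) = ‖x‖ from radius_point _ _] at a1 a2 b1 b2
  rw [fluxDensity_eq hM hS hx, fluxDensity_eq hM hS hx, excess, excess, defectWeight, defectWeight,
    defectWeight, defectWeight]
  constructor
  · linear_combination mul_le_mul_of_nonneg_left a1 c1 + mul_le_mul_of_nonneg_left b1 c2
  · linear_combination mul_le_mul_of_nonneg_left a2 c1 + mul_le_mul_of_nonneg_left b2 c2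

end

theorem fluxDensity_currentXi_nonneg (F : TensorField) (hM : 0 < M)
    (hS : S.IsSphericallySymmetric) (hx : x ∈ S.dom) :
    0 ≤ S.fluxDensity (currentXi M F) x := by
  have hp := graph_mem hx
  have hv := abs_lt.mp (abs_velocity_lt hM hS hx)
  have hf := lapse_pos hM hp
  have h1 : 0 ≤ 1 + S.velocity x := by linarith
  have h2 : 0 ≤ 1 - S.velocity x := by linarith
  have a1 := nullComp_currentXi_nonneg F hM hp (s := 1) (by norm_num)
  have b1 := nullComp_currentXi_nonneg F hM hp (s := -1) (by norm_num)
  rw [fluxDensity_eq hM hS hx]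
  positivity

end SpacelikeSlice

end

end Schwarzschild

end

/-! ### Comparison of the two energies -/

theorem mainTheorem4 (M : ℝ) (hM : 0 < M) (F : Schwarzschild.TensorField)
    (hF : Schwarzschild.IsMaxwellField M F) (S : Schwarzschild.SpacelikeSlice M)
    (hS : S.IsSphericallySymmetric) :
    (S.FluxIntegrable (Schwarzschild.currentXi M F) ↔
        S.FluxIntegrable (Schwarzschild.currentXiAq M F)) ∧
      1 / 10 * Schwarzschild.energyXi F S ≤ Schwarzschild.energyXiAq F S ∧
      Schwarzschild.energyXiAq F S ≤ 19 / 10 * Schwarzschild.energyXi F S := by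
  have hF1 : ∀ p ∈ Schwarzschild.exterior M, ∀ a b, ContDiffAt ℝ 1 (fun y => F y a b) p :=
    fun p hp a b =>
      ((hF.smooth a b).contDiffAt (Schwarzschild.exterior_mem_nhds hp)).of_le (by simp)
  have hcont (k : ℝ) : ContinuousOn (S.excess F k) S.dom :=
    (Schwarzschild.SpacelikeSlice.continuousOn_defectWeight_mul hM hF.smooth 1 k).add
      (Schwarzschild.SpacelikeSlice.continuousOn_defectWeight_mul hM hF.smooth (-1) (-k))
  have hnonneg {k : ℝ} (hk : k = 1 ∨ k = -1) (n : ℕ) :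
      0 ≤ ∫ x in Schwarzschild.exhaustion S.dom n, S.excess F k x :=
    Schwarzschild.SpacelikeSlice.setIntegral_excess_nonneg hM hS hF.smooth hk
      (Schwarzschild.isCompact_exhaustion n) (Schwarzschild.exhaustion_subset n)
      (Schwarzschild.rotInvariant_exhaustion
        (Schwarzschild.SpacelikeSlice.rotInvariant_dom hS) n)
  -- The exhaustion uses `Metric.infDist` to the complement, which would be 0 for an empty
  -- complement; the origin lies in it.
  have hne : S.domᶜ.Nonempty := ⟨0, fun h => by
    have := Schwarzschild.SpacelikeSlice.norm_pos hM h
    simp at this⟩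
  -- The constant 7/5 = 9/10 + 1/2 is the one in `excess_le`; it affects only the integrability
  -- statement, not the two inequalities.
  exact Schwarzschild.integral_comparison S.isOpen_dom hne (k₃ := 7 / 5) (by norm_num)
    (by norm_num)
    (Schwarzschild.SpacelikeSlice.continuousOn_fluxDensity hM hS fun p hp =>
      Schwarzschild.continuousAt_currentXi hM hp (hF1 p hp))
    (Schwarzschild.SpacelikeSlice.continuousOn_fluxDensity hM hS fun p hp =>
      Schwarzschild.continuousAt_currentXiAq hM hp (hF1 p hp))
    (hcont 1) (hcont (-1))
    (fun x hx => Schwarzschild.SpacelikeSlice.fluxDensity_currentXi_nonneg F hM hS hx)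
    (fun x hx => (Schwarzschild.SpacelikeSlice.excess_bounds hM hS hF.smooth hx).1)
    (fun x hx => (Schwarzschild.SpacelikeSlice.excess_bounds hM hS hF.smooth hx).2)
    (fun x hx => Schwarzschild.SpacelikeSlice.excess_le hM hS hF.smooth (Or.inl rfl) hx)
    (fun x hx => Schwarzschild.SpacelikeSlice.excess_le hM hS hF.smooth (Or.inr rfl) hx)
    (hnonneg (Or.inl rfl)) (hnonneg (Or.inr rfl))
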